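/- Let $k$ be a field, $m\ge 3$ and $n\ge 1$. *Iyama's algebras.* Let $T_m^{(1)}(k)$ be the algebra of upper triangular $m\times m$ matrices over $k$, and for $n\ge1$ let $T_m^{(n+1)}(k)=\operatorname{End}_{\Lambda}(M)$ be the cone of $\Lambda=T_m^{(n)}(k)$, where $M=\bigoplus_{i\ge 0}\tau_n^i(D\Lambda)$, $D=\operatorname{Hom}_k(-,k)$ and $\tau_n=D\operatorname{Ext}^n_\Lambda(-,\Lambda)$. *Pyramid algebras.* For an integral vector $\mathbf i=(i_1,\dots,i_p)$ put $|\mathbf i|=\sum_t i_t$, $\mathbf i(1)=\mathbf i+\mathbf e_1$ and $\mathbf i(t)=\mathbf i-\mathbf e_{t-1}+\mathbf e_t$ for $2\le t\le p$. The quiver $Q(n)$ has the vertices $\mathbf i\in\mathbb Z^n$ with $i_t\ge1$ and $\sum_{t=1}^s i_t\le m+s-1$ for $1\le s\le n$, and the arrows $\gamma_t^{\mathbf i}:\mathbf i\to\mathbf i(t)$ with $\mathbf i,\mathbf i(t)\in Q(n)_0$. Let $\Lambda^{\tilde{\mathbf g}}(n)=kQ(n)/(\rho)$, where $\rho$ consists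 of all paths $\gamma_t^{\mathbf i(t)}\gamma_t^{\mathbf i}$ and, for $t<s$, of all $-\gamma_t^{\mathbf i(s)}\gamma_s^{\mathbf i}-\gamma_s^{\mathbf i(t)}\gamma_t^{\mathbf i}$ such that $\mathbf i,\mathbf i(t),\mathbf i(s),\mathbf i(t)(s)$ are vertices. The quadratic dual $\Lambda^!$ of an algebra $\Lambda=kQ/(\rho)$ with $\rho$ a set of combinations of paths of length two is $kQ^{op}/(\rho^\perp)$. *Cuboid completions.* Let $c_{t,\mathbf j}$ be nonzero scalars such that $\gamma_t^{\mathbf j+\mathbf e_n}\mapsto c_{t,\mathbf j}\gamma_t^{\mathbf j}$ respects the commutativity relations of $\Lambda^{\tilde{\mathbf g}}(n)$ (so that it induces a graded endomorphism $g'$ over the translation $\mathbf i\mapsto\mathbf i-\mathbf e_n$), and write $\bar{\mathbf g}=(\tilde{\mathbf g},g')$. Let $\bar Q(n)$ be the quiver with vertex set $Q(n)_0\times\mathbb Z\subset\mathbb Z^{n+1}$ and all arrows $\gamma_t^{\mathbf i}:\mathbf i\to\mathbf i(t)$, $1\le t\le n+1$, between its vertices; its relations $\bar\rho(n)$ are those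 of $Q(n)$ in each layer $Q(n)_0\times\{v\}$, the paths $\gamma_{n+1}^{\mathbf i(n+1)}\gamma_{n+1}^{\mathbf i}$, and, for $s\le n$ and $\mathbf i=(\mathbf i',v)$, the elements $c_{s,\mathbf i'-\mathbf e_n}\gamma_s^{\mathbf i(n+1)}\gamma_{n+1}^{\mathbf i}-\gamma_{n+1}^{\mathbf i(s)}\gamma_s^{\mathbf i}$ whenever all the vertices involved exist. For $v\in\mathbb Z$ the $(n+1)$-cuboid completion $\Lambda^{\bar{\mathbf g}}(n+1)(v)$ of $\Lambda^{\tilde{\mathbf g}}(n)$ is the algebra of the full subquiver of $\bar Q(n)$, with the restricted relations, on the vertices $$(i_1+a_1-a_2,\dots,i_n+a_n-a_{n+1},\,v+a_{n+1}),\qquad \mathbf i\in Q(n)_0,\ \mathbf a\in\mathbb Z^{n+1},\ 0\le a_1\le m+n-1-|\mathbf i|,\ 0\le a_{t+1}\le i_t-1\ (1\le t\le n).$$ **Theorem.** $\Lambda^{\tilde{\mathbf g}}(n)^!\cong T_m^{(n)}(k)$, and there is a choice of $g'$ as above such that for every $v\in\mathbb Z$ the subquiver above is a full bound subquiver of $\bar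 Q(n)$ (every path occurring in an element of $\bar\rho(n)$ between two of its vertices lies in it) and the $(n+1)$-cuboid completion satisfies $$\Lambda^{\bar{\mathbf g}}(n+1)(v)^!\cong T_m^{(n+1)}(k)$$ as $k$-algebras. -/

import Mathlib

open CategoryTheory

universe u

/-! ## Bound quivers with quadratic relations and their algebras -/

/-- `f` is a `k`-linear combination of paths of length two, all with the same source and the
same target, in the quiver with arrows `A`, sources `src` and targets `tgt`. The pair `(a, b)`
stands for the path `a` followed by `b`, written `b a` when arrows are composed like maps. -/
def IsParallelComb {k : Type u} [Field k] {V A : Type} (src tgt : A → V)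
    (f : (A × A) →₀ k) : Prop :=
  ∀ p ∈ f.support, tgt p.1 = src p.2 ∧
    ∀ q ∈ f.support, src p.1 = src q.1 ∧ tgt p.2 = tgt q.2

/-- A bound quiver over `k` all of whose relations are combinations of paths of length two. -/
structure QuadraticQuiver (k : Type u) [Field k] where
  V : Type
  A : Type
  src : A → V
  tgt : A → V
  rel : Set ((A × A) →₀ k)
  parallel : ∀ r ∈ rel, IsParallelComb src tgt r

namespace QuadraticQuiver

variable {k : Type u} [Field k] (B : QuadraticQuiver k)

/-- The free algebra on the vertices (trivial paths) and the arrows. -/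
abbrev Gen : Type u := FreeAlgebra k (B.V ⊕ B.A)

/-- The trivial path `e_v`. -/
noncomputable def vtx (v : B.V) : B.Gen := FreeAlgebra.ι k (Sum.inl v)

/-- The path of length one along `a`. -/
noncomputable def arr (a : B.A) : B.Gen := FreeAlgebra.ι k (Sum.inr a)

/-- The defining relations of `kQ/(ρ)`: the first five present the path algebra `kQ` (the trivial
paths are orthogonal idempotents with sum `1`, and `a = e_j a e_i` for an arrow `a : i → j`),
the last one kills `ρ`. -/
inductive AlgRel : B.Gen → B.Gen → Prop
  | idem (v : B.V) : AlgRel (B.vtx v * B.vtx v) (B.vtx v)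
  | orth (v w : B.V) : v ≠ w → AlgRel (B.vtx v * B.vtx w) 0
  | complete : AlgRel (∑ᶠ v : B.V, B.vtx v) 1
  | left (a : B.A) : AlgRel (B.vtx (B.tgt a) * B.arr a) (B.arr a)
  | right (a : B.A) : AlgRel (B.arr a * B.vtx (B.src a)) (B.arr a)
  | rel (r : (B.A × B.A) →₀ k) : r ∈ B.rel →
      AlgRel (r.sum fun p c => c • (B.arr p.2 * B.arr p.1)) 0

/-- The algebra `kQ/(ρ)` of a bound quiver with finitely many vertices. -/
abbrev Alg [Finite B.V] : Type u := RingQuot B.AlgRel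

/-- The bound quiver of the quadratic dual: the opposite quiver with the relations `ρ^⊥`. The
arrow dual to `a` is denoted by `a` again, so the path dual to `(a, b)` is `(b, a)`, and `ρ^⊥`
is spanned by the combinations of parallel paths of length two that pair to zero with `ρ`. -/
noncomputable def dual : QuadraticQuiver k where
  V := B.V
  A := B.A
  src := B.tgt
  tgt := B.src
  rel := {f | IsParallelComb B.tgt B.src f ∧
    ∀ r ∈ B.rel, (r.sum fun p c => c * f p.swap) = 0}
  parallel := fun _ hf => hf.1

instance [h : Finite B.V] : Finite B.dual.V := h

/-- The quadratic dual algebra of `kQ/(ρ)`. -/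
abbrev DualAlg [Finite B.V] : Type u := B.dual.Alg

/-- The full subquiver on the vertex set `W`, with the restricted relations `ρ[W]`: the elements
of `ρ` that are combinations of paths in the subquiver. -/
noncomputable def restrict (W : Set B.V) : QuadraticQuiver k where
  V := W
  A := {a : B.A // B.src a ∈ W ∧ B.tgt a ∈ W}
  src := fun a => ⟨B.src a.1, a.2.1⟩
  tgt := fun a => ⟨B.tgt a.1, a.2.2⟩
  rel := {r | r.embDomain ((Function.Embedding.subtype _).prodMap
    (Function.Embedding.subtype _)) ∈ B.rel}
  parallel := by
    intro r hr p hp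
    have key : ∀ q ∈ r.support, (q.1.1, q.2.1) ∈ (r.embDomain
        ((Function.Embedding.subtype _).prodMap (Function.Embedding.subtype _))).support := by
      intro q hq
      rw [Finsupp.support_embDomain]
      exact Finset.mem_map.2 ⟨q, hq, rfl⟩
    obtain ⟨h1, h2⟩ := B.parallel _ hr _ (key p hp)
    refine ⟨Subtype.ext h1, fun q hq => ?_⟩
    obtain ⟨h3, h4⟩ := h2 _ (key q hq)
    exact ⟨Subtype.ext h3, Subtype.ext h4⟩

instance (W : Set B.V) [h : Finite W] : Finite (B.restrict W).V := h

/-- The full subquiver on `W` is a full bound subquiver: every path that occurs in a relation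
between two vertices of `W` is a path in the subquiver. -/
def IsFullBound (W : Set B.V) : Prop :=
  ∀ r ∈ B.rel, ∀ p ∈ r.support, B.src p.1 ∈ W → B.tgt p.2 ∈ W → B.tgt p.1 ∈ W

end QuadraticQuiver

/-! ## Cubic quivers in `ℤ^p` -/

/-- The vector `i(t)`, i.e. `i + e_1` for `t = 1` and `i - e_{t-1} + e_t` for `t ≥ 2`
(types and components are numbered from `0` here). -/
def step {p : ℕ} (t : Fin p) (i : Fin p → ℤ) : Fin p → ℤ := fun u =>
  i u + (if u = t then 1 else 0) - (if u.val + 1 = t.val then 1 else 0)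

theorem step_comm {p : ℕ} (s t : Fin p) (i : Fin p → ℤ) :
    step s (step t i) = step t (step s i) := by
  funext u
  simp only [step]
  ring

/-- The arrows `γ_t^i : i → i(t)` with `i` and `i(t)` in `S`; the pair `(t, i)` is `γ_t^i`. -/
abbrev CubicArrow {p : ℕ} (S : Set (Fin p → ℤ)) : Type :=
  {x : Fin p × (Fin p → ℤ) // x.2 ∈ S ∧ step x.1 x.2 ∈ S}

/-- The bound quiver with vertex set `S`, arrows `γ_t^i : i → i(t)`, and relations
`γ_t γ_t` (zero relations) and `d_{s,t,i} γ_t^{i(s)} γ_s^i - γ_s^{i(t)} γ_t^i` for `t < s`,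
the latter whenever `i, i(t), i(s), i(t)(s)` all lie in `S`. -/
noncomputable def cubicQuiver (k : Type u) [Field k] {p : ℕ} (S : Set (Fin p → ℤ))
    (d : Fin p → Fin p → (Fin p → ℤ) → kˣ) : QuadraticQuiver k where
  V := S
  A := CubicArrow S
  src := fun a => ⟨a.1.2, a.2.1⟩
  tgt := fun a => ⟨step a.1.1 a.1.2, a.2.2⟩
  rel := {r | ∃ (s t : Fin p) (i : Fin p → ℤ) (_ : t < s) (h0 : i ∈ S) (ht : step t i ∈ S)
        (hs : step s i ∈ S) (hts : step s (step t i) ∈ S) (hst : step t (step s i) ∈ S),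
        r = Finsupp.single
              ((⟨(s, i), h0, hs⟩, ⟨(t, step s i), hs, hst⟩) : CubicArrow S × CubicArrow S)
              (d s t i : k)
          - Finsupp.single
              ((⟨(t, i), h0, ht⟩, ⟨(s, step t i), ht, hts⟩) : CubicArrow S × CubicArrow S) 1} ∪
    {r | ∃ (t : Fin p) (i : Fin p → ℤ) (h0 : i ∈ S) (h1 : step t i ∈ S)
        (h2 : step t (step t i) ∈ S),
        r = Finsupp.single
              ((⟨(t, i), h0, h1⟩, ⟨(t, step t i), h1, h2⟩) : CubicArrow S × CubicArrow S) 1}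
  parallel := by
    classical
    rintro r (⟨s, t, i, -, h0, ht, hs, hts, hst, rfl⟩ | ⟨t, i, h0, h1, h2, rfl⟩)
    · have key : ∀ p : CubicArrow S × CubicArrow S, p ∈ (Finsupp.single
              ((⟨(s, i), h0, hs⟩, ⟨(t, step s i), hs, hst⟩) : CubicArrow S × CubicArrow S)
              (d s t i : k)
          - Finsupp.single
              ((⟨(t, i), h0, ht⟩, ⟨(s, step t i), ht, hts⟩) : CubicArrow S × CubicArrow S)
              1).support →
          step p.1.1.1 p.1.1.2 = p.2.1.2 ∧ p.1.1.2 = i ∧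
            step p.2.1.1 p.2.1.2 = step s (step t i) := by
        intro p hp
        rcases Finset.mem_union.1 (Finsupp.support_sub hp) with h | h
        · rw [Finset.mem_singleton.1 (Finsupp.support_single_subset h)]
          exact ⟨rfl, rfl, step_comm _ _ _⟩
        · rw [Finset.mem_singleton.1 (Finsupp.support_single_subset h)]
          exact ⟨rfl, rfl, rfl⟩
      intro p hp
      obtain ⟨a1, a2, a3⟩ := key p hp
      refine ⟨Subtype.ext a1, fun q hq => ?_⟩
      obtain ⟨b1, b2, b3⟩ := key q hq
      exact ⟨Subtype.ext (a2.trans b2.symm), Subtype.ext (a3.trans b3.symm)⟩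
    · intro p hp
      rw [Finset.mem_singleton.1 (Finsupp.support_single_subset hp)]
      refine ⟨rfl, fun q hq => ?_⟩
      rw [Finset.mem_singleton.1 (Finsupp.support_single_subset hq)]
      exact ⟨rfl, rfl⟩

/-! ## Cubic pyramid quivers and cuboid completions -/

/-- The vertex set `Q(n)_0` of the `n`-cubic pyramid quiver of height `m`:
`i_t ≥ 1` and `i_1 + ⋯ + i_s ≤ m + s - 1` for `1 ≤ s ≤ n`. -/
def pyramid (m n : ℕ) : Set (Fin n → ℤ) :=
  {i | (∀ t, 1 ≤ i t) ∧ ∀ s : Fin n, ∑ t ∈ Finset.Iic s, i t ≤ (m : ℤ) + s.val}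

instance pyramid_finite (m n : ℕ) : Finite (pyramid m n) := by
  refine ((Set.finite_Icc (fun _ => (1 : ℤ)) (fun _ => (m : ℤ) + n)).subset ?_).to_subtype
  rintro i ⟨h1, h2⟩
  refine ⟨h1, fun s => ?_⟩
  have h3 : i s ≤ ∑ t ∈ Finset.Iic s, i t :=
    Finset.single_le_sum (f := i) (fun t _ => by linarith [h1 t]) (Finset.mem_Iic.2 le_rfl)
  have h4 := h2 s
  have h5 : (s.val : ℤ) < n := by exact_mod_cast s.2
  simp only
  linarith

/-- The bound quiver `(Q(n), ρ^g(n))` of the `n`-cubic pyramid algebra `Λ^g(n)`, where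
`g_s(γ_t^i) = d_{s,t,i} γ_t^{g_s(i)}`. -/
noncomputable abbrev pyramidQuiver (k : Type u) [Field k] (m n : ℕ)
    (d : Fin n → Fin n → (Fin n → ℤ) → kˣ) : QuadraticQuiver k :=
  cubicQuiver k (pyramid m n) d

instance (k : Type u) [Field k] (m n : ℕ) (d : Fin n → Fin n → (Fin n → ℤ) → kˣ) :
    Finite (pyramidQuiver k m n d).V := pyramid_finite m n

/-- The scalars of the sequence `g̃`, with `g̃_s(γ_t^i) = - γ_t^{g̃_s(i)}`. -/
def signTwist (k : Type u) [Field k] (n : ℕ) : Fin n → Fin n → (Fin n → ℤ) → kˣ :=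
  fun _ _ _ => -1

/-- The vector `e_n` in `ℤ^n`. -/
def lastVec (n : ℕ) : Fin n → ℤ := fun u => if u.val + 1 = n then 1 else 0

/-- The scalars `c` define a graded endomorphism `g'` of `Λ^g(n)` inducing the translation
`i ↦ i - e_n`: the assignment `g'(γ_t^{j + e_n}) = c_{t,j} γ_t^j` sends each commutativity relation
at `j + e_n` to a multiple of the one at `j`. -/
def IsTranslationTwist {k : Type u} [Field k] (m n : ℕ)
    (d : Fin n → Fin n → (Fin n → ℤ) → kˣ) (c : Fin n → (Fin n → ℤ) → kˣ) : Prop :=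
  ∀ (s t : Fin n) (j : Fin n → ℤ), t < s →
    (∀ i ∈ ({j, step t j, step s j, step s (step t j)} : Set (Fin n → ℤ)),
      i ∈ pyramid m n ∧ i + lastVec n ∈ pyramid m n) →
    d s t (j + lastVec n) * c t (step s j) * c s j = d s t j * c s (step t j) * c t j

/-- The vertex set `Q(n)_0 × ℤ` of the quiver `Q̄(n)`. -/
def barVertices (m n : ℕ) : Set (Fin (n + 1) → ℤ) := {i | Fin.init i ∈ pyramid m n}

/-- The scalars of the relations of `Q̄(n)`: `d_{s,t,i}` for `t < s ≤ n`, and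
`d_{n+1,t,i(n+1)} = c_{t, i - e_n}` for `t ≤ n`; they do not depend on the last coordinate. -/
def barTwist {k : Type u} [Field k] {n : ℕ} (d : Fin n → Fin n → (Fin n → ℤ) → kˣ)
    (c : Fin n → (Fin n → ℤ) → kˣ) :
    Fin (n + 1) → Fin (n + 1) → (Fin (n + 1) → ℤ) → kˣ := fun s t i =>
  if ht : t.val < n then
    if hs : s.val < n then d ⟨s, hs⟩ ⟨t, ht⟩ (Fin.init i)
    else c ⟨t, ht⟩ (Fin.init (step (Fin.last n) i))
  else 1

/-- The bound quiver `(Q̄(n), ρ̄(n))` of the smash product with `ℤ` of the twisted trivial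
extension of `Λ^g(n)`: its vertex set is `Q(n)_0 × ℤ`, and besides the arrows of `Q(n) × ℤ` it
has the arrows `γ_{n+1} : (i, v) → (i - e_n, v + 1)`. -/
noncomputable abbrev barQuiver (k : Type u) [Field k] (m n : ℕ)
    (d : Fin n → Fin n → (Fin n → ℤ) → kˣ) (c : Fin n → (Fin n → ℤ) → kˣ) :
    QuadraticQuiver k :=
  cubicQuiver k (barVertices m n) (barTwist d c)

/-- The side lengths `b(i) = (m + n - 1 - |i|, i_1 - 1, …, i_n - 1)`. -/
def cuboidSides (m n : ℕ) (i : Fin n → ℤ) : Fin (n + 1) → ℤ :=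
  Fin.cons ((m : ℤ) + n - 1 - ∑ t, i t) (fun t => i t - 1)

/-- The integral points of the `(n+1)`-cuboid associated to the vertex `i`. -/
def cuboid (m n : ℕ) (i : Fin n → ℤ) : Set (Fin (n + 1) → ℤ) :=
  Set.Icc 0 (cuboidSides m n i)

/-- The vector `v̄^i(a) = (i_1 + a_1 - a_2, …, i_n + a_n - a_{n+1}, i_{n+1} + a_{n+1})`. -/
def barV {n : ℕ} (i a : Fin (n + 1) → ℤ) : Fin (n + 1) → ℤ := fun u =>
  i u + a u - (if h : u.val + 1 < n + 1 then a ⟨u.val + 1, h⟩ else 0)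

/-- The vertex set of the `(n+1)`-cuboid completion of `Q(n) × {v}`. -/
def completionSet (m n : ℕ) (v : ℤ) : Set (barVertices m n) :=
  {j | ∃ i ∈ pyramid m n, ∃ a ∈ cuboid m n i, j.1 = barV (Fin.snoc i v) a}

instance completionSet_finite (m n : ℕ) (v : ℤ) : Finite (completionSet m n v) := by
  have h1 : (⋃ i ∈ pyramid m n, (barV (Fin.snoc i v : Fin (n + 1) → ℤ)) '' cuboid m n i).Finite :=
    (Set.toFinite (pyramid m n)).biUnion fun i _ => (Set.finite_Icc _ _).image _
  refine ((h1.preimage (Subtype.val_injective.injOn (s := _))).subset ?_).to_subtype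
  rintro j ⟨i, hi, a, ha, h⟩
  exact Set.mem_biUnion hi ⟨a, ha, h.symm⟩

/-- The bound quiver of the `(n+1)`-cuboid completion `Λ(n+1)(v)` of `Λ^g(n)`. -/
noncomputable abbrev cuboidCompletion (k : Type u) [Field k] (m n : ℕ)
    (d : Fin n → Fin n → (Fin n → ℤ) → kˣ) (c : Fin n → (Fin n → ℤ) → kˣ) (v : ℤ) :
    QuadraticQuiver k :=
  (barQuiver k m n d c).restrict (completionSet m n v)

instance (k : Type u) [Field k] (m n : ℕ) (d : Fin n → Fin n → (Fin n → ℤ) → kˣ)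
    (c : Fin n → (Fin n → ℤ) → kˣ) (v : ℤ) : Finite (cuboidCompletion k m n d c v).V :=
  completionSet_finite m n v

/-! ## Iyama's cones and the algebras `T_m^(n)(k)` -/

section Cone

open scoped ModuleCat

variable (k : Type u) [Field k] (L : Type u) [Ring L] [Algebra k L]

/-- The left `L`-module `D L = Hom_k(L, k)`. -/
def DualRegular : Type u := Module.Dual k L

noncomputable instance : AddCommGroup (DualRegular k L) :=
  inferInstanceAs (AddCommGroup (Module.Dual k L))

/-- The action `(r f)(x) = f (x r)`. -/
noncomputable instance : Module L (DualRegular k L) where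
  smul r f := LinearMap.comp (f : Module.Dual k L) (LinearMap.mulRight k r)
  one_smul f := (congrArg (LinearMap.comp (f : Module.Dual k L))
    (LinearMap.ext fun x => mul_one x : LinearMap.mulRight k (1 : L) = LinearMap.id)).trans
    (LinearMap.comp_id _)
  mul_smul r s f := congrArg (LinearMap.comp (f : Module.Dual k L))
    (LinearMap.ext fun x => (mul_assoc x r s).symm :
      LinearMap.mulRight k (r * s) = LinearMap.mulRight k s ∘ₗ LinearMap.mulRight k r)
  smul_zero _ := rfl
  smul_add _ _ _ := rfl
  add_smul r s f := (congrArg (LinearMap.comp (f : Module.Dual k L))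
    (LinearMap.ext fun x => mul_add x r s :
      LinearMap.mulRight k (r + s) = LinearMap.mulRight k r + LinearMap.mulRight k s)).trans
    (LinearMap.comp_add _ _ _)
  zero_smul f := (congrArg (LinearMap.comp (f : Module.Dual k L))
    (LinearMap.ext fun x => mul_zero x : LinearMap.mulRight k (0 : L) = 0)).trans
    (LinearMap.comp_zero _)

/-- Right multiplication `x ↦ x r` as an endomorphism of the regular left module. -/
def rightMul (r : L) : ModuleCat.of L L ⟶ ModuleCat.of L L :=
  ModuleCat.ofHom (LinearMap.toSpanSingleton L L r)

/-- The action of `r` on the right `L`-module `Ext^n_L(X, L)`. -/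
noncomputable def extRight (n : ℕ) (X : ModuleCat.{u} L) (r : L) :
    Abelian.Ext.{u} X (ModuleCat.of L L) n →ₗ[k] Abelian.Ext.{u} X (ModuleCat.of L L) n :=
  (Abelian.Ext.mk₀ (rightMul L r)).postcompOfLinear k X (add_zero n)

/-- The left `L`-module `τ_n X = D Ext^n_L(X, L)`. -/
def DualExt (n : ℕ) (X : ModuleCat.{u} L) : Type u :=
  Module.Dual k (Abelian.Ext.{u} X (ModuleCat.of L L) n)

noncomputable instance (n : ℕ) (X : ModuleCat.{u} L) : AddCommGroup (DualExt k L n X) :=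
  inferInstanceAs (AddCommGroup (Module.Dual k (Abelian.Ext.{u} X (ModuleCat.of L L) n)))

theorem extRight_one (n : ℕ) (X : ModuleCat.{u} L) : extRight k L n X 1 = LinearMap.id := by
  have h : rightMul L (1 : L) = 𝟙 _ := by
    ext; simp [rightMul]
  ext x
  simp [extRight, h]

theorem extRight_mul (n : ℕ) (X : ModuleCat.{u} L) (r s : L) :
    extRight k L n X (r * s) = extRight k L n X s ∘ₗ extRight k L n X r := by
  have h : rightMul L (r * s) = rightMul L r ≫ rightMul L s := by
    ext; simp [rightMul]
  ext x
  simp [extRight, h, ← Abelian.Ext.mk₀_comp_mk₀]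

theorem extRight_add (n : ℕ) (X : ModuleCat.{u} L) (r s : L) :
    extRight k L n X (r + s) = extRight k L n X r + extRight k L n X s := by
  have h : rightMul L (r + s) = rightMul L r + rightMul L s := by
    ext; simp [rightMul]
  ext x
  simp [extRight, h, Abelian.Ext.mk₀_add]

theorem extRight_zero (n : ℕ) (X : ModuleCat.{u} L) : extRight k L n X 0 = 0 := by
  have h := extRight_add k L n X 0 0
  rw [add_zero] at h
  exact left_eq_add.1 h

/-- The action `(r f)(x) = f (x r)`. -/
noncomputable instance (n : ℕ) (X : ModuleCat.{u} L) : Module L (DualExt k L n X) where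
  smul r f := LinearMap.comp (f : Module.Dual k _) (extRight k L n X r)
  one_smul f := (congrArg (LinearMap.comp (f : Module.Dual k _)) (extRight_one k L n X)).trans
    (LinearMap.comp_id _)
  mul_smul r s f := (congrArg (LinearMap.comp (f : Module.Dual k _)) (extRight_mul k L n X r s))
  smul_zero _ := rfl
  smul_add _ _ _ := rfl
  add_smul r s f := (congrArg (LinearMap.comp (f : Module.Dual k _))
    (extRight_add k L n X r s)).trans (LinearMap.comp_add _ _ _)
  zero_smul f := (congrArg (LinearMap.comp (f : Module.Dual k _)) (extRight_zero k L n X)).trans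
    (LinearMap.comp_zero _)

/-- The `n`-Auslander-Reiten translation `τ_n = D Ext^n_L(-, L)` (for `gl.dim L ≤ n`). -/
noncomputable def arTranslate (n : ℕ) (X : ModuleCat.{u} L) : ModuleCat.{u} L :=
  ModuleCat.of L (DualExt k L n X)

/-- The module `M = ⨁_{i ≥ 0} τ_n^i (D L)`. For an absolutely `n`-complete basic algebra `L` almost
all summands vanish, and `M` is the basic `n`-cluster tilting module of `L`. -/
abbrev coneModule (n : ℕ) : Type u :=
  DirectSum ℕ fun i => ((arTranslate k L n)^[i] (ModuleCat.of L (DualRegular k L)))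

/-- The cone `End_L(M)` of `L`. -/
abbrev Cone (n : ℕ) : Type u := Module.End L (coneModule k L n)

end Cone

/-- The algebra `T_m(k)` of upper triangular `m × m` matrices. -/
def upperTriangular (k : Type u) [Field k] (m : ℕ) : Subalgebra k (Matrix (Fin m) (Fin m) k) where
  carrier := {A | A.BlockTriangular id}
  mul_mem' := fun h1 h2 => h1.mul h2
  add_mem' := fun h1 h2 => h1.add h2
  algebraMap_mem' := fun r => by
    rw [Matrix.algebraMap_eq_diagonal]
    exact Matrix.blockTriangular_diagonal _

open scoped ModuleCat in
/-- Iyama's algebra `T_m^(n)(k)` for `n ≥ 1`: `T_m^(1)(k)` is the algebra of upper triangular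
`m × m` matrices and `T_m^(n+1)(k)` is the cone of `T_m^(n)(k)`, formed with `τ_n`.
(The value at `n = 0` is irrelevant.) -/
noncomputable def iyamaT (k : Type u) [Field k] (m : ℕ) : ℕ → AlgCat.{u} k
  | 0 => AlgCat.of k (upperTriangular k m)
  | 1 => AlgCat.of k (upperTriangular k m)
  | n + 2 => AlgCat.of k (Cone k (iyamaT k m (n + 1)) (n + 1))

/-! Both sides are compared with one explicit algebra. A chain is a sequence m - 1 ≥ w_1 ≥ ⋯ ≥ w_n ≥
0; x is interlaced with y if x_t ≤ y_t for all t and y_t ≤ x_s for s < t. The algebra has a basis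
e_{xy} indexed by the interlaced pairs, and e_{xy} e_{yz} is e_{xz} if x, z are interlaced and 0
otherwise (`RelAlg` for `ChainRel m n`).

Cone side (`nonempty_relAlg_iyamaT`). Induction on n shows that T_m^(n)(k) has such a basis; for n =
1 it consists of the matrix units. If L has such a basis for n, a chain u of length n + 1 defines an
L-module M_u with one basis vector for each chain x in the box u_{t+1} ≤ x_t ≤ u_t. The M_u with u_1
= m - 1 add up to D L. Each M_u has an explicit projective resolution of length n
(`splits_syzShape`), from which τ_n M_u is read off: it is M_{u - (1,…,1)}, or 0 if u_{n+1} = 0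
(`nonempty_arTranslate_equiv`). Hence the module defining the cone is the sum of M_u over all chains
u (`nonempty_coneModule_equiv`). The space Hom(M_u, M_v) is k if u is interlaced with v and 0
otherwise, so the endomorphism algebra has a basis of the same kind for the opposite relation
(`endRelAlg`), and the involution w ↦ (m - 1 - w_{n+1}, …, m - 1 - w_1) turns the relation around.

Quiver side. The sums w_t = ∑_{u ≥ t} (i_u - 1) identify Q(n)_0 with the chains of length n, and the
arrow i → i(t) becomes raising w_t by one. After a shift by v - 1, the same formula identifies the
vertices of the cuboid completion with the chains of length n + 1 (`mem_completionSet_iff`). For g'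
all scalars are taken to be -1, so that all squares anticommute. In the quadratic dual the squares
then commute, paths in a single direction survive, and a path of length two whose square lacks its
fourth corner is zero. These relations force all paths from x to y to coincide, and to vanish unless
x, y are interlaced (`ChainGenerators.isPath_unique`), so the dual is the algebra above
(`ChainQuiver.nonempty_dualAlg_equiv`). -/

/-! ## Yoneda products along a projective resolution -/

section Resolution

open Abelian

universe w v v'

variable {C : Type v} [Category.{v'} C] [Abelian C] [HasExt.{w} C]

/-- `Ext^n(X, Y)` is presented by `Hom(P, Y) → Hom(K, Y) → Ext^n(X, Y) → 0`, where the second map is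
the Yoneda product with `η`. -/
def PresentsExt {X K P : C} {n : ℕ} (Y : C) (f : K ⟶ P) (η : Ext.{w} X K n) : Prop :=
  (∀ z : Ext.{w} X Y n, ∃ h : K ⟶ Y, η.comp (Ext.mk₀ h) (add_zero n) = z) ∧
    ∀ h : K ⟶ Y, η.comp (Ext.mk₀ h) (add_zero n) = 0 ↔ ∃ H : P ⟶ Y, f ≫ H = h

/-- This is the long exact sequence of Hom(-, Y), in which Ext^1 of the projective middle term
vanishes. -/
theorem PresentsExt.extClass {S : ShortComplex C} (hS : S.ShortExact) [Projective S.X₂] (Y : C) :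
    PresentsExt Y S.f hS.extClass := by
  refine ⟨fun z => ?_, fun h => ⟨fun hh => ?_, ?_⟩⟩
  · obtain ⟨x, hx⟩ := Ext.contravariant_sequence_exact₃ hS Y z
      (Ext.eq_zero_of_projective _) (add_zero 1)
    obtain ⟨h, rfl⟩ := (Ext.mk₀_bijective _ _).2 x
    exact ⟨h, hx⟩
  · obtain ⟨x, hx⟩ := Ext.contravariant_sequence_exact₁ hS Y (Ext.mk₀ h) (add_zero 1) hh
    obtain ⟨H, rfl⟩ := (Ext.mk₀_bijective _ _).2 x
    rw [Ext.mk₀_comp_mk₀] at hx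
    exact ⟨H, (Ext.mk₀_bijective _ _).1 hx⟩
  · rintro ⟨H, rfl⟩
    rw [← Ext.mk₀_comp_mk₀, hS.extClass_comp_assoc]

/-- Dimension shift: multiplication with the extension class maps Ext^n(X₁, Y) onto Ext^{n+1}(X₃,
Y). It is injective because Ext^n of the projective term vanishes, which needs n ≥ 1. -/
theorem PresentsExt.extClass_comp {S : ShortComplex C} (hS : S.ShortExact) [Projective S.X₂]
    {K P : C} {n : ℕ} (hn : 1 ≤ n) {Y : C} {f : K ⟶ P} {η : Ext.{w} S.X₁ K n}
    (h : PresentsExt Y f η) :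
    PresentsExt Y f (hS.extClass.comp η (add_comm 1 n)) := by
  obtain ⟨n, rfl⟩ := Nat.exists_eq_add_of_le' hn
  have assoc : ∀ g : K ⟶ Y, (hS.extClass.comp η (add_comm 1 (n + 1))).comp (Ext.mk₀ g)
      (add_zero _) = hS.extClass.comp (η.comp (Ext.mk₀ g) (add_zero _)) (add_comm 1 (n + 1)) :=
    fun g => Ext.comp_assoc _ _ _ _ _ (by omega)
  refine ⟨fun z => ?_, fun g => ?_⟩
  · obtain ⟨x, rfl⟩ := Ext.contravariant_sequence_exact₃ hS Y z
      (Ext.eq_zero_of_projective _) (add_comm 1 (n + 1))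
    obtain ⟨g, rfl⟩ := h.1 x
    exact ⟨g, assoc g⟩
  · rw [assoc, ← h.2]
    refine ⟨fun hh => ?_, fun hh => by rw [hh, Ext.comp_zero]⟩
    obtain ⟨x, hx⟩ := Ext.contravariant_sequence_exact₁ hS Y _ _ hh
    rw [← hx, Ext.eq_zero_of_projective x, Ext.comp_zero]

theorem PresentsExt.iso_comp {X X' K P : C} {n : ℕ} {Y : C} {f : K ⟶ P} {η : Ext.{w} X K n}
    (h : PresentsExt Y f η) (e : X' ≅ X) :
    PresentsExt Y f ((Ext.mk₀ e.hom).comp η (zero_add n)) := by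
  have assoc : ∀ g : K ⟶ Y, ((Ext.mk₀ e.hom).comp η (zero_add n)).comp (Ext.mk₀ g)
      (add_zero _) = (Ext.mk₀ e.hom).comp (η.comp (Ext.mk₀ g) (add_zero _)) (zero_add n) :=
    fun g => Ext.comp_assoc _ _ _ _ _ (by omega)
  have cancel : ∀ z : Ext.{w} X Y n, (Ext.mk₀ e.inv).comp
      ((Ext.mk₀ e.hom).comp z (zero_add n)) (zero_add n) = z := fun z => by
    rw [Ext.mk₀_comp_mk₀_assoc, e.inv_hom_id, Ext.mk₀_id_comp]
  refine ⟨fun z => ?_, fun g => ?_⟩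
  · obtain ⟨g, hg⟩ := h.1 ((Ext.mk₀ e.inv).comp z (zero_add n))
    refine ⟨g, ?_⟩
    rw [assoc, hg, Ext.mk₀_comp_mk₀_assoc, e.hom_inv_id, Ext.mk₀_id_comp]
  · rw [assoc, ← h.2]
    refine ⟨fun hh => ?_, fun hh => by rw [hh, Ext.comp_zero]⟩
    rw [← cancel (η.comp _ _), hh, Ext.comp_zero]

/-- The complex is spliced from short exact sequences K c → P → K (c+1). Only the leftmost inclusion
enters the presentation of the top Ext group; the later sequences merely shift the degree. -/
theorem exists_presentsExt (Y : C) (K : ℕ → C) {P : C} (i : K 0 ⟶ P) (p : P ⟶ K 1) (w : i ≫ p = 0)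
    (hS : (ShortComplex.mk _ _ w).ShortExact) (hP : Projective P) (N : ℕ)
    (h : ∀ c, 1 ≤ c → c < N → ∃ (P : C) (i : K c ⟶ P) (p : P ⟶ K (c + 1)) (w : i ≫ p = 0),
      (ShortComplex.mk _ _ w).ShortExact ∧ Projective P) (n : ℕ) (hn : 1 ≤ n) (hnN : n ≤ N) :
    ∃ η : Ext.{w} (K n) (K 0) n, PresentsExt Y i η := by
  induction n, hn using Nat.le_induction with
  | base =>
    have : Projective (ShortComplex.mk _ _ w).X₂ := hP
    exact ⟨hS.extClass, PresentsExt.extClass hS Y⟩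
  | succ n hn ih =>
    obtain ⟨η, hη⟩ := ih (by omega)
    obtain ⟨P', i', p', w', hS', hP'⟩ := h n hn hnN
    have : Projective (ShortComplex.mk _ _ w').X₂ := hP'
    exact ⟨_, PresentsExt.extClass_comp hS' hn (η := η) hη⟩

end Resolution

/-! ## Algebras with a multiplicative basis indexed by a relation -/

/-- A basis `e_{xy}` of `L` indexed by the pairs with `R x y`, such that `1 = ∑ e_{xx}` and
`e_{xy} e_{yz}` is `e_{xz}` if `R x z` and `0` otherwise; `coef` gives the coordinates. -/
structure RelAlg (k : Type u) [Field k] (L : Type u) [Ring L] [Algebra k L] {V : Type} [Fintype V]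
    (R : V → V → Prop) where
  coef : L →ₗ[k] V → V → k
  coef_injective : Function.Injective coef
  coef_eq_zero : ∀ r x y, ¬ R x y → coef r x y = 0
  exists_coef_eq : ∀ g : V → V → k, (∀ x y, ¬ R x y → g x y = 0) → ∃ r, coef r = g
  coef_one_self : ∀ x, coef 1 x x = 1
  coef_one_of_ne : ∀ x y, x ≠ y → coef 1 x y = 0
  coef_mul : ∀ r s x z, R x z → coef (r * s) x z = ∑ y, coef r x y * coef s y z

namespace RelAlg

variable {k : Type u} [Field k] {L : Type u} [Ring L] [Algebra k L] {V : Type} [Fintype V]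
  {R : V → V → Prop} (A : RelAlg k L R)

theorem refl (A : RelAlg k L R) (x : V) : R x x := by
  by_contra h
  have := A.coef_eq_zero 1 x x h
  rw [A.coef_one_self] at this
  exact one_ne_zero this

theorem rel_of_coef_ne_zero {r : L} {x y : V} (h : A.coef r x y ≠ 0) : R x y :=
  not_not.1 fun h' => h (A.coef_eq_zero r x y h')

theorem ext {r s : L} (h : ∀ x y, R x y → A.coef r x y = A.coef s x y) : r = s := by
  refine A.coef_injective (funext fun x => funext fun y => ?_)
  by_cases hxy : R x y
  · exact h x y hxy
  · rw [A.coef_eq_zero _ _ _ hxy, A.coef_eq_zero _ _ _ hxy]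

open scoped Classical in
/-- The element with coordinates `g x y`. -/
noncomputable def elt (g : V → V → k) : L :=
  (A.exists_coef_eq (fun x y => if R x y then g x y else 0) fun _ _ h => if_neg h).choose

theorem coef_elt (g : V → V → k) {x y : V} (h : R x y) : A.coef (A.elt g) x y = g x y := by
  classical
  rw [elt, (A.exists_coef_eq (fun x y => if R x y then g x y else 0) fun _ _ h =>
    if_neg h).choose_spec]
  exact if_pos h

open scoped Classical in
/-- The basis element `e_{xy}` (zero unless `R x y`). -/
noncomputable def single (x y : V) : L := A.elt fun a b => if a = x ∧ b = y then 1 else 0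

open scoped Classical in
theorem coef_single (x y : V) {a b : V} (h : R a b) :
    A.coef (A.single x y) a b = if a = x ∧ b = y then 1 else 0 := A.coef_elt _ h

theorem single_eq_zero {x y : V} (h : ¬ R x y) : A.single x y = 0 := by
  classical
  refine A.ext fun a b hab => ?_
  rw [A.coef_single _ _ hab, if_neg, map_zero]
  · rfl
  · rintro ⟨rfl, rfl⟩; exact h hab

theorem coef_single_mul {x y : V} (hxy : R x y) (r : L) {z : V} (hxz : R x z) :
    A.coef (A.single x y * r) x z = A.coef r y z := by
  classical
  rw [A.coef_mul _ _ _ _ hxz, Finset.sum_eq_single y]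
  · rw [A.coef_single _ _ hxy, if_pos ⟨rfl, rfl⟩, one_mul]
  · intro b _ hb
    by_cases h : R x b
    · rw [A.coef_single _ _ h, if_neg (fun h => hb h.2), zero_mul]
    · rw [A.coef_eq_zero _ _ _ h, zero_mul]
  · simp

theorem coef_single_mul_of_ne {x y a : V} (ha : a ≠ x) (r : L) (z : V) :
    A.coef (A.single x y * r) a z = 0 := by
  classical
  by_cases haz : R a z
  · rw [A.coef_mul _ _ _ _ haz]
    refine Finset.sum_eq_zero fun b _ => ?_
    by_cases h : R a b
    · rw [A.coef_single _ _ h, if_neg (fun h => ha h.1), zero_mul]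
    · rw [A.coef_eq_zero _ _ _ h, zero_mul]
  · exact A.coef_eq_zero _ _ _ haz

theorem single_mul_single {x y z : V} (hxy : R x y) (hyz : R y z) :
    A.single x y * A.single y z = A.single x z := by
  classical
  refine A.ext fun a b hab => ?_
  rcases eq_or_ne a x with rfl | ha
  · rw [A.coef_single_mul hxy _ hab, A.coef_single _ _ hab]
    by_cases hyb : R y b
    · rw [A.coef_single _ _ hyb]; simp
    · rw [A.coef_eq_zero _ _ _ hyb, if_neg]
      rintro ⟨-, rfl⟩; exact hyb hyz
  · rw [A.coef_single_mul_of_ne ha, A.coef_single _ _ hab, if_neg fun h => ha h.1]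

theorem single_mul_single_of_ne {x y y' z : V} (hy : y ≠ y') :
    A.single x y * A.single y' z = 0 := by
  classical
  by_cases hxy : R x y
  · refine A.ext fun a b hab => ?_
    rcases eq_or_ne a x with rfl | ha
    · rw [A.coef_single_mul hxy _ hab]
      by_cases hyb : R y b
      · rw [A.coef_single _ _ hyb, if_neg fun h => hy h.1, map_zero]; rfl
      · rw [A.coef_eq_zero _ _ _ hyb, map_zero]; rfl
    · rw [A.coef_single_mul_of_ne ha, map_zero]; rfl
  · rw [A.single_eq_zero hxy, zero_mul]

theorem sum_smul_single (r : L) : r = ∑ x, ∑ y, A.coef r x y • A.single x y := by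
  classical
  refine A.ext fun a b hab => ?_
  simp only [map_sum, map_smul, Finset.sum_apply, Pi.smul_apply, A.coef_single _ _ hab,
    smul_eq_mul, mul_ite, mul_one, mul_zero]
  rw [Finset.sum_eq_single a, Finset.sum_eq_single b] <;> simp +contextual [eq_comm]

theorem single_mul_eq_sum (x y : V) (r : L) (hxy : R x y) :
    A.single x y * r = ∑ z, A.coef r y z • A.single x z := by
  classical
  refine A.ext fun a b hab => ?_
  simp only [map_sum, map_smul, Finset.sum_apply, Pi.smul_apply, A.coef_single _ _ hab,
    smul_eq_mul, mul_ite, mul_one, mul_zero]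
  rcases eq_or_ne a x with rfl | ha
  · rw [A.coef_single_mul hxy _ hab]; simp
  · rw [A.coef_single_mul_of_ne ha]; simp [ha]

theorem sum_single_self : ∑ x, A.single x x = 1 := by
  classical
  refine A.ext fun a b hab => ?_
  simp only [map_sum, Finset.sum_apply, A.coef_single _ _ hab]
  rcases eq_or_ne a b with rfl | h
  · rw [A.coef_one_self, Finset.sum_eq_single a] <;> simp +contextual [eq_comm]
  · rw [A.coef_one_of_ne _ _ h]
    refine Finset.sum_eq_zero fun x _ => if_neg ?_
    rintro ⟨rfl, rfl⟩; exact h rfl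

/-- Transport along a bijection of the index sets. -/
noncomputable def reindex {W : Type} [Fintype W] {R' : W → W → Prop} (e : W ≃ V)
    (he : ∀ x y, R' x y ↔ R (e x) (e y)) : RelAlg k L R' where
  coef := (LinearMap.funLeft k _ e).compLeft W ∘ₗ LinearMap.funLeft k _ e ∘ₗ A.coef
  coef_injective := by
    intro r s h
    refine A.ext fun x y _ => ?_
    have := congrFun (congrFun h (e.symm x)) (e.symm y)
    simpa [LinearMap.funLeft] using this
  coef_eq_zero r x y h := A.coef_eq_zero r _ _ fun h' => h ((he x y).2 h')
  exists_coef_eq g hg := by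
    obtain ⟨r, hr⟩ := A.exists_coef_eq (fun x y => g (e.symm x) (e.symm y)) fun x y h =>
      hg _ _ fun h' => h (by simpa using (he _ _).1 h')
    refine ⟨r, funext fun x => funext fun y => ?_⟩
    have := congrFun (congrFun hr (e x)) (e y)
    simpa [LinearMap.funLeft] using this
  coef_one_self x := A.coef_one_self (e x)
  coef_one_of_ne x y h := A.coef_one_of_ne _ _ (e.injective.ne h)
  coef_mul r s x z h := (A.coef_mul r s _ _ ((he x z).1 h)).trans
    (e.sum_comp fun y => A.coef r (e x) y * A.coef s y (e z)).symm

/-! ### Representations supported on convex sets -/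

end RelAlg

/-- A family of convex sets on which `R` restricts to a transitive relation. -/
structure Shape {V : Type} (R : V → V → Prop) (I : Type) where
  mem : I → V → Prop
  convex : ∀ a x y z, mem a x → mem a z → R x y → R y z → mem a y
  rel : ∀ a x y z, mem a x → mem a z → R x y → R y z → R x z

namespace RelAlg

variable {k : Type u} [Field k] {L : Type u} [Ring L] [Algebra k L] {V : Type} [Fintype V]
  {R : V → V → Prop} (A : RelAlg k L R) {I J : Type}

/-- The left `L`-module with basis the pairs `(a, x)` with `x` in the `a`-th set of `S`, where
`e_{xy}` maps the basis vector at `(a, y)` to the one at `(a, x)`. -/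
def Rep (_ : RelAlg k L R) (S : Shape R I) : Type u :=
  {f : I → V → k // ∀ a x, ¬ S.mem a x → f a x = 0}

variable {S : Shape R I} {T : Shape R J}

instance : CoeFun (A.Rep S) fun _ => I → V → k := ⟨Subtype.val⟩

theorem Rep.ext {f g : A.Rep S} (h : ∀ a x, S.mem a x → f a x = g a x) : f = g := by
  refine Subtype.ext (funext fun a => funext fun x => ?_)
  by_cases hx : S.mem a x
  · exact h a x hx
  · rw [f.2 a x hx, g.2 a x hx]

noncomputable instance : AddCommGroup (A.Rep S) :=
  inferInstanceAs (AddCommGroup ({ carrier := {f | ∀ a x, ¬ S.mem a x → f a x = 0}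
                                   add_mem' := fun h1 h2 a x h => by
                                    simp [h1 a x h, h2 a x h]
                                   zero_mem' := fun _ _ _ => rfl
                                   neg_mem' := fun h1 a x h => by
                                    simp [h1 a x h] } : AddSubgroup (I → V → k)))

@[simp] theorem Rep.add_apply (f g : A.Rep S) (a : I) (x : V) : (f + g) a x = f a x + g a x := rfl

@[simp] theorem Rep.zero_apply (a : I) (x : V) : (0 : A.Rep S) a x = 0 := rfl

theorem Rep.sum_apply {ι : Type*} (s : Finset ι) (f : ι → A.Rep S) (a : I) (x : V) :
    (∑ i ∈ s, f i) a x = ∑ i ∈ s, f i a x := by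
  classical
  induction s using Finset.induction_on with
  | empty => rfl
  | insert i s hi ih => rw [Finset.sum_insert hi, Finset.sum_insert hi, Rep.add_apply, ih]

theorem Rep.mem_of_ne_zero {f : A.Rep S} {a : I} {x : V} (h : f a x ≠ 0) : S.mem a x :=
  not_not.1 fun h' => h (f.2 a x h')

open scoped Classical in
/-- The vector with coordinates `g a x`. -/
noncomputable def Rep.mk (g : I → V → k) : A.Rep S :=
  ⟨fun a x => if S.mem a x then g a x else 0, fun _ _ h => if_neg h⟩

theorem Rep.mk_apply (g : I → V → k) {a : I} {x : V} (h : S.mem a x) :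
    (Rep.mk A g : A.Rep S) a x = g a x := if_pos h

noncomputable instance : SMul L (A.Rep S) :=
  ⟨fun r f => Rep.mk A fun a x => ∑ y, A.coef r x y * f a y⟩

theorem Rep.smul_apply (r : L) (f : A.Rep S) {a : I} {x : V} (h : S.mem a x) :
    (r • f) a x = ∑ y, A.coef r x y * f a y := Rep.mk_apply A _ h

/-- The relation `R` need not be transitive, so associativity uses both conditions on a shape.
Convexity makes the terms through points outside the set vanish, and transitivity on the set means
that no product of basis elements between its points is cut off. -/
noncomputable instance : Module L (A.Rep S) where
  one_smul f := Rep.ext A fun a x h => by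
    rw [Rep.smul_apply A _ _ h, Finset.sum_eq_single x, A.coef_one_self, one_mul]
    · intro y _ hy
      rw [A.coef_one_of_ne _ _ hy.symm, zero_mul]
    · simp
  mul_smul r s f := Rep.ext A fun a x h => by
    have key : ∀ y z, S.mem a z → ¬ S.mem a y → A.coef r x y * A.coef s y z = 0 := by
      intro y z hz hy
      by_contra h'
      exact hy (S.convex a x y z h hz (A.rel_of_coef_ne_zero (left_ne_zero_of_mul h'))
        (A.rel_of_coef_ne_zero (right_ne_zero_of_mul h')))
    have key2 : ∀ z, S.mem a z → A.coef (r * s) x z = ∑ y, A.coef r x y * A.coef s y z := by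
      intro z hz
      by_cases hxz : R x z
      · exact A.coef_mul r s x z hxz
      · rw [A.coef_eq_zero _ _ _ hxz]
        refine (Finset.sum_eq_zero fun y _ => ?_).symm
        by_contra h'
        exact hxz (S.rel a x y z h hz (A.rel_of_coef_ne_zero (left_ne_zero_of_mul h'))
          (A.rel_of_coef_ne_zero (right_ne_zero_of_mul h')))
    rw [Rep.smul_apply A _ _ h, Rep.smul_apply A _ _ h]
    have e1 : ∀ y, A.coef r x y * (s • f) a y = ∑ z, A.coef r x y * A.coef s y z * f a z := by
      intro y
      by_cases hy : S.mem a y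
      · rw [Rep.smul_apply A _ _ hy, Finset.mul_sum]
        exact Finset.sum_congr rfl fun z _ => (mul_assoc _ _ _).symm
      · rw [(s • f).2 a y hy, mul_zero]
        refine (Finset.sum_eq_zero fun z _ => ?_).symm
        by_cases hz : S.mem a z
        · rw [key y z hz hy, zero_mul]
        · rw [f.2 a z hz, mul_zero]
    simp only [e1]
    rw [Finset.sum_comm]
    refine Finset.sum_congr rfl fun z _ => ?_
    rw [← Finset.sum_mul]
    by_cases hz : S.mem a z
    · rw [key2 z hz]
    · rw [f.2 a z hz, mul_zero, mul_zero]
  smul_zero r := Rep.ext A fun a x h => by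
    simp [Rep.smul_apply A _ _ h]
  smul_add r f g := Rep.ext A fun a x h => by
    simp [Rep.smul_apply A _ _ h, mul_add, Finset.sum_add_distrib]
  add_smul r s f := Rep.ext A fun a x h => by
    simp [Rep.smul_apply A _ _ h, add_mul, Finset.sum_add_distrib]
  zero_smul f := Rep.ext A fun a x h => by
    simp [Rep.smul_apply A _ _ h]

/-- `C` is the matrix of a homomorphism between the modules of `S` and `T`. -/
def Compat (S : Shape R I) (T : Shape R J) (C : J → I → k) : Prop :=
  ∀ b a x y, C b a ≠ 0 → T.mem b x → S.mem a y → R x y → (S.mem a x ↔ T.mem b y)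

/-- The homomorphism mapping the basis vector at `(a, x)` to `∑ C b a (b, x)`. -/
noncomputable def matMap [Fintype I] (C : J → I → k) (h : Compat S T C) :
    A.Rep S →ₗ[L] A.Rep T where
  toFun f := Rep.mk A fun b x => ∑ a, C b a * f a x
  map_add' f g := Rep.ext A fun b x hx => by
    simp [Rep.mk_apply A _ hx, mul_add, Finset.sum_add_distrib]
  map_smul' r f := Rep.ext A fun b x hx => by
    rw [RingHom.id_apply, Rep.mk_apply A _ hx, Rep.smul_apply A _ _ hx]
    -- The vector with all coordinates 1 serves as the indicator function of the target shape, so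
    -- both cases of membership fit in one formula.
    have e1 : ∀ a, C b a * (r • f) a x = ∑ y, C b a *
        (A.coef r x y * (Rep.mk A (fun _ _ => 1) : A.Rep T) b y * f a y) := by
      intro a
      by_cases hC : C b a = 0
      · simp [hC]
      rw [← Finset.mul_sum]
      congr 1
      have e2 : ∀ y, A.coef r x y * f a y ≠ 0 → (S.mem a x ↔ T.mem b y) := fun y hy =>
        h b a x y hC hx (Rep.mem_of_ne_zero A (right_ne_zero_of_mul hy))
          (A.rel_of_coef_ne_zero (left_ne_zero_of_mul hy))
      have e3 : ∀ y, A.coef r x y * (Rep.mk A (fun _ _ => 1) : A.Rep T) b y * f a y =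
          (A.coef r x y * f a y) * (Rep.mk A (fun _ _ => 1) : A.Rep T) b y := fun y => by ring
      simp only [e3]
      by_cases hS : S.mem a x
      · rw [Rep.smul_apply A _ _ hS]
        refine Finset.sum_congr rfl fun y _ => ?_
        by_cases hy : A.coef r x y * f a y = 0
        · rw [hy, zero_mul]
        · rw [Rep.mk_apply A _ ((e2 y hy).1 hS), mul_one]
      · rw [(r • f).2 a x hS]
        refine (Finset.sum_eq_zero fun y _ => ?_).symm
        by_cases hy : A.coef r x y * f a y = 0
        · rw [hy, zero_mul]
        · rw [(Rep.mk A (fun _ _ => 1) : A.Rep T).2 b y (mt (e2 y hy).2 hS), mul_zero]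
    simp only [e1]
    rw [Finset.sum_comm]
    refine Finset.sum_congr rfl fun y _ => ?_
    by_cases hy : T.mem b y
    · rw [Rep.mk_apply A _ hy, Rep.mk_apply A _ hy, Finset.mul_sum]
      exact Finset.sum_congr rfl fun a _ => by ring
    · rw [(Rep.mk A (fun _ _ => 1) : A.Rep T).2 b y hy, (Rep.mk A _ : A.Rep T).2 b y hy]
      simp

theorem matMap_apply [Fintype I] (C : J → I → k) (h : Compat S T C) (f : A.Rep S) {b : J} {x : V}
    (hx : T.mem b x) : A.matMap C h f b x = ∑ a, C b a * f a x := Rep.mk_apply A _ hx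

end RelAlg

namespace RelAlg

variable {k : Type u} [Field k] {L : Type u} [Ring L] [Algebra k L] {V : Type} [Fintype V]
  {R : V → V → Prop} (A : RelAlg k L R) {I J : Type} {S : Shape R I} {T : Shape R J}

/-! ### Projective representations -/

end RelAlg

/-- Each set of `S` is empty or consists of all elements below `t a`. -/
def Shape.Generated {V : Type} {R : V → V → Prop} {I : Type} (S : Shape R I) (t : I → V) : Prop :=
  ∀ a, (∀ x, S.mem a x ↔ R x (t a)) ∨ ∀ x, ¬ S.mem a x

namespace RelAlg

variable {k : Type u} [Field k] {L : Type u} [Ring L] [Algebra k L] {V : Type} [Fintype V]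
  {R : V → V → Prop} (A : RelAlg k L R) {I J : Type} {S : Shape R I} {T : Shape R J}

open scoped Classical in
/-- The basis vector at `(a, t)` (zero if `t` is not in the `a`-th set). -/
noncomputable def Rep.basisVec (S : Shape R I) (a : I) (t : V) : A.Rep S :=
  Rep.mk A fun b x => if b = a ∧ x = t then 1 else 0

open scoped Classical in
theorem Rep.basisVec_apply {a b : I} {t x : V} (h : S.mem b x) :
    Rep.basisVec A S a t b x = if b = a ∧ x = t then 1 else 0 := Rep.mk_apply A _ h

theorem Rep.smul_basisVec (r : L) {a b : I} {t x : V} (ht : S.mem a t) (hx : S.mem b x)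
    (hab : b = a) :
    (r • Rep.basisVec A S a t) b x = A.coef r x t := by
  subst hab
  rw [Rep.smul_apply A _ _ hx, Finset.sum_eq_single t]
  · rw [Rep.basisVec_apply A ht, if_pos ⟨rfl, rfl⟩, mul_one]
  · intro y _ hy
    by_cases h : S.mem b y
    · rw [Rep.basisVec_apply A h, if_neg fun h => hy h.2, mul_zero]
    · rw [(Rep.basisVec A S b t).2 _ _ h, mul_zero]
  · simp

theorem Rep.smul_basisVec_of_ne (r : L) {a b : I} {t x : V} (hab : b ≠ a) :
    (r • Rep.basisVec A S a t) b x = 0 := by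
  by_cases hx : S.mem b x
  · rw [Rep.smul_apply A _ _ hx]
    refine Finset.sum_eq_zero fun y _ => ?_
    by_cases h : S.mem b y
    · rw [Rep.basisVec_apply A h, if_neg fun h => hab h.1, mul_zero]
    · rw [(Rep.basisVec A S a t).2 _ _ h, mul_zero]
  · exact (r • Rep.basisVec A S a t).2 _ _ hx

theorem Rep.single_smul_basisVec {a : I} {x t : V} (hx : S.mem a x) (ht : S.mem a t)
    (hR : R x t) : A.single x t • Rep.basisVec A S a t = Rep.basisVec A S a x := by
  classical
  refine Rep.ext A fun b y hy => ?_
  rcases eq_or_ne b a with rfl | hb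
  · rw [Rep.smul_basisVec A _ ht hy rfl, Rep.basisVec_apply A hy]
    by_cases hyt : R y t
    · simp [A.coef_single _ _ hyt]
    · rw [A.coef_eq_zero _ _ _ hyt, if_neg]
      rintro ⟨-, rfl⟩; exact hyt hR
  · rw [Rep.smul_basisVec_of_ne A _ hb, Rep.basisVec_apply A hy, if_neg fun h => hb h.1]

open scoped Classical in
/-- The element whose column `t` consists of the coordinates of `f` at `a`. -/
noncomputable def col (f : A.Rep S) (a : I) (t : V) : L :=
  A.elt fun x z => if z = t then f a x else 0

theorem col_add (f g : A.Rep S) (a : I) (t : V) :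
    A.col (f + g) a t = A.col f a t + A.col g a t := by
  classical
  refine A.ext fun x z h => ?_
  rw [map_add, Pi.add_apply, Pi.add_apply, col, col, col, A.coef_elt _ h, A.coef_elt _ h,
    A.coef_elt _ h]
  split_ifs <;> simp

/-- If the set is everything below `t a`, the summand is the left ideal spanned by the column of `t
a`, and `col` is that identification. If the set is empty, the column is zero. -/
theorem col_smul {t : I → V} (hS : S.Generated t) (r : L) (f : A.Rep S) (a : I) :
    A.col (r • f) a (t a) = r * A.col f a (t a) := by
  classical
  refine A.ext fun x z h => ?_
  rw [A.coef_mul _ _ _ _ h, col, A.coef_elt _ h]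
  split_ifs with hz
  · subst hz
    rcases hS a with h1 | h1
    · rw [Rep.smul_apply A _ _ ((h1 x).2 h)]
      refine Finset.sum_congr rfl fun y _ => ?_
      by_cases hy : R y (t a)
      · rw [col, A.coef_elt _ hy, if_pos rfl]
      · rw [f.2 a y (mt (h1 y).1 hy), A.coef_eq_zero _ _ _ hy]
    · rw [(r • f).2 a x (h1 x)]
      refine (Finset.sum_eq_zero fun y _ => ?_).symm
      by_cases hy : R y (t a)
      · rw [col, A.coef_elt _ hy, if_pos rfl, f.2 a y (h1 y), mul_zero]
      · rw [A.coef_eq_zero _ _ _ hy, mul_zero]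
  · refine (Finset.sum_eq_zero fun y _ => ?_).symm
    by_cases hy : R y z
    · rw [col, A.coef_elt _ hy, if_neg hz, mul_zero]
    · rw [A.coef_eq_zero _ _ _ hy, mul_zero]

variable [Fintype I]

/-- Here each set only has to lie below its top. This is weaker than `Shape.Generated`, so it also
applies to the non-projective box modules. -/
theorem Rep.sum_col_smul {t : I → V} (hS : ∀ a x, S.mem a x → R x (t a) ∧ S.mem a (t a))
    (f : A.Rep S) : ∑ a, A.col f a (t a) • Rep.basisVec A S a (t a) = f := by
  classical
  refine Rep.ext A fun b x hx => ?_
  rw [Rep.sum_apply, Finset.sum_eq_single b]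
  · rw [Rep.smul_basisVec A _ (hS b x hx).2 hx rfl, col, A.coef_elt _ (hS b x hx).1, if_pos rfl]
  · exact fun a _ ha => Rep.smul_basisVec_of_ne A _ ha.symm
  · simp

variable {M : Type*} [AddCommGroup M] [Module L M]

/-- The homomorphism determined by the images of the generators. -/
noncomputable def liftGen {t : I → V} (hS : S.Generated t) (m : I → M) : A.Rep S →ₗ[L] M where
  toFun f := ∑ a, A.col f a (t a) • m a
  map_add' f g := by simp [col_add, add_smul, Finset.sum_add_distrib]
  map_smul' r f := by simp [A.col_smul hS, mul_smul, Finset.smul_sum]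

theorem hom_eq_liftGen {t : I → V} (hS : S.Generated t) (h : A.Rep S →ₗ[L] M) :
    h = A.liftGen hS fun a => h (Rep.basisVec A S a (t a)) := by
  refine LinearMap.ext fun f => ?_
  conv_lhs => rw [← Rep.sum_col_smul A (fun a x hx =>
    have h1 := (hS a).resolve_right fun h => h x hx
    ⟨(h1 x).1 hx, (h1 _).2 (A.refl _)⟩) f]
  simp [liftGen]

theorem hom_ext {t : I → V} (hS : S.Generated t) {h h' : A.Rep S →ₗ[L] M}
    (H : ∀ a, S.mem a (t a) → h (Rep.basisVec A S a (t a)) = h' (Rep.basisVec A S a (t a))) :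
    h = h' := by
  classical
  rw [A.hom_eq_liftGen hS h, A.hom_eq_liftGen hS h']
  congr 1
  funext a
  by_cases ha : S.mem a (t a)
  · exact H a ha
  · have : Rep.basisVec A S a (t a) = 0 := Rep.ext A fun b x hx => by
      rw [Rep.basisVec_apply A hx, if_neg]; · rfl
      rintro ⟨rfl, rfl⟩; exact ha hx
    rw [this, map_zero, map_zero]

/-- The generator is fixed by the idempotent at `t a`, so only that component of `m a` can be its
image. -/
theorem liftGen_basisVec {t : I → V} (hS : S.Generated t) (m : I → M) {a : I}
    (ha : S.mem a (t a)) :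
    A.liftGen hS m (Rep.basisVec A S a (t a)) = A.single (t a) (t a) • m a := by
  classical
  have h1 := (hS a).resolve_right fun h => h _ ha
  change ∑ b, A.col (Rep.basisVec A S a (t a)) b (t b) • m b = _
  rw [Finset.sum_eq_single a]
  · congr 1
    refine A.ext fun x z h => ?_
    rw [col, A.coef_elt _ h, A.coef_single _ _ h]
    by_cases hz : z = t a
    · subst hz
      rw [if_pos rfl, Rep.basisVec_apply A ((h1 x).2 h)]
      simp
    · rw [if_neg hz, if_neg fun h => hz h.2]
  · intro b _ hb
    have : A.col (Rep.basisVec A S a (t a)) b (t b) = 0 := A.ext fun x z h => by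
      rw [col, A.coef_elt _ h, map_zero]
      split_ifs
      · by_cases hx : S.mem b x
        · rw [Rep.basisVec_apply A hx, if_neg fun h => hb h.1]; rfl
        · exact (Rep.basisVec A S a (t a)).2 _ _ hx
      · rfl
    rw [this, zero_smul]
  · simp

/-- Preimages of the generators under a surjection are chosen freely; the idempotent that `liftGen`
inserts acts trivially on the generators themselves. -/
theorem Rep.projective {t : I → V} (hS : S.Generated t) : Module.Projective L (A.Rep S) := by
  refine Module.Projective.of_lifting_property'' fun f hf => ?_
  choose g hg using fun a => hf (Rep.basisVec A S a (t a))
  refine ⟨A.liftGen hS g, A.hom_ext hS fun a ha => ?_⟩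
  have h1 := (hS a).resolve_right fun h => h _ ha
  rw [LinearMap.comp_apply, A.liftGen_basisVec hS g ha, map_smul, hg, LinearMap.id_apply,
    Rep.single_smul_basisVec A ha ha (A.refl _)]

/-! ### The dual of `Ext^n(X, L)` -/

/-- The homomorphism to `L` mapping the `a`-th generator to `∑ g a y e_{t a, y}`. -/
noncomputable def toRegular {t : I → V} (hS : S.Generated t) (g : I → V → k) : A.Rep S →ₗ[L] L :=
  A.liftGen hS fun a => ∑ y, g a y • A.single (t a) y

theorem toRegular_basisVec {t : I → V} (hS : S.Generated t) (g : I → V → k) {a : I}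
    (ha : S.mem a (t a)) : A.toRegular hS g (Rep.basisVec A S a (t a)) =
      ∑ y, g a y • A.single (t a) y := by
  rw [toRegular, A.liftGen_basisVec hS _ ha, smul_eq_mul, Finset.mul_sum]
  refine Finset.sum_congr rfl fun y _ => ?_
  by_cases hy : R (t a) y
  · rw [mul_smul_comm, A.single_mul_single (A.refl _) hy]
  · rw [A.single_eq_zero hy, smul_zero, mul_zero]

theorem exists_toRegular {t : I → V} (hS : S.Generated t) (h : A.Rep S →ₗ[L] L) :
    ∃ g, A.toRegular hS g = h := by
  refine ⟨fun a y => A.coef (h (Rep.basisVec A S a (t a))) (t a) y, A.hom_ext hS fun a ha => ?_⟩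
  rw [A.toRegular_basisVec hS _ ha, ← A.single_mul_eq_sum _ _ _ (A.refl _), ← smul_eq_mul,
    ← map_smul, Rep.single_smul_basisVec A ha ha (A.refl _)]

theorem toRegular_add {t : I → V} (hS : S.Generated t) (g g' : I → V → k) :
    A.toRegular hS (g + g') = A.toRegular hS g + A.toRegular hS g' :=
  A.hom_ext hS fun a ha => by
    simp only [LinearMap.add_apply, A.toRegular_basisVec hS _ ha, Pi.add_apply, add_smul,
      Finset.sum_add_distrib]

theorem toRegular_smul {t : I → V} (hS : S.Generated t) (c : k) (g : I → V → k) (f : A.Rep S) :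
    A.toRegular hS (c • g) f = c • A.toRegular hS g f := by
  simp only [toRegular, liftGen, LinearMap.coe_mk, AddHom.coe_mk, Finset.smul_sum (r := c),
    Pi.smul_apply, smul_assoc]
  refine Finset.sum_congr rfl fun a _ => ?_
  rw [← Finset.smul_sum, smul_eq_mul, smul_eq_mul, mul_smul_comm]

/-- The inclusion of representations on the same index set. -/
theorem exists_extension_iff {P : Shape R I} {q q' : I → V} (hS : S.Generated q)
    (hP : P.Generated q') (i : A.Rep S →ₗ[L] A.Rep P)
    (hi : ∀ a, S.mem a (q a) → i (Rep.basisVec A S a (q a)) = Rep.basisVec A P a (q a))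
    (hSP : ∀ a, S.mem a (q a) → R (q a) (q' a) ∧ P.mem a (q' a)) (g : I → V → k) :
    (∃ H : A.Rep P →ₗ[L] L, H ∘ₗ i = A.toRegular hS g) ↔
      ∀ a y, S.mem a (q a) → R (q a) y → ¬ R (q' a) y → g a y = 0 := by
  classical
  -- The generator at `q a` is `e_{q a, q' a}` times the generator at `q' a`. An extendable
  -- homomorphism therefore takes it into `e_{q a, q' a} L`, whose coordinates live at the y with `R
  -- (q' a) y`.
  have key : ∀ a, S.mem a (q a) → ∀ H : A.Rep P →ₗ[L] L, (H ∘ₗ i) (Rep.basisVec A S a (q a)) =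
      A.single (q a) (q' a) * H (Rep.basisVec A P a (q' a)) := by
    intro a ha H
    have hP1 := (hP a).resolve_right fun h => h _ (hSP a ha).2
    rw [LinearMap.comp_apply, hi a ha, ← smul_eq_mul, ← map_smul, Rep.single_smul_basisVec A
      ((hP1 _).2 (hSP a ha).1) (hSP a ha).2 (hSP a ha).1]
  have key2 : ∀ a z, R (q a) z → A.coef (∑ y, g a y • A.single (q a) y) (q a) z = g a z := by
    intro a z hz
    simp only [map_sum, map_smul, Finset.sum_apply, Pi.smul_apply, A.coef_single _ _ hz,
      smul_eq_mul, mul_ite, mul_one, mul_zero]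
    simp
  constructor
  · rintro ⟨H, hH⟩ a y ha hy hy'
    have h1 := key a ha H
    rw [hH, A.toRegular_basisVec hS _ ha] at h1
    rw [← key2 a y hy, h1, A.coef_single_mul (hSP a ha).1 _ hy, A.coef_eq_zero _ _ _ hy']
  · intro hg
    refine ⟨A.toRegular hP g, A.hom_ext hS fun a ha => ?_⟩
    rw [key a ha, A.toRegular_basisVec hS _ ha, A.toRegular_basisVec hP _ (hSP a ha).2,
      Finset.mul_sum]
    refine Finset.sum_congr rfl fun y _ => ?_
    rw [mul_smul_comm]
    by_cases hy : R (q' a) y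
    · rw [A.single_mul_single (hSP a ha).1 hy]
    · rw [A.single_eq_zero hy, mul_zero]
      by_cases hy' : R (q a) y
      · rw [hg a y ha hy' hy, zero_smul, zero_smul]
      · rw [A.single_eq_zero hy']

open Abelian

section

open scoped ModuleCat

/-- The Yoneda product with `η`, in terms of coordinates. -/
noncomputable def yoneda {t : I → V} (hS : S.Generated t) {X : ModuleCat.{u} L} {n : ℕ}
    (η : Ext.{u} X (ModuleCat.of L (A.Rep S)) n) :
    (I → V → k) →ₗ[k] Ext.{u} X (ModuleCat.of L L) n where
  toFun g := η.comp (Ext.mk₀ (ModuleCat.ofHom (A.toRegular hS g))) (add_zero n)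
  map_add' g g' := by
    rw [toRegular_add, ModuleCat.ofHom_add, Ext.mk₀_add, Ext.comp_add]
  map_smul' c g := by
    rw [RingHom.id_apply, ← Ext.comp_smul, ← Ext.mk₀_smul]
    congr 2
    ext f
    refine (A.toRegular_smul hS c g f).trans ?_
    exact Algebra.smul_def c _

/-- Postcomposition does not touch `η`, so the right action on Ext is right multiplication on the
images of the generators. -/
theorem extRight_yoneda {t : I → V} (hS : S.Generated t) {X : ModuleCat.{u} L} {n : ℕ}
    (η : Ext.{u} X (ModuleCat.of L (A.Rep S)) n) (r : L) (g g' : I → V → k)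
    (h : ∀ a, S.mem a (t a) → (∑ y, g a y • A.single (t a) y) * r =
      ∑ y, g' a y • A.single (t a) y) :
    extRight k L n X r (A.yoneda hS η g) = A.yoneda hS η g' := by
  change (η.comp (Ext.mk₀ (ModuleCat.ofHom (A.toRegular hS g))) (add_zero n)).comp
    (Ext.mk₀ (rightMul L r)) (add_zero n) = _
  rw [Ext.comp_assoc_of_third_deg_zero, Ext.mk₀_comp_mk₀]
  change _ = η.comp (Ext.mk₀ (ModuleCat.ofHom (A.toRegular hS g'))) (add_zero n)
  congr 2
  rw [rightMul, ← ModuleCat.ofHom_comp]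
  congr 1
  refine A.hom_ext hS fun a ha => ?_
  rw [LinearMap.comp_apply, A.toRegular_basisVec hS _ ha, A.toRegular_basisVec hS _ ha, ← h a ha]
  rfl

/-- An element of `D Ext^n(X, L)` as a functional. -/
def _root_.DualExt.toDual {n : ℕ} {X : ModuleCat.{u} L} (φ : DualExt k L n X) :
    Module.Dual k (Ext.{u} X (ModuleCat.of L L) n) := φ

/-- By `PresentsExt`, Ext^n(X, L) is the cokernel of Hom(P, L) → Hom(S, L). In coordinates it has a
basis of the pairs (a, y) with `R (q a) y` and not `R (q' a) y`, and its dual is the representation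
on these pairs. The map `e` skips the indices at which `S` is empty. -/
theorem nonempty_dualExt_equiv {P : Shape R I} {q q' : I → V} (hS : S.Generated q)
    (hP : P.Generated q') (i : A.Rep S →ₗ[L] A.Rep P)
    (hi : ∀ a, S.mem a (q a) → i (Rep.basisVec A S a (q a)) = Rep.basisVec A P a (q a))
    (hSP : ∀ a, S.mem a (q a) → R (q a) (q' a) ∧ P.mem a (q' a))
    {X : ModuleCat.{u} L} {n : ℕ} (η : Ext.{u} X (ModuleCat.of L (A.Rep S)) n)
    (hη : PresentsExt (ModuleCat.of L L) (ModuleCat.ofHom i) η)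
    [Fintype J] (T : Shape R J) (e : J → I) (he : Function.Injective e)
    (h1 : ∀ b, S.mem (e b) (q (e b))) (h2 : ∀ a, S.mem a (q a) → ∃ b, e b = a)
    (hT : ∀ b y, T.mem b y ↔ R (q (e b)) y ∧ ¬ R (q' (e b)) y) :
    Nonempty (DualExt k L n X ≃ₗ[L] A.Rep T) := by
  classical
  have surj : Function.Surjective (A.yoneda hS η) := fun z => by
    obtain ⟨h, hz⟩ := hη.1 z
    obtain ⟨g, hg⟩ := A.exists_toRegular hS h.hom
    refine ⟨g, ?_⟩
    rw [← hz]
    change η.comp (Ext.mk₀ (ModuleCat.ofHom (A.toRegular hS g))) (add_zero n) = _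
    rw [hg]; rfl
  have ker : ∀ g, A.yoneda hS η g = 0 ↔ ∀ b y, T.mem b y → g (e b) y = 0 := fun g => by
    have : A.yoneda hS η g = 0 ↔ ∃ H : A.Rep P →ₗ[L] L, H ∘ₗ i = A.toRegular hS g := by
      refine (hη.2 _).trans ⟨?_, ?_⟩
      · rintro ⟨H, hH⟩
        exact ⟨H.hom, congrArg ModuleCat.Hom.hom hH⟩
      · rintro ⟨H, hH⟩
        exact ⟨ModuleCat.ofHom H, by rw [← ModuleCat.ofHom_comp, hH]⟩
    rw [this, A.exists_extension_iff hS hP i hi hSP]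
    constructor
    · intro H b y hb
      exact H _ _ (h1 b) ((hT b y).1 hb).1 ((hT b y).1 hb).2
    · intro H a y ha hy hy'
      obtain ⟨b, rfl⟩ := h2 a ha
      exact H b y ((hT b y).2 ⟨hy, hy'⟩)
  -- These are the coordinates of the homomorphism that maps the generator at `a` to `e_{q a, y}`
  -- and the other generators to 0.
  let δ : I → V → I → V → k := fun a y => Pi.single a (Pi.single y 1)
  have hδ : ∀ a y z, z ≠ y → δ a y a z = 0 := fun a y z h => by
    simp [δ, Pi.single_eq_of_ne h]
  have hδ' : ∀ a y b, b ≠ a → δ a y b = 0 := fun a y b h => by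
    simp [δ, Pi.single_eq_of_ne h]
  have hδs : ∀ a y, δ a y a y = 1 := fun a y => by simp [δ]
  have hz : ∀ b y, ¬ T.mem b y → A.yoneda hS η (δ (e b) y) = 0 := fun b y h => by
    rw [ker]
    intro b' y' h'
    by_cases hb : e b' = e b
    · obtain rfl := he hb
      exact hδ _ _ _ (by rintro rfl; exact h h')
    · rw [hδ' _ _ _ hb]; rfl
  let Φ : DualExt k L n X →ₗ[L] A.Rep T :=
    { toFun := fun φ => Rep.mk A fun b y =>
        φ.toDual (A.yoneda hS η (δ (e b) y))
      map_add' := fun φ ψ => Rep.ext A fun b y hb => by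
        rw [Rep.mk_apply A _ hb, Rep.add_apply, Rep.mk_apply A _ hb, Rep.mk_apply A _ hb]
        rfl
      map_smul' := fun r φ => Rep.ext A fun b y hb => by
        rw [RingHom.id_apply, Rep.mk_apply A _ hb, Rep.smul_apply A _ _ hb]
        have e1 : extRight k L n X r (A.yoneda hS η (δ (e b) y)) =
            ∑ z, A.coef r y z • A.yoneda hS η (δ (e b) z) := by
          rw [A.extRight_yoneda hS η r (δ (e b) y) (∑ z, A.coef r y z • δ (e b) z), map_sum]
          · simp only [map_smul]
          · intro a ha
            by_cases hab : a = e b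
            · subst hab
              rw [Finset.sum_eq_single y, hδs, one_smul,
                A.single_mul_eq_sum _ _ _ ((hT b y).1 hb).1]
              · refine Finset.sum_congr rfl fun z _ => ?_
                congr 1
                simp only [Finset.sum_apply, Pi.smul_apply, smul_eq_mul]
                rw [Finset.sum_eq_single z, hδs, mul_one]
                · intro w _ hw
                  rw [hδ _ _ _ hw.symm, mul_zero]
                · simp
              · intro z _ hz
                rw [hδ _ _ _ hz, zero_smul]
              · simp
            · simp only [Finset.sum_apply, Pi.smul_apply, hδ' _ _ _ hab, Pi.zero_apply, zero_smul,
                Finset.sum_const_zero, zero_mul, smul_zero]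
        refine (congrArg φ.toDual e1).trans ?_
        rw [map_sum]
        refine Finset.sum_congr rfl fun z _ => ?_
        rw [map_smul, smul_eq_mul]
        by_cases hz' : T.mem b z
        · rw [Rep.mk_apply A _ hz']
        · rw [hz b z hz', map_zero, (Rep.mk A _ : A.Rep T).2 b z hz'] }
  refine ⟨LinearEquiv.ofBijective Φ ⟨?_, ?_⟩⟩
  · rw [injective_iff_map_eq_zero]
    intro φ hφ
    have h3 : φ.toDual ∘ₗ A.yoneda hS η = 0 := by
      refine LinearMap.pi_ext' fun a => LinearMap.pi_ext' fun y => LinearMap.ext_ring ?_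
      change φ.toDual (A.yoneda hS η (δ a y)) = 0
      by_cases h : ∃ b, e b = a ∧ T.mem b y
      · obtain ⟨b, rfl, hb⟩ := h
        have := congrArg (fun f : A.Rep T => f b y) hφ
        exact (Rep.mk_apply A (S := T) _ hb).symm.trans this
      · have : A.yoneda hS η (δ a y) = 0 := by
          rw [ker]
          intro b' y' h'
          by_cases hb : e b' = a
          · subst hb
            exact hδ _ _ _ (by rintro rfl; exact h ⟨b', rfl, h'⟩)
          · rw [hδ' _ _ _ hb]; rfl
        rw [this, map_zero]
    refine LinearMap.ext fun z => ?_
    obtain ⟨g, rfl⟩ := surj z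
    exact LinearMap.congr_fun h3 g
  · intro g₀
    -- The prescribed coordinates define a functional that vanishes on the kernel of `yoneda`; over
    -- a field it factors through a functional on Ext.
    let lam : (I → V → k) →ₗ[k] k :=
      { toFun := fun g => ∑ b, ∑ y, g₀ b y * g (e b) y
        map_add' := fun g g' => by simp [mul_add, Finset.sum_add_distrib]
        map_smul' := fun c g => by simp [Finset.mul_sum, mul_left_comm] }
    have hl : lam ∈ (LinearMap.ker (A.yoneda hS η)).dualAnnihilator := by
      rw [Submodule.mem_dualAnnihilator]
      intro g hg
      rw [LinearMap.mem_ker, ker] at hg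
      refine Finset.sum_eq_zero fun b _ => Finset.sum_eq_zero fun y _ => ?_
      by_cases hb : T.mem b y
      · rw [hg b y hb, mul_zero]
      · rw [g₀.2 b y hb, zero_mul]
    rw [← LinearMap.range_dualMap_eq_dualAnnihilator_ker] at hl
    obtain ⟨φ, hφ⟩ := hl
    refine ⟨φ, Rep.ext A fun b y hb => ?_⟩
    refine (Rep.mk_apply A (S := T) _ hb).trans ?_
    refine (LinearMap.congr_fun hφ (δ (e b) y)).trans ?_
    change ∑ b', ∑ y', g₀ b' y' * δ (e b) y (e b') y' = _
    rw [Finset.sum_eq_single b, Finset.sum_eq_single y, hδs, mul_one]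
    · intro z _ hz'
      rw [hδ _ _ _ hz', mul_zero]
    · simp
    · intro b' _ hb'
      simp [hδ' _ _ _ (he.ne hb')]
    · simp

end

end RelAlg

namespace RelAlg

/-! ### Subrepresentations and quotients -/

section

variable {k : Type u} [Field k] {V : Type} {R : V → V → Prop} {I : Type} {S P Q : Shape R I}

/-- `S` is closed under predecessors in `P` and `Q` is its complement. -/
structure Splits (S P Q : Shape R I) : Prop where
  le : ∀ a x, S.mem a x → P.mem a x
  lower : ∀ a x y, P.mem a x → S.mem a y → R x y → S.mem a x
  mem_iff : ∀ a x, Q.mem a x ↔ P.mem a x ∧ ¬ S.mem a x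

open scoped Classical in
theorem Splits.compat_left (h : Splits S P Q) :
    Compat (k := k) S P fun b a => if b = a then 1 else 0 := by
  intro b a x y hC hx hy hxy
  obtain rfl : b = a := by by_contra hne; exact hC (if_neg hne)
  exact ⟨fun _ => h.le _ _ hy, fun _ => h.lower _ _ _ hx hy hxy⟩

open scoped Classical in
theorem Splits.compat_right (h : Splits S P Q) :
    Compat (k := k) P Q fun b a => if b = a then 1 else 0 := by
  intro b a x y hC hx hy hxy
  obtain rfl : b = a := by by_contra hne; exact hC (if_neg hne)
  rw [h.mem_iff] at hx ⊢
  exact ⟨fun _ => ⟨hy, fun h' => hx.2 (h.lower _ _ _ hx.1 h' hxy)⟩, fun _ => hx.1⟩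

end

variable {k : Type u} [Field k] {L : Type u} [Ring L] [Algebra k L] {V : Type} [Fintype V]
  {R : V → V → Prop} (A : RelAlg k L R) {I : Type} [Fintype I] {S P Q : Shape R I}

open scoped Classical in
theorem matMap_one_apply {S T : Shape R I}
    (h : Compat (k := k) S T fun b a => if b = a then 1 else 0)
    (f : A.Rep S) {a : I} {x : V} (hx : T.mem a x) : A.matMap _ h f a x = f a x := by
  rw [A.matMap_apply _ h f hx, Finset.sum_eq_single a] <;> simp +contextual [eq_comm]

open scoped Classical in
theorem matMap_one_basisVec {S T : Shape R I}
    (h : Compat (k := k) S T fun b a => if b = a then 1 else 0) {a : I} {t : V} (ht : S.mem a t) :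
    A.matMap _ h (Rep.basisVec A S a t) = Rep.basisVec A T a t := by
  refine Rep.ext A fun b x hx => ?_
  rw [A.matMap_one_apply h _ hx, Rep.basisVec_apply A hx]
  by_cases hS : S.mem b x
  · exact Rep.basisVec_apply A hS
  · rw [(Rep.basisVec A S a t).2 _ _ hS, if_neg]
    rintro ⟨rfl, rfl⟩; exact hS ht

/-- The inclusion of a subrepresentation. -/
noncomputable def Splits.incl (h : Splits S P Q) : A.Rep S →ₗ[L] A.Rep P :=
  A.matMap _ h.compat_left

/-- The projection to the quotient representation. -/
noncomputable def Splits.proj (h : Splits S P Q) : A.Rep P →ₗ[L] A.Rep Q :=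
  A.matMap _ h.compat_right

theorem Splits.proj_comp_incl (h : Splits S P Q) : h.proj A ∘ₗ h.incl A = 0 := by
  classical
  refine LinearMap.ext fun f => Rep.ext A fun a x hx => ?_
  have hx' := (h.mem_iff a x).1 hx
  rw [LinearMap.comp_apply, Splits.proj, A.matMap_one_apply _ _ hx, Splits.incl,
    A.matMap_one_apply _ _ hx'.1, f.2 a x hx'.2]
  rfl

theorem Splits.ofHom_comp (h : Splits S P Q) :
    ModuleCat.ofHom (h.incl A) ≫ ModuleCat.ofHom (h.proj A) = 0 := by
  rw [← ModuleCat.ofHom_comp, h.proj_comp_incl]; rfl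

theorem Splits.shortExact (h : Splits S P Q) :
    (ShortComplex.mk _ _ (h.ofHom_comp A)).ShortExact := by
  classical
  refine ModuleCat.shortComplex_shortExact _ ?_ ?_ ?_
  · intro f
    refine ⟨fun hf => ?_, ?_⟩
    · refine ⟨(Rep.mk A f.1 : A.Rep S), Rep.ext A fun a x hx => ?_⟩
      change (A.matMap _ h.compat_left _) a x = f.1 a x
      rw [A.matMap_one_apply _ _ hx]
      by_cases hS : S.mem a x
      · exact Rep.mk_apply A _ hS
      · rw [(Rep.mk A f.1 : A.Rep S).2 _ _ hS]
        have hQ := (h.mem_iff a x).2 ⟨hx, hS⟩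
        have h1 : A.matMap _ h.compat_right f a x = 0 :=
          congrArg (fun g : A.Rep Q => g a x) hf
        rw [A.matMap_one_apply _ _ hQ] at h1
        exact h1.symm
    · rintro ⟨g, rfl⟩
      exact LinearMap.congr_fun (h.proj_comp_incl A) g
  · intro f g hfg
    refine Rep.ext A fun a x hx => ?_
    have h1 : A.matMap _ h.compat_left f a x = A.matMap _ h.compat_left g a x :=
      congrArg (fun g : A.Rep P => g a x) hfg
    rwa [A.matMap_one_apply _ _ (h.le _ _ hx), A.matMap_one_apply _ _ (h.le _ _ hx)] at h1
  · intro g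
    refine ⟨(Rep.mk A g.1 : A.Rep P), Rep.ext A fun a x hx => ?_⟩
    change (A.matMap _ h.compat_right _) a x = g.1 a x
    rw [A.matMap_one_apply _ _ hx]
    exact Rep.mk_apply A _ ((h.mem_iff a x).1 hx).1

end RelAlg

/-! ## Chains and interlacing -/

/-- `x_t ≤ y_t`, and `y_t ≤ x_s` for `s < t`. -/
def Interlaced {n : ℕ} (x y : Fin n → ℤ) : Prop :=
  (∀ t, x t ≤ y t) ∧ ∀ s t, s < t → y t ≤ x s

/-- The chains `m - 1 ≥ w_1 ≥ ⋯ ≥ w_n ≥ 0`. -/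
def Chain (m n : ℕ) : Type :=
  {w : Fin n → ℤ // Interlaced w w ∧ ∀ t, 0 ≤ w t ∧ w t < m}

/-- The interlacing relation on chains. -/
abbrev ChainRel (m n : ℕ) : Chain m n → Chain m n → Prop := fun x y => Interlaced x.1 y.1

noncomputable instance (m n : ℕ) : Fintype (Chain m n) := by
  refine @Fintype.ofFinite _ (Set.Finite.to_subtype
    ((Set.finite_Icc (fun _ => (0 : ℤ)) (fun _ => (m : ℤ))).subset ?_))
  exact fun w hw => ⟨fun t => (hw.2 t).1, fun t => (hw.2 t).2.le⟩

namespace Chain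

variable {m n : ℕ}

theorem anti (u : Chain m n) {s t : Fin n} (h : s ≤ t) : u.1 t ≤ u.1 s := by
  rcases h.eq_or_lt with rfl | h
  · exact le_rfl
  · exact u.2.1.2 s t h

theorem nonneg (u : Chain m n) (t : Fin n) : 0 ≤ u.1 t := (u.2.2 t).1

theorem lt (u : Chain m n) (t : Fin n) : u.1 t < m := (u.2.2 t).2

/-- The vector with entries `u_t` for `t ≤ c` and `u_{t+1} - 1` for `t > c`, the top of the `c`-th
term of the resolution (from the left) of the module of `u`. -/
def top (u : Chain m (n + 1)) (c : ℕ) : Fin n → ℤ := fun t =>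
  if t.val < c then u.1 t.castSucc else u.1 t.succ - 1

theorem castSucc_ge (u : Chain m (n + 1)) (t : Fin n) : u.1 t.succ ≤ u.1 t.castSucc :=
  u.anti (Fin.castSucc_lt_succ).le

theorem castSucc_le_succ (u : Chain m (n + 1)) {s t : Fin n} (h : s < t) :
    u.1 t.castSucc ≤ u.1 s.succ := u.anti (Fin.succ_le_castSucc_iff.2 h)

theorem succ_anti (u : Chain m (n + 1)) {s t : Fin n} (h : s ≤ t) :
    u.1 t.succ ≤ u.1 s.succ := u.anti (Fin.succ_le_succ_iff.2 h)

theorem interlaced_top (u : Chain m (n + 1)) (c : ℕ) : Interlaced (u.top c) (u.top c) := by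
  refine ⟨fun t => le_rfl, fun s t h => ?_⟩
  have h1 := u.castSucc_le_succ h
  have h2 := u.castSucc_ge t
  have h3 := u.castSucc_ge s
  have h4 : s.val < t.val := h
  simp only [top]
  split_ifs <;> omega

theorem top_lt (u : Chain m (n + 1)) (c : ℕ) (t : Fin n) : u.top c t < m := by
  have h1 := u.lt t.castSucc
  have h2 := u.lt t.succ
  simp only [top]
  split_ifs <;> omega

open scoped Classical in
/-- The chain `u.top c`, if this is a chain. -/
noncomputable def topChain (u : Chain m (n + 1)) (c : ℕ) : Chain m n :=
  if h : ∀ t, 0 ≤ u.top c t then ⟨u.top c, u.interlaced_top c, fun t => ⟨h t, u.top_lt c t⟩⟩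
  else ⟨u.top n, u.interlaced_top n, fun t => ⟨by simp [top, u.nonneg], u.top_lt n t⟩⟩

theorem topChain_val (u : Chain m (n + 1)) (c : ℕ) (h : ∀ t, 0 ≤ u.top c t) :
    (u.topChain c).1 = u.top c :=
  congrArg Subtype.val (dif_pos h)

theorem top_nonneg (u : Chain m (n + 1)) (c : ℕ) (h : 1 ≤ u.1 (Fin.last n)) (t : Fin n) :
    0 ≤ u.top c t := by
  have h1 := u.anti (Fin.le_last t.castSucc)
  have h2 := u.anti (Fin.le_last t.succ)
  simp only [top]
  split_ifs <;> omega

end Chain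

/-! ### Projective resolutions of the box modules -/

section Shapes

variable {m n : ℕ} {I : Type} (u : I → Chain m (n + 1))

/-- The terms of the resolution. -/
def projShape (c : ℕ) : Shape (ChainRel m n) I where
  mem a x := Interlaced x.1 ((u a).top c)
  convex _ _ _ _ hx hz hxy hyz :=
    ⟨fun t => (hyz.1 t).trans (hz.1 t), fun s t h => (hx.2 s t h).trans (hxy.1 s)⟩
  rel _ _ _ _ hx hz hxy hyz :=
    ⟨fun t => (hxy.1 t).trans (hyz.1 t), fun s t h => (hz.1 t).trans (hx.2 s t h)⟩

/-- The syzygies; for `c = n` the modules of the chains `u a`. -/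
def syzShape (c : ℕ) : Shape (ChainRel m n) I where
  mem a x := Interlaced x.1 ((u a).top c) ∧ ∀ t, t.val < c → (u a).1 t.succ ≤ x.1 t
  convex a x y z hx hz hxy hyz := ⟨(projShape u c).convex a x y z hx.1 hz.1 hxy hyz,
    fun t ht => (hx.2 t ht).trans (hxy.1 t)⟩
  rel a x y z hx hz hxy hyz := (projShape u c).rel a x y z hx.1 hz.1 hxy hyz

/-- The remaining interlacing condition is automatic: for s < t one has u_t ≤ u_{s+1} ≤ x_s. So the
support is a box. -/
theorem syzShape_mem (a : I) (x : Chain m n) : (syzShape u n).mem a x ↔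
    ∀ t, (u a).1 t.succ ≤ x.1 t ∧ x.1 t ≤ (u a).1 t.castSucc := by
  have h1 : ∀ t : Fin n, (u a).top n t = (u a).1 t.castSucc := fun t => if_pos t.2
  simp only [syzShape, Interlaced, h1]
  refine ⟨fun h t => ⟨h.2 t t.2, h.1.1 t⟩, fun h => ⟨⟨fun t => (h t).2, fun s t hst => ?_⟩,
    fun t _ => (h t).1⟩⟩
  exact ((u a).castSucc_le_succ hst).trans (h s).1

/-- If `top` has a negative entry, no chain lies below it and the set is empty, so the fallback
value of `topChain` plays no role. -/
theorem generated_projShape (c : ℕ) : (projShape u c).Generated fun a => (u a).topChain c := by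
  intro a
  by_cases h : ∀ t, 0 ≤ (u a).top c t
  · left
    intro x
    simp only [projShape, ChainRel, (u a).topChain_val c h]
  · right
    intro x hx
    exact h fun t => (x.nonneg t).trans (hx.1 t)

theorem generated_syzShape : (syzShape u 0).Generated fun a => (u a).topChain 0 := by
  intro a
  rcases generated_projShape u 0 a with h | h
  · left
    intro x
    rw [← h x]
    simp [syzShape, projShape]
  · right
    intro x hx
    exact h x hx.1

/-- The tops for `c` and `c + 1` differ only in the entry at `c`, counted from 0: it is `u (c+1) -
1` for the first and `u c` for the second. So the projective for `c + 1` is cut by the value of `x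
c`: the part with `x c < u (c+1)` is the syzygy for `c`, and the part with `x c ≥ u (c+1)` is the
syzygy for `c + 1`. The lower bounds at the earlier positions follow from interlacing with the top.
-/
theorem splits_syzShape [Fintype I] {c : ℕ} (hc : c < n) :
    RelAlg.Splits (syzShape u c) (projShape u (c + 1)) (syzShape u (c + 1)) := by
  have key : ∀ a x, (projShape u (c + 1)).mem a x → ∀ t : Fin n, t.val < c →
      (u a).1 t.succ ≤ x.1 t := by
    intro a x hx t ht
    have h1 := hx.2 t ⟨t.val + 1, by omega⟩ (Fin.lt_def.2 (Nat.lt_succ_self _))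
    simp only [Chain.top] at h1
    rw [if_pos (by omega)] at h1
    exact h1
  have htop : ∀ a (t : Fin n), (u a).top c t ≤ (u a).top (c + 1) t := by
    intro a t
    have := (u a).castSucc_ge t
    simp only [Chain.top]
    split_ifs <;> omega
  refine ⟨fun a x hx => ⟨fun t => (hx.1.1 t).trans (htop a t), fun s t hst => ?_⟩,
    fun a x y hx hy hxy => ⟨⟨fun t => (hxy.1 t).trans (hy.1.1 t), fun s t hst =>
      (htop a t).trans (hx.2 s t hst)⟩, key a x hx⟩, fun a x => ⟨fun hx => ⟨hx.1, fun h => ?_⟩,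
      fun hx => ⟨hx.1, fun t ht => ?_⟩⟩⟩
  · have h1 := hx.1.2 s t hst
    have h2 := (u a).castSucc_le_succ hst
    have h3 : s.val < t.val := hst
    simp only [Chain.top] at h1 ⊢
    split_ifs at h1 ⊢ with h4 h5
    · exact h1
    · exact h2.trans (hx.2 s (by omega))
    · omega
    · exact h1
  · have h1 := hx.2 ⟨c, hc⟩ (Nat.lt_succ_self _)
    have h2 := h.1.1 ⟨c, hc⟩
    simp only [Chain.top, lt_irrefl, if_false] at h2
    omega
  · rcases Nat.lt_succ_iff_lt_or_eq.1 ht with h | h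
    · exact key a x hx.1 t h
    · by_contra hlt
      refine hx.2 ⟨⟨fun s => ?_, fun s r hsr => (htop a r).trans (hx.1.2 s r hsr)⟩,
        key a x hx.1⟩
      rcases eq_or_ne s t with rfl | hs
      · simp only [Chain.top, h, lt_irrefl, if_false]
        omega
      · have h1 := hx.1.1 s
        have h2 : s.val ≠ t.val := fun h' => hs (Fin.ext h')
        simp only [Chain.top] at h1 ⊢
        split_ifs at h1 ⊢ <;> omega

end Shapes

/-! ### The translate τ_n of a box module -/

namespace RelAlg

variable {k : Type u} [Field k] {L : Type u} [Ring L] [Algebra k L] {m n : ℕ}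
  (A : RelAlg k L (ChainRel m n)) {I J : Type} [Fintype I] [Fintype J]

/-- `τ_n` lowers all entries of a chain by one, and kills the chains with last entry zero. -/
theorem nonempty_arTranslate_equiv (hn : 1 ≤ n) (u : I → Chain m (n + 1))
    (v : J → Chain m (n + 1)) (e : J → I) (he : Function.Injective e)
    (huv : ∀ b t, (v b).1 t = (u (e b)).1 t - 1)
    (h2 : ∀ a, 1 ≤ (u a).1 (Fin.last n) → ∃ b, e b = a) {X : ModuleCat.{u} L}
    (f : X ≃ₗ[L] A.Rep (syzShape u n)) :
    Nonempty (arTranslate k L n X ≃ₗ[L] A.Rep (syzShape v n)) := by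
  have hS := (splits_syzShape u (c := 0) hn)
  have hproj : ∀ c, Projective (ModuleCat.of L (A.Rep (projShape u c))) := fun c =>
    (IsProjective.iff_projective _).1 (Rep.projective A (generated_projShape u c))
  obtain ⟨η, hη⟩ := exists_presentsExt (ModuleCat.of L L)
    (fun c => ModuleCat.of L (A.Rep (syzShape u c))) (ModuleCat.ofHom (hS.incl A))
    (ModuleCat.ofHom (hS.proj A)) (hS.ofHom_comp A) (hS.shortExact A) (hproj 1) n
    (fun c _ hc => ⟨_, _, _, _, (splits_syzShape u hc).shortExact A, hproj _⟩) n hn le_rfl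
  have hη' := hη.iso_comp f.toModuleIso
  have hlast : ∀ b, 1 ≤ (u (e b)).1 (Fin.last n) := fun b => by
    have h1 := huv b (Fin.last n)
    have h2 := (v b).nonneg (Fin.last n)
    omega
  refine A.nonempty_dualExt_equiv (generated_syzShape u) (generated_projShape u 1) (hS.incl A)
    (fun a ha => A.matMap_one_basisVec _ ha) (fun a ha => ?_) _ hη' (syzShape v n) e he
    (fun b => ?_) (fun a ha => h2 a ?_) (fun b y => ?_)
  · have h1 := hS.le _ _ ha
    have h2 := (generated_projShape u 1 a).resolve_right fun h => h _ h1
    exact ⟨(h2 _).1 h1, (h2 _).2 (A.refl _)⟩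
  · refine ⟨?_, fun t ht => absurd ht (Nat.not_lt_zero _)⟩
    rw [(u (e b)).topChain_val 0 ((u (e b)).top_nonneg 0 (hlast b))]
    exact (u (e b)).interlaced_top 0
  · have h3 := ha.1.1 ⟨n - 1, by omega⟩
    have h4 := ((u a).topChain 0).nonneg ⟨n - 1, by omega⟩
    have h5 : (⟨n - 1, by omega⟩ : Fin n).succ = Fin.last n := Fin.ext (by simp; omega)
    simp only [Chain.top, Nat.not_lt_zero, if_false, h5] at h3
    omega
  -- With positions counted from 1, the tops are (u_2 - 1, …, u_{n+1} - 1) and (u_1, u_3 - 1, …,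
  -- u_{n+1} - 1). Interlacing of the first with y gives all lower bounds u_{t+1} - 1 ≤ y_t and the
  -- upper bounds y_t ≤ u_t - 1 for t ≥ 2. Failure of interlacing for the second is then exactly the
  -- missing bound y_1 ≤ u_1 - 1.
  · rw [syzShape_mem, ChainRel, ChainRel,
      (u (e b)).topChain_val 0 ((u (e b)).top_nonneg 0 (hlast b)),
      (u (e b)).topChain_val 1 ((u (e b)).top_nonneg 1 (hlast b))]
    simp only [huv]
    generalize u (e b) = w
    constructor
    · refine fun h => ⟨⟨fun t => ?_, fun s t hst => ?_⟩, fun h' => ?_⟩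
      · simpa [Chain.top] using (h t).1
      · have h1 := w.castSucc_le_succ hst
        have h2 := (h t).2
        simp only [Chain.top, Nat.not_lt_zero, if_false]
        omega
      · have h1 := h'.1 ⟨0, hn⟩
        have h2 := (h ⟨0, hn⟩).2
        simp only [Chain.top, Nat.zero_lt_one, if_true] at h1
        omega
    · rintro ⟨h, h'⟩ t
      have h0 := h.1 t
      simp only [Chain.top, Nat.not_lt_zero, if_false] at h0
      refine ⟨h0, ?_⟩
      rcases Nat.eq_zero_or_pos t.val with ht | ht
      · by_contra hlt
        refine h' ⟨fun s => ?_, fun s r hsr => ?_⟩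
        · have h1 := h.1 s
          simp only [Chain.top, Nat.not_lt_zero, if_false] at h1 ⊢
          split_ifs with hs
          · obtain rfl : s = t := Fin.ext (by omega)
            omega
          · exact h1
        · have h1 := h.2 s r hsr
          have h2 := w.castSucc_ge s
          simp only [Chain.top, Nat.not_lt_zero, if_false] at h1 ⊢
          split_ifs <;> omega
      · have h1 := h.2 ⟨t.val - 1, by omega⟩ t (Fin.lt_def.2 (by simp; omega))
        simp only [Chain.top, Nat.not_lt_zero, if_false] at h1
        have h2 : (⟨t.val - 1, by omega⟩ : Fin n).succ = t.castSucc := Fin.ext (by simp; omega)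
        rwa [h2] at h1

end RelAlg

/-! ### The cone module as the sum of all box modules -/

namespace Chain

variable {m n : ℕ}

/-- The chain `(u_1, …, u_n)`. -/
def initChain (u : Chain m (n + 1)) : Chain m n :=
  ⟨fun t => u.1 t.castSucc,
    ⟨fun _ => le_rfl, fun _ _ h => u.anti (Fin.castSucc_le_castSucc_iff.2 h.le)⟩,
    fun t => u.2.2 t.castSucc⟩

/-- The chain `(u_2, …, u_{n+1})`. -/
def tailChain (u : Chain m (n + 1)) : Chain m n :=
  ⟨fun t => u.1 t.succ, ⟨fun _ => le_rfl, fun _ _ h => u.succ_anti h.le⟩, fun t => u.2.2 t.succ⟩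

/-- The chain `(m - 1, x_1, …, x_n)`. -/
def consTop (hm : 1 ≤ m) (x : Chain m n) : Chain m (n + 1) :=
  ⟨Fin.cons ((m : ℤ) - 1) x.1, ⟨fun _ => le_rfl, fun s t h => by
      obtain ⟨t, rfl⟩ := Fin.exists_succ_eq.2 (Fin.ne_zero_of_lt h)
      cases s using Fin.cases with
      | zero =>
        have := x.lt t
        simp only [Fin.cons_succ, Fin.cons_zero]
        omega
      | succ s => simpa using x.anti (Fin.succ_le_succ_iff.1 h.le)⟩,
    fun t => by
      cases t using Fin.cases with
      | zero => simp only [Fin.cons_zero]; omega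
      | succ t => simpa using x.2.2 t⟩

theorem consTop_tailChain (hm : 1 ≤ m) {u : Chain m (n + 1)} (hu : u.1 0 = m - 1) :
    consTop hm u.tailChain = u := by
  refine Subtype.ext (funext fun t => ?_)
  cases t using Fin.cases with
  | zero => exact hu.symm
  | succ t => rfl

/-- The chain `(u_1 + 1, …, u_n + 1)`. -/
def addOne (u : Chain m (n + 1)) (h : u.1 0 + 1 < m) : Chain m (n + 1) :=
  ⟨fun t => u.1 t + 1,
    ⟨fun _ => le_rfl, fun _ _ h => by have := u.anti h.le; dsimp only; omega⟩, fun t => by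
    have h1 := u.anti (Fin.zero_le t)
    have h2 := u.nonneg t
    dsimp only
    omega⟩

/-- The chain `(m - 1 - w_n, …, m - 1 - w_1)`. -/
def rev (w : Chain m n) : Chain m n :=
  ⟨fun t => m - 1 - w.1 t.rev, ⟨fun _ => le_rfl, fun s t h => by
    have := w.anti (Fin.rev_lt_rev.2 h).le
    dsimp only
    omega⟩, fun t => by
    have h1 := w.nonneg t.rev
    have h2 := w.lt t.rev
    dsimp only
    omega⟩

theorem rev_val (w : Chain m n) (t : Fin n) : w.rev.1 t = m - 1 - w.1 t.rev := rfl

theorem rev_rev (w : Chain m n) : w.rev.rev = w :=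
  Subtype.ext (funext fun t => by rw [rev_val, rev_val, Fin.rev_rev]; omega)

theorem rel_rev {x y : Chain m n} (h : ChainRel m n x y) : ChainRel m n y.rev x.rev := by
  refine ⟨fun t => ?_, fun s t hst => ?_⟩
  · have := h.1 t.rev
    simp only [rev_val]; omega
  · have := h.2 _ _ (Fin.rev_lt_rev.2 hst)
    simp only [rev_val]; omega

theorem rel_rev_iff (x y : Chain m n) : ChainRel m n x y ↔ ChainRel m n y.rev x.rev :=
  ⟨rel_rev, fun h => by simpa only [rev_rev] using rel_rev h⟩

/-- The involution `rev` as an equivalence. -/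
def revEquiv (m n : ℕ) : Chain m n ≃ Chain m n := ⟨rev, rev, rev_rev, rev_rev⟩

end Chain

/-- The chains with first entry `m - 1 - i`. -/
abbrev ChainLevel (m n i : ℕ) : Type := {u : Chain m (n + 1) // u.1 0 = (m : ℤ) - 1 - i}

/-- The shape of `τ_n^i (D L)`. -/
abbrev levelShape (m n i : ℕ) : Shape (ChainRel m n) (ChainLevel m n i) :=
  syzShape (fun u : ChainLevel m n i => u.1) n

/-- The shape of the sum of the modules of all chains. -/
abbrev totalShape (m n : ℕ) : Shape (ChainRel m n) (Chain m (n + 1)) := syzShape id n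

/-- The bound y_1 ≤ u_1 = m - 1 is void, so the box is the set of all chains above the tail of u, as
it should be for a summand of D L. -/
theorem levelShape_zero_mem {m n : ℕ} (u : ChainLevel m n 0) (y : Chain m n) :
    (levelShape m n 0).mem u y ↔ ChainRel m n u.1.tailChain y := by
  rw [syzShape_mem]
  refine ⟨fun h => ⟨fun t => (h t).1, fun s t hst => (h t).2.trans (u.1.castSucc_le_succ hst)⟩,
    fun h t => ⟨h.1 t, ?_⟩⟩
  rcases Nat.eq_zero_or_pos t.val with ht | ht
  · have h1 : t.castSucc = 0 := Fin.ext ht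
    have h2 := u.2
    have h3 := y.lt t
    rw [h1, h2]
    push_cast
    omega
  · have h1 := h.2 ⟨t.val - 1, by omega⟩ t (Fin.lt_def.2 (by simp; omega))
    have h2 : (⟨t.val - 1, by omega⟩ : Fin n).succ = t.castSucc := Fin.ext (by simp; omega)
    rw [← h2]
    exact h1

namespace RelAlg

variable {k : Type u} [Field k] {L : Type u} [Ring L] [Algebra k L] {m n : ℕ}
  (A : RelAlg k L (ChainRel m n))

/-- An element of `D L` as a functional. -/
def _root_.DualRegular.toDual (φ : DualRegular k L) : Module.Dual k L := φ

/-- A functional on L is given by its values on the basis. Its values on the row of x form the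
module of the chain (m - 1, x_1, …, x_n). -/
theorem nonempty_dualRegular_equiv (hm : 1 ≤ m) :
    Nonempty (DualRegular k L ≃ₗ[L] A.Rep (levelShape m n 0)) := by
  classical
  let Φ : DualRegular k L →ₗ[L] A.Rep (levelShape m n 0) :=
    { toFun := fun φ => Rep.mk A fun u y => φ.toDual (A.single u.1.tailChain y)
      map_add' := fun φ ψ => Rep.ext A fun u y h => by
        rw [Rep.mk_apply A _ h, Rep.add_apply, Rep.mk_apply A _ h, Rep.mk_apply A _ h]
        rfl
      map_smul' := fun r φ => Rep.ext A fun u y h => by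
        rw [RingHom.id_apply, Rep.mk_apply A _ h, Rep.smul_apply A _ _ h]
        have hR := (levelShape_zero_mem u y).1 h
        refine (congrArg φ.toDual (A.single_mul_eq_sum _ _ r hR)).trans ?_
        rw [map_sum]
        refine Finset.sum_congr rfl fun z _ => ?_
        rw [map_smul, smul_eq_mul]
        by_cases hz : (levelShape m n 0).mem u z
        · rw [Rep.mk_apply A _ hz]
        · rw [(Rep.mk A _ : A.Rep (levelShape m n 0)).2 u z hz,
            A.single_eq_zero (mt (levelShape_zero_mem u z).2 hz), map_zero] }
  have hu : ∀ x : Chain m n, (Chain.consTop hm x).1 0 = (m : ℤ) - 1 - (0 : ℕ) := fun x => by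
    simp [Chain.consTop]
  refine ⟨LinearEquiv.ofBijective Φ ⟨?_, fun g => ?_⟩⟩
  · rw [injective_iff_map_eq_zero]
    intro φ hφ
    refine LinearMap.ext fun r => ?_
    change φ.toDual r = 0
    rw [A.sum_smul_single r]
    simp only [map_sum, map_smul]
    refine Finset.sum_eq_zero fun x _ => Finset.sum_eq_zero fun y _ => ?_
    by_cases hxy : ChainRel m n x y
    · have h1 := congrArg (fun f : A.Rep (levelShape m n 0) => f ⟨_, hu x⟩ y) hφ
      have h2 : (levelShape m n 0).mem ⟨_, hu x⟩ y := (levelShape_zero_mem _ _).2 hxy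
      have h3 : φ.toDual (A.single x y) = 0 :=
        (Rep.mk_apply A (S := levelShape m n 0) _ h2).symm.trans h1
      rw [h3, smul_zero]
    · rw [A.coef_eq_zero _ _ _ hxy, zero_smul]
  · let φ : Module.Dual k L :=
      { toFun := fun r => ∑ x, ∑ y, A.coef r x y * g ⟨_, hu x⟩ y
        map_add' := fun r s => by simp [add_mul, Finset.sum_add_distrib]
        map_smul' := fun c r => by simp [Finset.mul_sum, mul_assoc] }
    refine ⟨φ, Rep.ext A fun u y h => ?_⟩
    refine (Rep.mk_apply A (S := levelShape m n 0) _ h).trans ?_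
    have hR := (levelShape_zero_mem u y).1 h
    change ∑ x, ∑ z, A.coef (A.single u.1.tailChain y) x z * g ⟨_, hu x⟩ z = g u y
    rw [Finset.sum_eq_single u.1.tailChain, Finset.sum_eq_single y]
    · rw [A.coef_single _ _ hR, if_pos ⟨rfl, rfl⟩, one_mul]
      have : (⟨_, hu u.1.tailChain⟩ : ChainLevel m n 0) = u :=
        Subtype.ext (Chain.consTop_tailChain hm (by simpa using u.2))
      rw [this]
    · intro z _ hz
      by_cases hz' : ChainRel m n u.1.tailChain z
      · rw [A.coef_single _ _ hz', if_neg fun h => hz h.2, zero_mul]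
      · rw [A.coef_eq_zero _ _ _ hz', zero_mul]
    · simp
    · intro x _ hx
      refine Finset.sum_eq_zero fun z _ => ?_
      by_cases hz' : ChainRel m n x z
      · rw [A.coef_single _ _ hz', if_neg fun h => hx h.1, zero_mul]
      · rw [A.coef_eq_zero _ _ _ hz', zero_mul]
    · simp

/-- Adding one to all entries identifies the chains of level i + 1 with those of level i whose last
entry is positive, and these are the ones that survive τ_n. -/
theorem nonempty_iterate_equiv (hm : 1 ≤ m) (hn : 1 ≤ n) (i : ℕ) :
    Nonempty ((arTranslate k L n)^[i] (ModuleCat.of L (DualRegular k L)) ≃ₗ[L]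
      A.Rep (levelShape m n i)) := by
  induction i with
  | zero => exact A.nonempty_dualRegular_equiv hm
  | succ i ih =>
    obtain ⟨f⟩ := ih
    rw [Function.iterate_succ_apply']
    have hlt : ∀ u : ChainLevel m n (i + 1), u.1.1 0 + 1 < (m : ℤ) := fun u => by
      have := u.2
      push_cast at this
      omega
    refine A.nonempty_arTranslate_equiv hn (fun u : ChainLevel m n i => u.1)
      (fun u : ChainLevel m n (i + 1) => u.1)
      (fun u => ⟨u.1.addOne (hlt u), ?_⟩) (fun u v h => ?_) (fun u t => ?_) (fun u hu => ?_) f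
    · have := u.2
      simp only [Chain.addOne]
      push_cast at this
      omega
    · refine Subtype.ext (Subtype.ext (funext fun t => ?_))
      have h1 : u.1.1 t + 1 = v.1.1 t + 1 :=
        congrFun (congrArg (fun w : ChainLevel m n i => w.1.1) h) t
      omega
    · simp [Chain.addOne]
    · refine ⟨⟨⟨fun t => u.1.1 t - 1, ⟨fun _ => le_rfl, fun s t h => ?_⟩, fun t => ?_⟩, ?_⟩, ?_⟩
      · have := u.1.anti h.le
        dsimp only
        omega
      · have h1 := u.1.anti (Fin.le_last t)
        have h2 := u.1.lt t
        dsimp only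
        omega
      · have := u.2
        push_cast
        omega
      · exact Subtype.ext (Subtype.ext (funext fun t => by simp [Chain.addOne]))

open scoped Classical in
theorem compat_level (m n i : ℕ) : Compat (k := k) (levelShape m n i) (totalShape m n)
    fun b a => if a.1 = b then 1 else 0 := by
  intro b a x y hC hx hy _
  obtain rfl : a.1 = b := by by_contra hne; exact hC (if_neg hne)
  exact ⟨fun _ => hy, fun _ => hx⟩

open scoped Classical in
theorem matMap_level_apply {i : ℕ} (f : A.Rep (levelShape m n i)) (u : ChainLevel m n i)
    {x : Chain m n} (hx : (totalShape m n).mem u.1 x) :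
    A.matMap _ (compat_level m n i) f u.1 x = f u x := by
  rw [A.matMap_apply _ _ f hx, Finset.sum_eq_single u]
  · simp
  · intro v _ hv
    rw [if_neg fun h => hv (Subtype.ext h), zero_mul]
  · simp

open scoped Classical in
theorem matMap_level_apply_of_ne {i : ℕ} (f : A.Rep (levelShape m n i)) {u : Chain m (n + 1)}
    (hu : u.1 0 ≠ (m : ℤ) - 1 - i) (x : Chain m n) :
    A.matMap _ (compat_level m n i) f u x = 0 := by
  by_cases hx : (totalShape m n).mem u x
  · rw [A.matMap_apply _ _ f hx]
    refine Finset.sum_eq_zero fun v _ => ?_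
    rw [if_neg, zero_mul]
    rintro rfl
    exact hu v.2
  · exact Subtype.prop (A.matMap _ (compat_level m n i) f) u x hx

/-- The level of a chain is determined by its first entry, so the chains are the disjoint union of
the levels. -/
theorem nonempty_coneModule_equiv (hm : 1 ≤ m) (hn : 1 ≤ n) :
    Nonempty (coneModule k L n ≃ₗ[L] A.Rep (totalShape m n)) := by
  classical
  have ψ := fun i => (A.nonempty_iterate_equiv hm hn i).some
  let φ : ∀ i, ((arTranslate k L n)^[i] (ModuleCat.of L (DualRegular k L))) →ₗ[L]
      A.Rep (totalShape m n) :=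
    fun i => A.matMap _ (compat_level m n i) ∘ₗ (ψ i).toLinearMap
  let Φ : coneModule k L n →ₗ[L] A.Rep (totalShape m n) := DirectSum.toModule L ℕ _ φ
  have hΦ : ∀ i z, Φ (DirectSum.lof L ℕ _ i z) = A.matMap _ (compat_level m n i) (ψ i z) :=
    fun i z => DirectSum.toModule_lof (φ := φ) L i z
  have key : ∀ (z : coneModule k L n) (i : ℕ) (u : ChainLevel m n i) (x : Chain m n),
      (totalShape m n).mem u.1 x → Φ z u.1 x = ψ i (z i) u x := by
    intro z i u x hx
    induction z using DirectSum.induction_on with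
    | zero => simp
    | of j z =>
      refine (congrArg (fun f : A.Rep (totalShape m n) => f u.1 x) (hΦ j z)).trans ?_
      dsimp only
      by_cases hij : j = i
      · subst hij
        rw [A.matMap_level_apply _ u hx, DirectSum.of_eq_same]
      · rw [A.matMap_level_apply_of_ne, DirectSum.of_eq_of_ne _ _ _ (Ne.symm hij), map_zero]
        · rfl
        · rw [u.2]
          omega
    | add z w hz hw => rw [map_add, Rep.add_apply, hz, hw, DirectSum.add_apply, map_add,
        Rep.add_apply]
  refine ⟨LinearEquiv.ofBijective Φ ⟨?_, fun f => ?_⟩⟩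
  · rw [injective_iff_map_eq_zero]
    intro z hz
    refine DFinsupp.ext fun i => (ψ i).injective (Rep.ext A fun u x hx => ?_)
    have h1 := key z i u x hx
    rw [hz] at h1
    simpa using h1.symm
  -- First entries lie between 0 and m - 1, so only the levels below m contribute.
  · refine ⟨∑ i ∈ Finset.range m, DirectSum.lof L ℕ _ i ((ψ i).symm (Rep.mk A fun u => f u.1)),
      Rep.ext A fun u x hx => ?_⟩
    have h1 := u.nonneg 0
    have h2 := u.lt 0
    have hu : u.1 0 = (m : ℤ) - 1 - ((m : ℤ) - 1 - u.1 0).toNat := by omega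
    rw [map_sum, Rep.sum_apply, Finset.sum_eq_single ((m : ℤ) - 1 - u.1 0).toNat]
    · rw [hΦ, LinearEquiv.apply_symm_apply]
      exact (A.matMap_level_apply _ ⟨u, hu⟩ hx).trans (Rep.mk_apply A (S := levelShape m n _) _ hx)
    · intro j _ hj
      rw [hΦ, A.matMap_level_apply_of_ne]
      omega
    · intro h
      exact absurd (Finset.mem_range.2 (by omega)) h

end RelAlg

namespace RelAlg

variable {k : Type u} [Field k] {L : Type u} [Ring L] [Algebra k L] {m n : ℕ}
  (A : RelAlg k L (ChainRel m n))

/-! ### Endomorphisms of the sum of the modules of all chains -/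

/-- The basis vector at the top of the module of `u`. -/
noncomputable def topVec (u : Chain m (n + 1)) : A.Rep (totalShape m n) :=
  Rep.basisVec A (totalShape m n) u u.initChain

/-- The matrix entries of an endomorphism. -/
noncomputable def entry (f : A.Rep (totalShape m n) →ₗ[L] A.Rep (totalShape m n))
    (v u : Chain m (n + 1)) : k := f (A.topVec u) v u.initChain

theorem totalShape_mem {u : Chain m (n + 1)} {x : Chain m n} : (totalShape m n).mem u x ↔
    ∀ t, u.1 t.succ ≤ x.1 t ∧ x.1 t ≤ u.1 t.castSucc := syzShape_mem id u x

theorem totalShape_gen (u : Chain m (n + 1)) (x : Chain m n) (h : (totalShape m n).mem u x) :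
    ChainRel m n x u.initChain ∧ (totalShape m n).mem u u.initChain := by
  rw [totalShape_mem] at h ⊢
  exact ⟨⟨fun t => (h t).2, fun s t hst => (u.castSucc_le_succ hst).trans (h s).1⟩,
    fun t => ⟨u.castSucc_ge t, le_rfl⟩⟩

theorem totalShape_mem_initChain (u : Chain m (n + 1)) :
    (totalShape m n).mem u u.initChain :=
  totalShape_mem.2 fun t => ⟨u.castSucc_ge t, le_rfl⟩

theorem mem_initChain_of_rel {u v : Chain m (n + 1)} (h : ChainRel m (n + 1) u v) :
    (totalShape m n).mem v u.initChain :=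
  totalShape_mem.2 fun _ => ⟨h.2 _ _ Fin.castSucc_lt_succ, h.1 _⟩

/-- The module of `u` is generated by its top vector, and the coefficient producing x from it
involves only the column of `u.initChain`. So the same scalar `entry f v u` governs all points x. -/
theorem apply_eq_sum_entry (f : A.Rep (totalShape m n) →ₗ[L] A.Rep (totalShape m n))
    (g : A.Rep (totalShape m n)) {v : Chain m (n + 1)} {x : Chain m n}
    (hx : (totalShape m n).mem v x) : f g v x = ∑ u, A.entry f v u * g u x := by
  classical
  conv_lhs => rw [← Rep.sum_col_smul A (totalShape_gen (m := m) (n := n)) g, map_sum]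
  rw [Rep.sum_apply]
  refine Finset.sum_congr rfl fun u _ => ?_
  rw [map_smul, Rep.smul_apply A _ _ hx, Finset.sum_eq_single u.initChain]
  · rw [mul_comm]
    congr 1
    by_cases h : ChainRel m n x u.initChain
    · rw [col, A.coef_elt _ h, if_pos rfl]
    · rw [A.coef_eq_zero _ _ _ h, g.2 u x fun h' => h (totalShape_gen u x h').1]
  · intro y _ hy
    by_cases h : ChainRel m n x y
    · rw [col, A.coef_elt _ h, if_neg hy, zero_mul]
    · rw [A.coef_eq_zero _ _ _ h, zero_mul]
  · simp

/-- The top of u must lie in the box of v, which gives v_{t+1} ≤ u_t ≤ v_t. The bottom of v must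
also lie in the box of u: otherwise the basis element from the top of u to the bottom of v kills the
top vector of u but not its image. This gives u_{t+1} ≤ v_{t+1} ≤ u_t, and together these are the
interlacing inequalities. -/
theorem rel_of_entry_ne_zero (hn : 1 ≤ n) {f : A.Rep (totalShape m n) →ₗ[L] A.Rep (totalShape m n)}
    {v u : Chain m (n + 1)} (h : A.entry f v u ≠ 0) : ChainRel m (n + 1) u v := by
  classical
  have h1 := totalShape_mem.1 (Rep.mem_of_ne_zero A h)
  have h2 : ChainRel m n v.tailChain u.initChain :=
    ⟨fun t => (h1 t).1, fun s t hst => (h1 t).2.trans (v.castSucc_le_succ hst)⟩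
  have h3 : (totalShape m n).mem v v.tailChain :=
    totalShape_mem.2 fun t => ⟨le_rfl, v.castSucc_ge t⟩
  have h4 : (totalShape m n).mem u v.tailChain := by
    by_contra hu
    refine h ?_
    have h5 : A.single v.tailChain u.initChain • A.topVec u = 0 := Rep.ext A fun w x hx => by
      rcases eq_or_ne w u with rfl | hw
      · rw [topVec, Rep.smul_basisVec A _ (totalShape_mem_initChain w) hx rfl]
        by_cases hx' : ChainRel m n x w.initChain
        · rw [A.coef_single _ _ hx', if_neg]; · rfl
          rintro ⟨rfl, -⟩; exact hu hx
        · rw [A.coef_eq_zero _ _ _ hx']; rfl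
      · rw [topVec, Rep.smul_basisVec_of_ne A _ hw]; rfl
    have h6 := congrArg (fun g => f g v v.tailChain) h5
    simp only [map_smul, map_zero, Rep.zero_apply] at h6
    rw [Rep.smul_apply A _ _ h3, Finset.sum_eq_single u.initChain] at h6
    · rwa [A.coef_single _ _ h2, if_pos ⟨rfl, rfl⟩, one_mul] at h6
    · intro y _ hy
      by_cases hy' : ChainRel m n v.tailChain y
      · rw [A.coef_single _ _ hy', if_neg fun h => hy h.2, zero_mul]
      · rw [A.coef_eq_zero _ _ _ hy', zero_mul]
    · simp
  have h5 := totalShape_mem.1 h4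
  refine ⟨fun t => ?_, fun s t hst => ?_⟩
  · cases t using Fin.cases with
    | zero => exact (h1 ⟨0, hn⟩).2
    | succ t => exact (h5 t).1
  · obtain ⟨t, rfl⟩ := Fin.exists_succ_eq.2 (Fin.ne_zero_of_lt hst)
    obtain ⟨s, rfl⟩ := Fin.exists_castSucc_eq.2 (Fin.ne_last_of_lt hst)
    exact (v.succ_anti (Fin.castSucc_lt_succ_iff.1 hst)).trans (h1 s).1

theorem entry_comp (f g : A.Rep (totalShape m n) →ₗ[L] A.Rep (totalShape m n))
    {v u : Chain m (n + 1)} (h : ChainRel m (n + 1) u v) :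
    A.entry (f ∘ₗ g) v u = ∑ w, A.entry f v w * A.entry g w u :=
  A.apply_eq_sum_entry f (g (A.topVec u)) (mem_initChain_of_rel h)

open scoped Classical in
theorem entry_id (v u : Chain m (n + 1)) :
    A.entry (LinearMap.id : A.Rep (totalShape m n) →ₗ[L] _) v u = if v = u then 1 else 0 := by
  change Rep.basisVec A (totalShape m n) u u.initChain v u.initChain = _
  by_cases h : (totalShape m n).mem v u.initChain
  · rw [Rep.basisVec_apply A h]
    simp
  · rw [(Rep.basisVec A (totalShape m n) u u.initChain).2 _ _ h, if_neg]
    rintro rfl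
    exact h (totalShape_mem_initChain v)

theorem entry_injective {f g : A.Rep (totalShape m n) →ₗ[L] A.Rep (totalShape m n)}
    (h : A.entry f = A.entry g) : f = g :=
  LinearMap.ext fun z => Rep.ext A fun v x hx => by
    rw [A.apply_eq_sum_entry f z hx, A.apply_eq_sum_entry g z hx, h]

/-- For interlaced u, v and comparable points x of the box of v and y of the box of u, the bounds
still to be checked follow from x_t ≤ y_t and u_t ≤ v_t. -/
theorem compat_of_rel {C : Chain m (n + 1) → Chain m (n + 1) → k}
    (hC : ∀ v u, ¬ ChainRel m (n + 1) u v → C v u = 0) :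
    Compat (totalShape m n) (totalShape m n) C := by
  intro v u x y h hx hy hxy
  have hR : ChainRel m (n + 1) u v := not_not.1 fun h' => h (hC v u h')
  rw [totalShape_mem] at hx hy ⊢
  rw [totalShape_mem]
  exact ⟨fun _ t => ⟨(hx t).1.trans (hxy.1 t), (hy t).2.trans (hR.1 _)⟩,
    fun _ t => ⟨(hR.1 _).trans (hx t).1, (hxy.1 t).trans (hy t).2⟩⟩

theorem entry_matMap {C : Chain m (n + 1) → Chain m (n + 1) → k}
    (hC : ∀ v u, ¬ ChainRel m (n + 1) u v → C v u = 0) :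
    A.entry (A.matMap C (compat_of_rel hC)) = C := by
  classical
  funext v u
  by_cases h : (totalShape m n).mem v u.initChain
  · refine (A.matMap_apply C _ _ h).trans ?_
    rw [Finset.sum_eq_single u]
    · rw [topVec, Rep.basisVec_apply A (totalShape_mem_initChain u), if_pos ⟨rfl, rfl⟩, mul_one]
    · intro w _ hw
      by_cases h' : (totalShape m n).mem w u.initChain
      · rw [topVec, Rep.basisVec_apply A h', if_neg fun h => hw h.1, mul_zero]
      · rw [(A.topVec u).2 _ _ h', mul_zero]
    · simp
  · rw [hC v u fun h' => h (mem_initChain_of_rel h')]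
    exact Subtype.prop (A.matMap C (compat_of_rel hC) (A.topVec u)) v _ h

theorem algebraMap_smul_apply {I : Type} {S : Shape (ChainRel m n) I} (c : k) (g : A.Rep S) (a : I)
    (x : Chain m n) : (algebraMap k L c • g) a x = c * g a x := by
  by_cases h : S.mem a x
  · rw [Rep.smul_apply A _ _ h, Finset.sum_eq_single x]
    · rw [Algebra.algebraMap_eq_smul_one, map_smul, Pi.smul_apply, Pi.smul_apply, A.coef_one_self,
        smul_eq_mul, mul_one]
    · intro y _ hy
      rw [Algebra.algebraMap_eq_smul_one, map_smul, Pi.smul_apply, Pi.smul_apply,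
        A.coef_one_of_ne _ _ hy.symm, smul_zero, zero_mul]
    · simp
  · rw [(algebraMap k L c • g).2 a x h, g.2 a x h, mul_zero]

/-- The endomorphism algebra of the sum of the modules of all chains. -/
noncomputable def endRelAlg (hn : 1 ≤ n) {M : Type u} [AddCommGroup M] [Module L M] [Module k M]
    [IsScalarTower k L M] (E : M ≃ₗ[L] A.Rep (totalShape m n)) :
    RelAlg k (Module.End L M) (fun v u => ChainRel m (n + 1) u v) where
  coef :=
    { toFun := fun f => A.entry (E.conjRingEquiv f)
      map_add' := fun f g => by rw [map_add]; rfl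
      map_smul' := fun c f => by
        funext v u
        change (E (c • f (E.symm (A.topVec u)))) v u.initChain = _
        rw [← algebraMap_smul L c, map_smul, A.algebraMap_smul_apply]
        rfl }
  coef_injective f g h := E.conjRingEquiv.injective (A.entry_injective h)
  coef_eq_zero f v u h := not_not.1 fun h' => h (A.rel_of_entry_ne_zero hn h')
  exists_coef_eq C hC :=
    ⟨E.conjRingEquiv.symm (A.matMap C (compat_of_rel hC)), by
      refine Eq.trans ?_ (A.entry_matMap hC)
      exact congrArg A.entry (E.conjRingEquiv.apply_symm_apply _)⟩
  coef_one_self v := by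
    classical
    refine (congrArg (fun f => A.entry f v v) (map_one E.conjRingEquiv)).trans ?_
    exact (A.entry_id v v).trans (if_pos rfl)
  coef_one_of_ne v u h := by
    classical
    refine (congrArg (fun f => A.entry f v u) (map_one E.conjRingEquiv)).trans ?_
    exact (A.entry_id v u).trans (if_neg h)
  coef_mul f g v u h := by
    refine (congrArg (fun f => A.entry f v u) (map_mul E.conjRingEquiv f g)).trans ?_
    exact A.entry_comp _ _ h

-- Matrix entries are indexed by (target, source), so `endRelAlg` produces the opposite relation;
-- reversing and complementing the chains restores the original one.
open scoped ModuleCat in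
theorem nonempty_cone (A : RelAlg k L (ChainRel m n)) (hm : 1 ≤ m) (hn : 1 ≤ n) :
    Nonempty (RelAlg k (Cone k L n) (ChainRel m (n + 1))) := by
  obtain ⟨E⟩ := A.nonempty_coneModule_equiv hm hn
  exact ⟨(A.endRelAlg hn E).reindex (Chain.revEquiv m (n + 1)) Chain.rel_rev_iff⟩

end RelAlg

/-! ### The induction for Iyama's algebras, starting from triangular matrices -/

open scoped Classical in
/-- The one-term chain with entry `i`. -/
def Chain.single {m : ℕ} (i : Fin m) : Chain m 1 :=
  ⟨fun _ => i.val, ⟨fun _ => le_rfl, fun s t h => by omega⟩, fun _ => by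
    have := i.2
    dsimp only
    omega⟩

/-- One-term chains are elements of `Fin m`. -/
def Chain.oneEquiv (m : ℕ) : Chain m 1 ≃ Fin m where
  toFun w := ⟨(w.1 0).toNat, by have := w.2.2 0; omega⟩
  invFun := Chain.single
  left_inv w := Subtype.ext (funext fun t => by
    obtain rfl : t = 0 := Subsingleton.elim _ _
    have := w.2.2 0
    simp only [Chain.single]
    omega)
  right_inv i := Fin.ext (by simp [Chain.single])

theorem Chain.oneEquiv_le {m : ℕ} (x y : Chain m 1) :
    ChainRel m 1 x y ↔ oneEquiv m x ≤ oneEquiv m y := by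
  have hx := x.2.2 0
  have hy := y.2.2 0
  have h : oneEquiv m x ≤ oneEquiv m y ↔ (x.1 0).toNat ≤ (y.1 0).toNat := Iff.rfl
  rw [h]
  refine ⟨fun h => by have := h.1 0; omega, fun h => ⟨fun t => ?_, fun s t h => by omega⟩⟩
  obtain rfl : t = 0 := Subsingleton.elim _ _
  omega

/-- Upper triangular matrices have the basis of matrix units. -/
noncomputable def upperTriangularRelAlg (k : Type u) [Field k] (m : ℕ) :
    RelAlg k (upperTriangular k m) (fun i j : Fin m => i ≤ j) where
  coef := (upperTriangular k m).val.toLinearMap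
  coef_injective := Subtype.val_injective
  coef_eq_zero r _ _ h := r.2 (not_le.1 h)
  exists_coef_eq g hg := ⟨⟨g, fun i j h => hg i j (not_le.2 h)⟩, rfl⟩
  coef_one_self i := Matrix.one_apply_eq i
  coef_one_of_ne _ _ h := Matrix.one_apply_ne h
  coef_mul r s _ _ _ := Matrix.mul_apply (M := r.1) (N := s.1)

theorem nonempty_relAlg_iyamaT (k : Type u) [Field k] {m : ℕ} (hm : 1 ≤ m) {n : ℕ} (hn : 1 ≤ n) :
    Nonempty (RelAlg k (iyamaT k m n) (ChainRel m n)) := by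
  induction n, hn using Nat.le_induction with
  | base => exact ⟨(upperTriangularRelAlg k m).reindex (Chain.oneEquiv m) Chain.oneEquiv_le⟩
  | succ n hn ih =>
    obtain ⟨A⟩ := ih
    obtain ⟨n, rfl⟩ := Nat.exists_eq_add_of_le' hn
    exact A.nonempty_cone hm hn

/-! ## Presentation by the chain quiver -/

namespace Chain

variable {m n : ℕ}

/-- `y` is obtained from `x` by raising the entry at `t` by one. -/
def IsUp (t : Fin n) (x y : Chain m n) : Prop :=
  ∀ s, y.1 s = x.1 s + if s = t then 1 else 0

theorem IsUp.eq {t : Fin n} {x y z : Chain m n} (h : IsUp t x y) (h' : IsUp t x z) : y = z :=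
  Subtype.ext (funext fun s => by rw [h s, h' s])

theorem IsUp.dir_eq {t t' : Fin n} {x y : Chain m n} (h : IsUp t x y) (h' : IsUp t' x y) :
    t = t' := by
  by_contra hne
  have h1 := h t
  rw [h' t, if_pos rfl, if_neg hne] at h1
  omega

theorem IsUp.sum_eq {t : Fin n} {x y : Chain m n} (h : IsUp t x y) :
    ∑ s, y.1 s = ∑ s, x.1 s + 1 := by
  rw [Finset.sum_congr rfl fun s _ => h s, Finset.sum_add_distrib]
  simp

theorem rel_refl (x : Chain m n) : ChainRel m n x x := x.2.1

theorem IsUp.rel {t : Fin n} {x y : Chain m n} (h : IsUp t x y) : ChainRel m n x y := by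
  refine ⟨fun s => ?_, fun r s hrs => ?_⟩
  · rw [h s]; split_ifs <;> omega
  · have h1 := y.2.1.2 r s hrs
    have h2 := x.2.1.2 r s hrs
    have h3 := h r
    have h4 := h s
    split_ifs at h3 h4 <;> omega

/-- The points of the box between interlaced chains are chains. -/
def ofBox {x y : Chain m n} (h : ChainRel m n x y) (w : Fin n → ℤ)
    (hw : ∀ t, x.1 t ≤ w t ∧ w t ≤ y.1 t) : Chain m n :=
  ⟨w, ⟨fun _ => le_rfl, fun s t hst => (hw t).2.trans ((h.2 s t hst).trans (hw s).1)⟩,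
    fun t => ⟨(x.nonneg t).trans (hw t).1, (hw t).2.trans_lt (y.lt t)⟩⟩

theorem rel_of_box {x y : Chain m n} (h : ChainRel m n x y) (w : Chain m n)
    (hw : ∀ t, x.1 t ≤ w.1 t ∧ w.1 t ≤ y.1 t) : ChainRel m n x w ∧ ChainRel m n w y :=
  ⟨⟨fun t => (hw t).1, fun s t hst => (hw t).2.trans (h.2 s t hst)⟩,
    ⟨fun t => (hw t).2, fun s t hst => (h.2 s t hst).trans (hw s).1⟩⟩

theorem exists_isUp {x y : Chain m n} (h : ChainRel m n x y) {t : Fin n} (ht : x.1 t < y.1 t) :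
    ∃ w, IsUp t x w ∧ ChainRel m n w y := by
  have hw : ∀ s, x.1 s ≤ x.1 s + (if s = t then 1 else 0) ∧
      x.1 s + (if s = t then 1 else 0) ≤ y.1 s := by
    intro s
    have := h.1 s
    split_ifs with hs
    · subst hs; omega
    · omega
  exact ⟨ofBox h _ hw, fun s => rfl, (rel_of_box h (ofBox h _ hw) hw).2⟩

theorem IsUp.opposite {s t : Fin n} {x y z w : Chain m n} (hxy : IsUp s x y) (hxw : IsUp t x w)
    (hyz : IsUp t y z) : IsUp s w z := by
  intro r
  rw [hyz r, hxy r, hxw r]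
  ring

end Chain

/-- Elements of an algebra that satisfy the defining relations: `e x` are the trivial paths and
`α x y` the arrows. -/
structure ChainGenerators (k : Type u) [Field k] (m n : ℕ) (D : Type u) [Ring D] [Algebra k D] where
  e : Chain m n → D
  α : Chain m n → Chain m n → D
  idem : ∀ x, e x * e x = e x
  orth : ∀ x y, x ≠ y → e x * e y = 0
  complete : ∑ x, e x = 1
  left : ∀ t x y, Chain.IsUp t x y → e x * α x y = α x y
  right : ∀ t x y, Chain.IsUp t x y → α x y * e y = α x y
  comm : ∀ s t x y z w, s ≠ t → Chain.IsUp s x y → Chain.IsUp t y z → Chain.IsUp t x w →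
    Chain.IsUp s w z → α x y * α y z = α x w * α w z
  zero : ∀ s t x y z, s ≠ t → Chain.IsUp s x y → Chain.IsUp t y z →
    (∀ w, ¬ Chain.IsUp t x w) → α x y * α y z = 0
  adjoin : Algebra.adjoin k (Set.range e ∪ {d | ∃ t x y, Chain.IsUp t x y ∧ d = α x y}) = ⊤

namespace ChainGenerators

open Chain

variable {k : Type u} [Field k] {m n : ℕ} {D : Type u} [Ring D] [Algebra k D]
  (G : ChainGenerators k m n D)

/-- `d` is the product along a path of length `l` from `x` to `y`. -/
inductive IsPath : ℕ → Chain m n → Chain m n → D → Prop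
  | nil (x) : IsPath 0 x x (G.e x)
  | cons (l t x w y d) : IsUp t x w → IsPath l w y d → IsPath (l + 1) x y (G.α x w * d)

variable {G}

theorem IsPath.sum_eq {l : ℕ} {x y : Chain m n} {d : D} (h : G.IsPath l x y d) :
    ∑ s, y.1 s = ∑ s, x.1 s + l := by
  induction h with
  | nil x => simp
  | cons l t x w y d hx _ ih => rw [ih, hx.sum_eq]; push_cast; ring

theorem IsPath.le {l : ℕ} {x y : Chain m n} {d : D} (h : G.IsPath l x y d) (t : Fin n) :
    x.1 t ≤ y.1 t := by
  induction h with
  | nil x => exact le_rfl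
  | cons l t x w y d hx _ ih => exact (hx.rel.1 _).trans ih

theorem IsPath.left {l : ℕ} {x y : Chain m n} {d : D} (h : G.IsPath l x y d) :
    G.e x * d = d := by
  induction h with
  | nil x => exact G.idem x
  | cons l t x w y d hx _ ih => rw [← mul_assoc, G.left t x w hx]

variable (G) in
theorem exists_isPath {x y : Chain m n} (h : ChainRel m n x y) : ∃ l d, G.IsPath l x y d := by
  obtain ⟨N, hN⟩ : ∃ N : ℕ, ∑ s, y.1 s = ∑ s, x.1 s + N :=
    ⟨(∑ s, y.1 s - ∑ s, x.1 s).toNat, by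
      have := Finset.sum_le_sum fun s (_ : s ∈ Finset.univ) => h.1 s
      omega⟩
  induction N generalizing x with
  | zero =>
    obtain rfl : x = y := by
      refine Subtype.ext (funext fun s => ?_)
      exact (Finset.sum_eq_sum_iff_of_le fun s _ => h.1 s).1 (by simpa using hN.symm) s
        (Finset.mem_univ s)
    exact ⟨0, _, .nil x⟩
  | succ N ih =>
    obtain ⟨t, ht⟩ : ∃ t, x.1 t < y.1 t := by
      by_contra! hle
      have := Finset.sum_le_sum fun s (_ : s ∈ Finset.univ) => hle s
      push_cast at hN
      omega
    obtain ⟨w, hw, hR⟩ := exists_isUp h ht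
    obtain ⟨l, d, hd⟩ := ih hR (by rw [hN, hw.sum_eq]; push_cast; ring)
    exact ⟨l + 1, _, .cons l t x w y d hw hd⟩

/-- Interlacing of the ends allows any direction that still has to be raised to come first; entry
sums fix the length. Uniqueness is a hypothesis because the lemma serves inside the induction that
proves uniqueness. -/
theorem IsPath.exists_cons {l : ℕ} {x y : Chain m n} {d : D} (h : G.IsPath l x y d)
    (huniq : ∀ d', G.IsPath l x y d' → d = d') (hR : ChainRel m n x y) {t : Fin n}
    (ht : x.1 t < y.1 t) : ∃ w l' d', IsUp t x w ∧ G.IsPath l' w y d' ∧ l = l' + 1 ∧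
      d = G.α x w * d' := by
  obtain ⟨w, hw, hR'⟩ := exists_isUp hR ht
  obtain ⟨l', d', hd'⟩ := G.exists_isPath hR'
  have h1 := h.sum_eq
  have h2 := hd'.sum_eq
  have h3 := hw.sum_eq
  obtain rfl : l = l' + 1 := by omega
  exact ⟨w, l', d', hw, hd', rfl, huniq _ (.cons _ _ _ _ _ _ hw hd')⟩

/-- Vanishing and uniqueness are proved by one induction on the length, since each is needed to
rearrange the shorter paths of the other. -/
theorem isPath_unique (l : ℕ) : ∀ x y : Chain m n,
    (¬ ChainRel m n x y → ∀ d, G.IsPath l x y d → d = 0) ∧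
      ∀ d d', G.IsPath l x y d → G.IsPath l x y d' → d = d' := by
  induction l with
  | zero =>
    refine fun x y => ⟨fun hR d h => ?_, fun d d' h h' => ?_⟩
    · cases h; exact absurd (rel_refl x) hR
    · cases h; cases h'; rfl
  | succ l ih =>
    intro x y
    have key : ¬ ChainRel m n x y → ∀ d, G.IsPath (l + 1) x y d → d = 0 := by
      intro hR d h
      have hle := h.le
      cases h with
      | cons _ s _ x₁ _ d₁ hs h₁ =>
      by_cases hR₁ : ChainRel m n x₁ y
      -- Raising the entry at `s` repairs interlacing, so the failure is at a pair (s, b) with x_s <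
      -- y_b. As x_b ≤ x_s, the path still has to raise the entry at `b`, and it may do so right
      -- after its first step.
      · obtain ⟨b, hsb, hb⟩ : ∃ b, s < b ∧ x.1 s < y.1 b := by
          by_contra! hcon
          refine hR ⟨hle, fun c b hcb => ?_⟩
          rcases eq_or_ne c s with rfl | hc
          · exact hcon b hcb
          · have h1 := hR₁.2 c b hcb
            rwa [hs c, if_neg hc, add_zero] at h1
        have hx₁b : x₁.1 b < y.1 b := by
          rw [hs b, if_neg hsb.ne', add_zero]
          exact (x.anti hsb.le).trans_lt hb
        obtain ⟨x₂, l', d₂, hx₂, h₂, rfl, rfl⟩ :=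
          h₁.exists_cons (fun d' => (ih x₁ y).2 _ d' h₁) hR₁ hx₁b
        rw [← mul_assoc]
        -- If the two steps can be exchanged, the remaining path starts at w with w_s = x_s < y_b
        -- and vanishes by induction. If not, the product of the two steps is zero by the zero
        -- relation.
        by_cases hw : ∃ w, IsUp b x w
        · obtain ⟨w, hw⟩ := hw
          have hwx₂ : IsUp s w x₂ := IsUp.opposite hs hw hx₂
          rw [G.comm s b x x₁ x₂ w hsb.ne hs hx₂ hw hwx₂, mul_assoc,
            (ih w y).1 (fun h' => ?_) _ (.cons _ _ _ _ _ _ hwx₂ h₂), mul_zero]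
          have h1 := h'.2 s b hsb
          rw [hw s, if_neg hsb.ne] at h1
          omega
        · rw [G.zero s b x x₁ x₂ hsb.ne hs hx₂ (fun w hw' => hw ⟨w, hw'⟩), zero_mul]
      · rw [(ih x₁ y).1 hR₁ d₁ h₁, mul_zero]
    refine ⟨key, fun d d' h h' => ?_⟩
    by_cases hR : ChainRel m n x y
    · cases h with
      | cons _ s _ x₁ _ d₁ hs h₁ =>
      cases h' with
      | cons _ t _ x₁' _ d₁' ht h₁' =>
      rcases eq_or_ne s t with rfl | hst
      · obtain rfl := hs.eq ht
        rw [(ih x₁ y).2 _ _ h₁ h₁']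
      -- Both paths are rerouted through the corner obtained from x by raising the entries at `s`
      -- and `t`; after that they differ only by the commuting square.
      · have hbox : ∀ {r : Fin n} {w : Chain m n} {d : D}, IsUp r x w → G.IsPath l w y d →
            ChainRel m n w y := fun hw hd => (rel_of_box hR _ fun a => ⟨hw.rel.1 a, hd.le a⟩).2
        have h1 : x₁.1 t < y.1 t := by
          have h1 := h₁'.le t
          have h2 := ht t
          rw [if_pos rfl] at h2
          rw [hs t, if_neg hst.symm]
          omega
        obtain ⟨x₂, l', d₂, hx₂, h₂, rfl, rfl⟩ :=
          h₁.exists_cons (fun d' => (ih x₁ y).2 _ d' h₁) (hbox hs h₁) h1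
        have hwx₂ : IsUp s x₁' x₂ := IsUp.opposite hs ht hx₂
        rw [(ih x₁' y).2 _ _ h₁' (.cons _ _ _ _ _ _ hwx₂ h₂), ← mul_assoc, ← mul_assoc,
          G.comm s t x x₁ x₂ x₁' hst hs hx₂ ht hwx₂]
    · rw [key hR d h, key hR d' h']

variable (G) in
-- The span is stable under left multiplication by the generators, and it contains 1 as the sum of
-- the trivial paths.
theorem span_isPath : Submodule.span k {d | ∃ l x y, G.IsPath l x y d} = ⊤ := by
  set N := Submodule.span k {d | ∃ l x y, G.IsPath l x y d} with hN
  have hmul : ∀ a : D, ∀ d ∈ N, a * d ∈ N := by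
    intro a
    have ha : a ∈ Algebra.adjoin k
        (Set.range G.e ∪ {d | ∃ t x y, Chain.IsUp t x y ∧ d = G.α x y}) := by
      rw [G.adjoin]; trivial
    induction ha using Algebra.adjoin_induction with
    | mem a ha =>
      intro d hd
      induction hd using Submodule.span_induction with
      | mem d hd =>
        obtain ⟨l, x, y, hd⟩ := hd
        rcases ha with ⟨w, rfl⟩ | ⟨t, w, x', hw, rfl⟩
        · rcases eq_or_ne w x with rfl | hne
          · rw [hd.left]; exact Submodule.subset_span ⟨l, w, y, hd⟩
          · rw [← hd.left, ← mul_assoc, G.orth w x hne, zero_mul]; exact N.zero_mem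
        · rcases eq_or_ne x' x with rfl | hne
          · exact Submodule.subset_span ⟨l + 1, w, y, .cons l t w x' y d hw hd⟩
          · rw [← hd.left, ← G.right t w x' hw, mul_assoc, ← mul_assoc (G.e x'), G.orth x' x hne,
              zero_mul, mul_zero]
            exact N.zero_mem
      | zero => rw [mul_zero]; exact N.zero_mem
      | add d d' _ _ h h' => rw [mul_add]; exact N.add_mem h h'
      | smul c d _ h => rw [mul_smul_comm]; exact N.smul_mem c h
    | algebraMap c =>
      intro d hd
      rw [← Algebra.smul_def]; exact N.smul_mem c hd
    | add a b _ _ ha hb => intro d hd; rw [add_mul]; exact N.add_mem (ha d hd) (hb d hd)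
    | mul a b _ _ ha hb => intro d hd; rw [mul_assoc]; exact ha _ (hb d hd)
  refine eq_top_iff.2 fun d _ => ?_
  rw [← mul_one d, ← G.complete]
  exact hmul d _ (N.sum_mem fun x _ => Submodule.subset_span ⟨0, x, x, .nil x⟩)

variable {L : Type u} [Ring L] [Algebra k L] (A : RelAlg k L (ChainRel m n))

theorem IsPath.map_eq (φ : D →ₐ[k] L) (he : ∀ x, φ (G.e x) = A.single x x)
    (hα : ∀ t x y, IsUp t x y → φ (G.α x y) = A.single x y) {l : ℕ} {x y : Chain m n} {d : D}
    (h : G.IsPath l x y d) : φ d = A.single x y := by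
  induction h with
  | nil x => exact he x
  | cons l t x w y d hx hd ih =>
    rw [map_mul, hα t x w hx, ih]
    by_cases hR : ChainRel m n w y
    · exact A.single_mul_single hx.rel hR
    -- All points of the path lie in the box from x to y. If x, y were interlaced, so would be w, y.
    · rw [A.single_eq_zero hR, mul_zero, A.single_eq_zero fun h =>
        hR (rel_of_box h w fun a => ⟨hx.rel.1 a, hd.le a⟩).2]

-- Choosing one path for each interlaced pair defines a linear map back. It is a left inverse
-- because paths span and are unique, and surjectivity holds because the basis elements are images
-- of paths.
variable (G) in
theorem bijective (φ : D →ₐ[k] L) (he : ∀ x, φ (G.e x) = A.single x x)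
    (hα : ∀ t x y, IsUp t x y → φ (G.α x y) = A.single x y) : Function.Bijective φ := by
  classical
  have hE : ∀ x y, ∃ d : D, ChainRel m n x y → ∃ l, G.IsPath l x y d := fun x y => by
    by_cases h : ChainRel m n x y
    · obtain ⟨l, d, hd⟩ := G.exists_isPath h
      exact ⟨d, fun _ => ⟨l, hd⟩⟩
    · exact ⟨0, fun h' => absurd h' h⟩
  choose E hE using hE
  let ψ : L →ₗ[k] D := ∑ x, ∑ y,
    (LinearMap.toSpanSingleton k D (E x y)) ∘ₗ (LinearMap.proj y) ∘ₗ (LinearMap.proj x) ∘ₗ A.coef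
  have hψ : ∀ x y, ChainRel m n x y → ψ (A.single x y) = E x y := by
    intro x y hxy
    simp only [ψ, LinearMap.sum_apply, LinearMap.comp_apply, LinearMap.proj_apply,
      LinearMap.toSpanSingleton_apply]
    rw [Finset.sum_eq_single x, Finset.sum_eq_single y]
    · rw [A.coef_single _ _ hxy, if_pos ⟨rfl, rfl⟩, one_smul]
    · intro b _ hb
      by_cases h : ChainRel m n x b
      · rw [A.coef_single _ _ h, if_neg fun h => hb h.2, zero_smul]
      · rw [A.coef_eq_zero _ _ _ h, zero_smul]
    · simp
    · intro a _ ha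
      refine Finset.sum_eq_zero fun b _ => ?_
      by_cases h : ChainRel m n a b
      · rw [A.coef_single _ _ h, if_neg fun h => ha h.1, zero_smul]
      · rw [A.coef_eq_zero _ _ _ h, zero_smul]
    · simp
  have hinv : ψ ∘ₗ φ.toLinearMap = LinearMap.id := by
    refine LinearMap.ext_on (G.span_isPath) ?_
    rintro d ⟨l, x, y, hd⟩
    change ψ (φ d) = d
    rw [hd.map_eq A φ he hα]
    by_cases hR : ChainRel m n x y
    · rw [hψ x y hR]
      obtain ⟨l', hl'⟩ := hE x y hR
      obtain rfl : l = l' := by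
        have h1 := hd.sum_eq
        have h2 := hl'.sum_eq
        omega
      exact (isPath_unique l x y).2 _ _ hl' hd
    · rw [A.single_eq_zero hR, map_zero, (isPath_unique l x y).1 hR d hd]
  refine ⟨Function.LeftInverse.injective (g := ψ) (LinearMap.congr_fun hinv), fun r => ?_⟩
  refine ⟨∑ x, ∑ y, A.coef r x y • E x y, ?_⟩
  conv_rhs => rw [A.sum_smul_single r]
  simp only [map_sum, map_smul]
  refine Finset.sum_congr rfl fun x _ => Finset.sum_congr rfl fun y _ => ?_
  by_cases hR : ChainRel m n x y
  · obtain ⟨l, hl⟩ := hE x y hR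
    rw [hl.map_eq A φ he hα]
  · rw [A.coef_eq_zero _ _ _ hR, zero_smul, zero_smul]

end ChainGenerators

/-! ## The quadratic dual of a chain quiver -/

/-- `B` is the quiver of the chains with the arrows raising one entry, bound by zero relations in
each direction and by anticommutativity of the squares. -/
structure ChainQuiver {k : Type u} [Field k] (B : QuadraticQuiver k) (m n : ℕ) where
  pos : B.V ≃ Chain m n
  dir : B.A → Fin n
  isUp : ∀ a, Chain.IsUp (dir a) (pos (B.src a)) (pos (B.tgt a))
  arrow_ext : ∀ a b, B.src a = B.src b → dir a = dir b → a = b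
  exists_arrow : ∀ t x y, Chain.IsUp t x y → ∃ a, pos (B.src a) = x ∧ dir a = t
  single_mem : ∀ a b, dir a = dir b → B.tgt a = B.src b → Finsupp.single (a, b) 1 ∈ B.rel
  square_mem : ∀ a b a' b', B.src a = B.src a' → B.tgt a = B.src b → B.tgt a' = B.src b' →
    dir a = dir b' → dir b = dir a' → dir b < dir a →
    Finsupp.single (a, b) (-1) - Finsupp.single (a', b') 1 ∈ B.rel
  rel_cases : ∀ r ∈ B.rel, (∃ a b, dir a = dir b ∧ r = Finsupp.single (a, b) 1) ∨
    ∃ a b a' b', B.src a = B.src a' ∧ B.tgt a = B.src b ∧ B.tgt a' = B.src b' ∧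
      dir a = dir b' ∧ dir b = dir a' ∧ dir b < dir a ∧
      r = Finsupp.single (a, b) (-1) - Finsupp.single (a', b') 1

namespace ChainQuiver

open Chain

variable {k : Type u} [Field k] {B : QuadraticQuiver k} {m n : ℕ} (Q : ChainQuiver B m n)

/-- `(a, b)` and `(a', b')` are the two paths around a square. -/
structure Square (a b a' b' : B.A) : Prop where
  src : B.src a = B.src a'
  tgt : B.tgt a = B.src b
  tgt' : B.tgt a' = B.src b'
  dir : Q.dir a = Q.dir b'
  dir' : Q.dir b = Q.dir a'
  ne : Q.dir a ≠ Q.dir b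

variable {Q}

theorem Square.symm {a b a' b' : B.A} (h : Q.Square a b a' b') : Q.Square a' b' a b :=
  ⟨h.src.symm, h.tgt', h.tgt, h.dir'.symm, h.dir.symm, by rw [← h.dir', ← h.dir]; exact h.ne.symm⟩

theorem Square.unique {a b a' b' a'' b'' : B.A} (h : Q.Square a b a' b')
    (h' : Q.Square a b a'' b'') : a' = a'' ∧ b' = b'' := by
  have h1 := Q.arrow_ext a' a'' (h.src.symm.trans h'.src) (h.dir'.symm.trans h'.dir')
  subst h1
  exact ⟨rfl, Q.arrow_ext b' b'' (h.tgt'.symm.trans h'.tgt') (h.dir.symm.trans h'.dir)⟩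

theorem Square.tgt_eq {a b a' b' : B.A} (h : Q.Square a b a' b') : B.tgt b = B.tgt b' := by
  refine Q.pos.injective (Subtype.ext (funext fun s => ?_))
  rw [Q.isUp b s, Q.isUp b' s, ← h.tgt, ← h.tgt', Q.isUp a s, Q.isUp a' s, h.src, h.dir, h.dir']
  ring

variable (Q)

theorem exists_arrow' {t : Fin n} {x y : Chain m n} (h : IsUp t x y) :
    ∃ a, Q.pos (B.src a) = x ∧ Q.pos (B.tgt a) = y ∧ Q.dir a = t := by
  obtain ⟨a, ha, rfl⟩ := Q.exists_arrow t x y h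
  have h1 := Q.isUp a
  rw [ha] at h1
  exact ⟨a, ha, h1.eq h, rfl⟩

theorem arrow_ext' (Q : ChainQuiver B m n) {a b : B.A} (h : B.src a = B.src b)
    (h' : B.tgt a = B.tgt b) : a = b := by
  refine Q.arrow_ext a b h ?_
  have h1 := Q.isUp a
  rw [h, h'] at h1
  exact h1.dir_eq (Q.isUp b)

/-- The two paths of a square coincide in the quadratic dual. -/
theorem square_mem_dual {a b a' b' : B.A} (h : Q.Square a b a' b') :
    (Finsupp.single (b, a) 1 - Finsupp.single (b', a') 1 : (B.A × B.A) →₀ k) ∈ B.dual.rel := by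
  classical
  refine ⟨?_, fun r hr => ?_⟩
  · have key : ∀ p ∈ (Finsupp.single (b, a) 1 - Finsupp.single (b', a') 1 :
        (B.A × B.A) →₀ k).support, B.src p.1 = B.tgt p.2 ∧ B.tgt p.1 = B.tgt b ∧
          B.src p.2 = B.src a := by
      intro p hp
      rcases Finset.mem_union.1 (Finsupp.support_sub hp) with hp | hp
      · rw [Finset.mem_singleton.1 (Finsupp.support_single_subset hp)]
        exact ⟨h.tgt.symm, rfl, rfl⟩
      · rw [Finset.mem_singleton.1 (Finsupp.support_single_subset hp)]
        exact ⟨h.tgt'.symm, h.tgt_eq.symm, h.src.symm⟩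
    intro p hp
    obtain ⟨h1, h2, h3⟩ := key p hp
    refine ⟨h1, fun q hq => ?_⟩
    obtain ⟨-, h4, h5⟩ := key q hq
    exact ⟨h2.trans h4.symm, h3.trans h5.symm⟩
  · rcases Q.rel_cases r hr with ⟨c, d, hcd, rfl⟩ | ⟨c, d, c', d', h1, h2, h3, h4, h5, h6, rfl⟩
    · rw [Finsupp.sum_single_index (by simp), Finsupp.sub_apply, Finsupp.single_apply,
        Finsupp.single_apply, if_neg, if_neg]
      · simp
      · intro e
        simp only [Prod.swap_prod_mk, Prod.mk.injEq] at e
        exact h.symm.ne (by rw [e.1, e.2, hcd])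
      · intro e
        simp only [Prod.swap_prod_mk, Prod.mk.injEq] at e
        exact h.ne (by rw [e.1, e.2, hcd])
    -- A square is determined by either of its paths, so the two squares share both paths or none.
    -- The pairing with the anticommutativity relation is then 0, or two terms of opposite sign that
    -- cancel.
    · have hsq : Q.Square c d c' d' := ⟨h1, h2, h3, h4, h5, h6.ne'⟩
      rw [Finsupp.sum_sub_index (fun _ _ _ => by ring), Finsupp.sum_single_index (by simp),
        Finsupp.sum_single_index (by simp)]
      simp only [Finsupp.sub_apply, Finsupp.single_apply, Prod.swap_prod_mk, Prod.mk.injEq]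
      have e1 : (b = d ∧ a = c) ↔ (b' = d' ∧ a' = c') := by
        constructor
        · rintro ⟨rfl, rfl⟩; exact (h.unique hsq).symm
        · rintro ⟨rfl, rfl⟩; exact (h.symm.unique hsq.symm).symm
      have e2 : (b' = d ∧ a' = c) ↔ (b = d' ∧ a = c') := by
        constructor
        · rintro ⟨rfl, rfl⟩; exact (h.symm.unique hsq).symm
        · rintro ⟨rfl, rfl⟩; exact (h.unique hsq.symm).symm
      simp only [e1, e2]
      ring

/-- A path that is not part of a square vanishes in the quadratic dual. -/
theorem single_mem_dual {a b : B.A} (h : B.tgt a = B.src b) (hne : Q.dir a ≠ Q.dir b)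
    (hsq : ∀ a' b', ¬ Q.Square a b a' b') :
    (Finsupp.single (b, a) 1 : (B.A × B.A) →₀ k) ∈ B.dual.rel := by
  classical
  refine ⟨fun p hp => ?_, fun r hr => ?_⟩
  · rw [Finset.mem_singleton.1 (Finsupp.support_single_subset hp)]
    refine ⟨h.symm, fun q hq => ?_⟩
    rw [Finset.mem_singleton.1 (Finsupp.support_single_subset hq)]
    exact ⟨rfl, rfl⟩
  · rcases Q.rel_cases r hr with ⟨c, d, hcd, rfl⟩ | ⟨c, d, c', d', h1, h2, h3, h4, h5, h6, rfl⟩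
    · rw [Finsupp.sum_single_index (by simp), Finsupp.single_apply, if_neg]
      · simp
      · intro e
        simp only [Prod.swap_prod_mk, Prod.mk.injEq] at e
        exact hne (by rw [e.1, e.2, hcd])
    · have hs : Q.Square c d c' d' := ⟨h1, h2, h3, h4, h5, h6.ne'⟩
      rw [Finsupp.sum_sub_index (fun _ _ _ => by ring), Finsupp.sum_single_index (by simp),
        Finsupp.sum_single_index (by simp), Finsupp.single_apply, Finsupp.single_apply, if_neg,
        if_neg]
      · simp
      · intro e
        simp only [Prod.swap_prod_mk, Prod.mk.injEq] at e
        exact hsq c d (by rw [e.1, e.2]; exact hs.symm)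
      · intro e
        simp only [Prod.swap_prod_mk, Prod.mk.injEq] at e
        exact hsq c' d' (by rw [e.1, e.2]; exact hs)

/-- The relations of the quadratic dual hold in an algebra with the basis of interlaced pairs. -/
theorem dual_rel_sum_eq_zero {L : Type u} [Ring L] [Algebra k L]
    (A : RelAlg k L (ChainRel m n)) {f : (B.A × B.A) →₀ k} (hf : f ∈ B.dual.rel) :
    (f.sum fun p c => c • (A.single (Q.pos (B.src p.2)) (Q.pos (B.tgt p.2)) *
      A.single (Q.pos (B.src p.1)) (Q.pos (B.tgt p.1)))) = 0 := by
  classical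
  obtain ⟨hpar, horth⟩ := hf
  by_cases h0 : f = 0
  · rw [h0, Finsupp.sum_zero_index]
  obtain ⟨⟨b, a⟩, hp⟩ := Finsupp.support_nonempty_iff.2 h0
  have htgt : B.tgt a = B.src b := (hpar _ hp).1.symm
  have hall : ∀ q ∈ f.support, B.tgt q.2 = B.src q.1 ∧ B.src q.2 = B.src a ∧
      B.tgt q.1 = B.tgt b := fun q hq =>
    ⟨(hpar q hq).1.symm, ((hpar _ hp).2 q hq).2.symm, ((hpar _ hp).2 q hq).1.symm⟩
  -- All paths in f have the same ends, hence the same image, and only the sum of the coefficients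
  -- matters.
  have hsum : (f.sum fun p c => c • (A.single (Q.pos (B.src p.2)) (Q.pos (B.tgt p.2)) *
      A.single (Q.pos (B.src p.1)) (Q.pos (B.tgt p.1)))) =
      (f.sum fun _ c => c) • A.single (Q.pos (B.src a)) (Q.pos (B.tgt b)) := by
    rw [Finsupp.sum, Finsupp.sum, Finset.sum_smul]
    refine Finset.sum_congr rfl fun q hq => ?_
    obtain ⟨h1, h2, h3⟩ := hall q hq
    have hR : ChainRel m n (Q.pos (B.src q.1)) (Q.pos (B.tgt q.1)) := (Q.isUp q.1).rel
    have hR' : ChainRel m n (Q.pos (B.src q.2)) (Q.pos (B.tgt q.2)) := (Q.isUp q.2).rel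
    rw [h1] at hR' ⊢
    rw [A.single_mul_single hR' hR, h2, h3]
  rw [hsum]
  by_cases hR : ChainRel m n (Q.pos (B.src a)) (Q.pos (B.tgt b))
  swap
  · rw [A.single_eq_zero hR, smul_zero]
  have hfab : f (b, a) ≠ 0 := Finsupp.mem_support_iff.1 hp
  have hne : Q.dir a ≠ Q.dir b := fun hab => by
    have h1 := horth _ (Q.single_mem a b hab htgt)
    rw [Finsupp.sum_single_index (by simp), one_mul] at h1
    exact hfab h1
  have hup := Q.isUp a
  have hup' := Q.isUp b
  rw [htgt] at hup
  -- Since the ends are interlaced, the box between them consists of chains and contains the fourth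
  -- corner of the square.
  obtain ⟨w, hw, -⟩ := exists_isUp hR (t := Q.dir b) (by
    rw [hup' (Q.dir b), hup (Q.dir b), if_pos rfl, if_neg hne.symm]
    omega)
  obtain ⟨a', ha1, ha2, ha3⟩ := Q.exists_arrow' hw
  obtain ⟨b', hb1, hb2, hb3⟩ := Q.exists_arrow' (hup.opposite hw hup')
  have hsq : Q.Square a b a' b' := ⟨Q.pos.injective ha1.symm, htgt,
    Q.pos.injective (ha2.trans hb1.symm), hb3.symm, ha3.symm, hne⟩
  have hzero : f (b, a) + f (b', a') = 0 := by
    rcases lt_or_gt_of_ne hne with hlt | hlt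
    · have h1 := horth _ (Q.square_mem a' b' a b hsq.symm.src hsq.tgt' hsq.tgt hsq.symm.dir
        hsq.symm.dir' (by rw [← hsq.dir', ← hsq.dir]; exact hlt))
      rw [Finsupp.sum_sub_index (fun _ _ _ => by ring), Finsupp.sum_single_index (by simp),
        Finsupp.sum_single_index (by simp)] at h1
      simp only [Prod.swap_prod_mk] at h1
      linear_combination -h1
    · have h1 := horth _ (Q.square_mem a b a' b' hsq.src hsq.tgt hsq.tgt' hsq.dir hsq.dir' hlt)
      rw [Finsupp.sum_sub_index (fun _ _ _ => by ring), Finsupp.sum_single_index (by simp),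
        Finsupp.sum_single_index (by simp)] at h1
      simp only [Prod.swap_prod_mk] at h1
      linear_combination -h1
  -- A parallel path of length two raises the same two entries, so it is one of the two paths around
  -- the square.
  have hsub : f.support ⊆ {(b, a), (b', a')} := by
    rintro ⟨d, c⟩ hq
    obtain ⟨h1, h2, h3⟩ := hall _ hq
    simp only at h1 h2 h3
    have hc := Q.isUp c
    have hd := Q.isUp d
    rw [h1, h2] at hc
    rw [h3] at hd
    have hcount : ∀ s, (if s = Q.dir a then (1 : ℤ) else 0) + (if s = Q.dir b then 1 else 0) =
        (if s = Q.dir c then 1 else 0) + if s = Q.dir d then 1 else 0 := fun s => by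
      have e1 := hc s
      have e2 := hd s
      have e3 := hup s
      have e4 := hup' s
      omega
    rw [Finset.mem_insert, Finset.mem_singleton]
    by_cases hca : Q.dir c = Q.dir a
    · left
      have h4 : c = a := Q.arrow_ext c a h2 hca
      subst h4
      have h5 : d = b := Q.arrow_ext' (h1.symm.trans htgt) h3
      rw [h5]
    · right
      have hcb : Q.dir c = Q.dir b := by
        by_contra hcb
        have := hcount (Q.dir c)
        rw [if_neg hca, if_neg hcb, if_pos rfl] at this
        split_ifs at this <;> omega
      have h4 : c = a' := Q.arrow_ext c a' (h2.trans hsq.src) (hcb.trans hsq.dir')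
      subst h4
      have h5 : d = b' := Q.arrow_ext' (h1.symm.trans hsq.tgt') (h3.trans hsq.tgt_eq)
      rw [h5]
  have hneq : (b, a) ≠ (b', a') := fun e => by
    rw [Prod.mk.injEq] at e
    exact hne (by rw [hsq.dir', e.2])
  rw [Finsupp.sum_of_support_subset f hsub _ (fun _ _ => rfl), Finset.sum_pair hneq, hzero,
    zero_smul]

end ChainQuiver

/-! ### Generators and universal property of the algebra of a bound quiver -/

namespace QuadraticQuiver

variable {k : Type u} [Field k] (B : QuadraticQuiver k) [Finite B.V]

/-- The class of a trivial path. -/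
noncomputable def vtxClass (v : B.V) : B.Alg := RingQuot.mkAlgHom k B.AlgRel (B.vtx v)

/-- The class of an arrow. -/
noncomputable def arrClass (a : B.A) : B.Alg := RingQuot.mkAlgHom k B.AlgRel (B.arr a)

theorem vtxClass_mul_self (v : B.V) : B.vtxClass v * B.vtxClass v = B.vtxClass v := by
  rw [vtxClass, ← map_mul]
  exact RingQuot.mkAlgHom_rel k (AlgRel.idem v)

theorem vtxClass_mul_of_ne {v w : B.V} (h : v ≠ w) : B.vtxClass v * B.vtxClass w = 0 := by
  rw [vtxClass, vtxClass, ← map_mul, RingQuot.mkAlgHom_rel k (AlgRel.orth v w h), map_zero]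

theorem sum_vtxClass [Fintype B.V] : ∑ v : B.V, B.vtxClass v = 1 := by
  have h := RingQuot.mkAlgHom_rel k (AlgRel.complete (B := B))
  rw [map_one, finsum_eq_sum_of_fintype, map_sum] at h
  exact h

theorem vtxClass_mul_arrClass (a : B.A) :
    B.vtxClass (B.tgt a) * B.arrClass a = B.arrClass a := by
  rw [vtxClass, arrClass, ← map_mul]
  exact RingQuot.mkAlgHom_rel k (AlgRel.left a)

theorem arrClass_mul_vtxClass (a : B.A) :
    B.arrClass a * B.vtxClass (B.src a) = B.arrClass a := by
  rw [vtxClass, arrClass, ← map_mul]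
  exact RingQuot.mkAlgHom_rel k (AlgRel.right a)

theorem arrClass_mul_eq {a b a' b' : B.A}
    (h : Finsupp.single (a, b) 1 - Finsupp.single (a', b') 1 ∈ B.rel) :
    B.arrClass b * B.arrClass a = B.arrClass b' * B.arrClass a' := by
  have h1 := RingQuot.mkAlgHom_rel k (AlgRel.rel _ h)
  rw [map_zero, Finsupp.sum_sub_index (fun _ _ _ => sub_smul _ _ _),
    Finsupp.sum_single_index (by simp), Finsupp.sum_single_index (by simp), one_smul,
    one_smul, map_sub, map_mul, map_mul, sub_eq_zero] at h1
  exact h1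

theorem arrClass_mul_eq_zero {a b : B.A} (h : Finsupp.single (a, b) 1 ∈ B.rel) :
    B.arrClass b * B.arrClass a = 0 := by
  have h1 := RingQuot.mkAlgHom_rel k (AlgRel.rel _ h)
  rw [map_zero, Finsupp.sum_single_index (by simp), one_smul, map_mul] at h1
  exact h1

theorem adjoin_class : Algebra.adjoin k (Set.range B.vtxClass ∪ Set.range B.arrClass) = ⊤ := by
  refine eq_top_iff.2 fun d _ => ?_
  obtain ⟨d, rfl⟩ := RingQuot.mkAlgHom_surjective k B.AlgRel d
  induction d using FreeAlgebra.induction with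
  | grade0 c => rw [AlgHom.commutes]; exact Subalgebra.algebraMap_mem _ c
  | grade1 x =>
    rcases x with v | a
    · exact Algebra.subset_adjoin (Or.inl ⟨v, rfl⟩)
    · exact Algebra.subset_adjoin (Or.inr ⟨a, rfl⟩)
  | mul x y hx hy => rw [map_mul]; exact Subalgebra.mul_mem _ (hx trivial) (hy trivial)
  | add x y hx hy => rw [map_add]; exact Subalgebra.add_mem _ (hx trivial) (hy trivial)

theorem exists_lift {L : Type u} [Ring L] [Algebra k L] (f : B.V → L) (g : B.A → L)
    (idem : ∀ v, f v * f v = f v) (orth : ∀ v w, v ≠ w → f v * f w = 0)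
    (complete : ∀ [Fintype B.V], ∑ v, f v = 1) (left : ∀ a, f (B.tgt a) * g a = g a)
    (right : ∀ a, g a * f (B.src a) = g a)
    (rel : ∀ r ∈ B.rel, (r.sum fun p c => c • (g p.2 * g p.1)) = 0) :
    ∃ φ : B.Alg →ₐ[k] L, (∀ v, φ (B.vtxClass v) = f v) ∧ ∀ a, φ (B.arrClass a) = g a := by
  have hv : ∀ v, FreeAlgebra.lift k (Sum.elim f g) (B.vtx v) = f v :=
    fun v => FreeAlgebra.lift_ι_apply _ _
  have ha : ∀ a, FreeAlgebra.lift k (Sum.elim f g) (B.arr a) = g a :=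
    fun a => FreeAlgebra.lift_ι_apply _ _
  have h : ∀ ⦃x y⦄, B.AlgRel x y →
      FreeAlgebra.lift k (Sum.elim f g) x = FreeAlgebra.lift k (Sum.elim f g) y := by
    intro x y h
    induction h with
    | idem v => rw [map_mul, hv, idem]
    | orth v w h => rw [map_mul, hv, hv, map_zero, orth v w h]
    | complete =>
      have := Fintype.ofFinite B.V
      rw [finsum_eq_sum_of_fintype, map_one, map_sum, Finset.sum_congr rfl fun v _ => hv v,
        complete]
    | left a => rw [map_mul, hv, ha, left]
    | right a => rw [map_mul, hv, ha, right]
    | rel r hr =>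
      rw [map_zero, ← rel r hr, Finsupp.sum, Finsupp.sum, map_sum]
      refine Finset.sum_congr rfl fun p _ => ?_
      rw [map_smul, map_mul, ha, ha]
  refine ⟨RingQuot.liftAlgHom k ⟨FreeAlgebra.lift k (Sum.elim f g), h⟩, fun v => ?_, fun a => ?_⟩
  · rw [vtxClass, RingQuot.liftAlgHom_mkAlgHom_apply, hv]
  · rw [arrClass, RingQuot.liftAlgHom_mkAlgHom_apply, ha]

end QuadraticQuiver

/-! ### The isomorphism for the quadratic dual -/

namespace ChainQuiver

open Chain

variable {k : Type u} [Field k] {B : QuadraticQuiver k} {m n : ℕ} (Q : ChainQuiver B m n)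
  [Finite B.V]

open scoped Classical in
/-- The class of the arrow from `x` to `y`, if there is one. -/
noncomputable def arrowClass (x y : Chain m n) : B.DualAlg :=
  if h : ∃ a, Q.pos (B.src a) = x ∧ Q.pos (B.tgt a) = y then B.dual.arrClass h.choose else 0

theorem arrowClass_eq (a : B.A) :
    Q.arrowClass (Q.pos (B.src a)) (Q.pos (B.tgt a)) = B.dual.arrClass a := by
  have h : ∃ b, Q.pos (B.src b) = Q.pos (B.src a) ∧ Q.pos (B.tgt b) = Q.pos (B.tgt a) :=
    ⟨a, rfl, rfl⟩
  rw [arrowClass, dif_pos h, Q.arrow_ext' (Q.pos.injective h.choose_spec.1)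
    (Q.pos.injective h.choose_spec.2)]

/-- The quadratic dual satisfies the relations of the chain quiver. -/
noncomputable def generators : ChainGenerators k m n B.DualAlg where
  e x := B.dual.vtxClass (Q.pos.symm x)
  α := Q.arrowClass
  idem x := B.dual.vtxClass_mul_self _
  orth x y h := B.dual.vtxClass_mul_of_ne (Q.pos.symm.injective.ne h)
  complete := by
    have := Fintype.ofFinite B.dual.V
    rw [← B.dual.sum_vtxClass]
    exact @Fintype.sum_equiv _ B.dual.V _ _ _ _ Q.pos.symm _ _ fun _ => rfl
  left t x y h := by
    obtain ⟨a, rfl, rfl, rfl⟩ := Q.exists_arrow' h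
    rw [arrowClass_eq, Equiv.symm_apply_apply]
    exact B.dual.vtxClass_mul_arrClass a
  right t x y h := by
    obtain ⟨a, rfl, rfl, rfl⟩ := Q.exists_arrow' h
    rw [arrowClass_eq, Equiv.symm_apply_apply]
    exact B.dual.arrClass_mul_vtxClass a
  comm s t x y z w hst hxy hyz hxw hwz := by
    obtain ⟨a, ha1, ha2, ha3⟩ := Q.exists_arrow' hxy
    obtain ⟨b, hb1, hb2, hb3⟩ := Q.exists_arrow' hyz
    obtain ⟨a', ha1', ha2', ha3'⟩ := Q.exists_arrow' hxw
    obtain ⟨b', hb1', hb2', hb3'⟩ := Q.exists_arrow' hwz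
    have hsq : Q.Square a b a' b' := ⟨Q.pos.injective (ha1.trans ha1'.symm),
      Q.pos.injective (ha2.trans hb1.symm), Q.pos.injective (ha2'.trans hb1'.symm),
      ha3.trans hb3'.symm, hb3.trans ha3'.symm, by rw [ha3, hb3]; exact hst⟩
    have e1 := Q.arrowClass_eq a
    have e2 := Q.arrowClass_eq b
    have e3 := Q.arrowClass_eq a'
    have e4 := Q.arrowClass_eq b'
    rw [ha1, ha2] at e1
    rw [hb1, hb2] at e2
    rw [ha1', ha2'] at e3
    rw [hb1', hb2'] at e4
    rw [e1, e2, e3, e4]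
    exact B.dual.arrClass_mul_eq (Q.square_mem_dual hsq)
  zero s t x y z hst hxy hyz hno := by
    obtain ⟨a, ha1, ha2, ha3⟩ := Q.exists_arrow' hxy
    obtain ⟨b, hb1, hb2, hb3⟩ := Q.exists_arrow' hyz
    have e1 := Q.arrowClass_eq a
    have e2 := Q.arrowClass_eq b
    rw [ha1, ha2] at e1
    rw [hb1, hb2] at e2
    rw [e1, e2]
    refine B.dual.arrClass_mul_eq_zero (Q.single_mem_dual (Q.pos.injective (ha2.trans hb1.symm))
      (by rw [ha3, hb3]; exact hst) fun a' b' hsq => hno (Q.pos (B.tgt a')) ?_)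
    have h1 := Q.isUp a'
    rwa [← hsq.src, ha1, ← hsq.dir', hb3] at h1
  adjoin := by
    refine eq_top_iff.2 ?_
    rw [← B.dual.adjoin_class]
    refine Algebra.adjoin_mono ?_
    rintro d (⟨v, rfl⟩ | ⟨a, rfl⟩)
    · exact Or.inl ⟨Q.pos v, congrArg B.dual.vtxClass (Q.pos.symm_apply_apply v)⟩
    · exact Or.inr ⟨_, _, _, Q.isUp a, (Q.arrowClass_eq a).symm⟩

variable {L : Type u} [Ring L] [Algebra k L]

/-- The quadratic dual of a chain quiver is the algebra with the basis of interlaced pairs. -/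
theorem nonempty_dualAlg_equiv (Q : ChainQuiver B m n) (A : RelAlg k L (ChainRel m n)) :
    Nonempty (B.DualAlg ≃ₐ[k] L) := by
  obtain ⟨φ, hv, ha⟩ := B.dual.exists_lift
    (fun v : B.V => A.single (Q.pos v) (Q.pos v))
    (fun a : B.A => A.single (Q.pos (B.src a)) (Q.pos (B.tgt a)))
    (fun v => A.single_mul_single (A.refl _) (A.refl _))
    (fun v w h => A.single_mul_single_of_ne (Q.pos.injective.ne h))
    (by
      intro _
      rw [← A.sum_single_self]
      exact @Fintype.sum_equiv B.dual.V _ _ _ _ _ Q.pos _ _ fun _ => rfl)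
    (fun a => A.single_mul_single (A.refl _) (Q.isUp a).rel)
    (fun a => A.single_mul_single (Q.isUp a).rel (A.refl _))
    (fun r hr => Q.dual_rel_sum_eq_zero A hr)
  refine ⟨AlgEquiv.ofBijective φ (Q.generators.bijective A φ (fun x => ?_) fun t x y h => ?_)⟩
  · refine (hv _).trans ?_
    rw [Equiv.apply_symm_apply]
  · obtain ⟨a, rfl, rfl, rfl⟩ := Q.exists_arrow' h
    exact (congrArg φ (Q.arrowClass_eq a)).trans (ha a)

end ChainQuiver

/-! ## Coordinates on the pyramid and on the cuboid completion -/

section Coordinates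

variable {p : ℕ}

/-- The next entry of `w`, or `-c` after the last one. -/
def nextEntry (c : ℤ) (w : Fin p → ℤ) (t : Fin p) : ℤ :=
  if h : t.val + 1 < p then w ⟨t.val + 1, h⟩ else -c

/-- The vector with the differences of the entries of `w`, each plus one. -/
def ofChain (c : ℤ) (w : Fin p → ℤ) : Fin p → ℤ := fun t => w t + 1 - nextEntry c w t

/-- The vector of the sums of the last entries of `i`, each minus one. -/
def toChain (c : ℤ) (i : Fin p → ℤ) : Fin p → ℤ := fun t => ∑ u ∈ Finset.Ici t, (i u - 1) - c

theorem toChain_eq (c : ℤ) (i : Fin p → ℤ) (t : Fin p) :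
    toChain c i t = i t - 1 + nextEntry c (toChain c i) t := by
  simp only [toChain, nextEntry]
  have h0 : Finset.Ici t = insert t (Finset.Ioi t) := by
    ext u
    simp [le_iff_eq_or_lt]
  rw [h0, Finset.sum_insert (by simp)]
  split_ifs with h
  · have : Finset.Ioi t = Finset.Ici ⟨t.val + 1, h⟩ := by
      ext u
      simp only [Finset.mem_Ioi, Finset.mem_Ici, Fin.lt_def, Fin.le_def]
      omega
    rw [this]
    ring
  · have : Finset.Ioi t = ∅ := by
      ext u
      have := u.2
      simp only [Finset.mem_Ioi, Fin.lt_def, Finset.notMem_empty, iff_false]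
      omega
    rw [this, Finset.sum_empty]
    ring

theorem ofChain_toChain (c : ℤ) (i : Fin p → ℤ) : ofChain c (toChain c i) = i := by
  funext t
  rw [ofChain, toChain_eq]
  ring

/-- The entries are recovered from the last one backwards, starting from the common value -c after
the end. -/
theorem ofChain_injective (c : ℤ) : Function.Injective (ofChain (p := p) c) := by
  intro w w' h
  have key : ∀ l : ℕ, ∀ t : Fin p, t.val + l + 1 = p → w t = w' t := by
    intro l
    induction l with
    | zero =>
      intro t ht
      have h1 := congrFun h t
      simp only [ofChain, nextEntry] at h1
      rw [dif_neg (by omega), dif_neg (by omega)] at h1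
      omega
    | succ l ih =>
      intro t ht
      have h1 := congrFun h t
      have h2 := ih ⟨t.val + 1, by omega⟩ (by simp only; omega)
      simp only [ofChain, nextEntry] at h1
      rw [dif_pos (by omega), dif_pos (by omega)] at h1
      omega
  exact funext fun t => key (p - t.val - 1) t (by omega)

theorem toChain_ofChain (c : ℤ) (w : Fin p → ℤ) : toChain c (ofChain c w) = w :=
  ofChain_injective c (ofChain_toChain c _)

/-- This is the reason for the coordinates: the vector e_t - e_{t-1} is the difference vector of the
t-th unit vector. -/
theorem step_ofChain (c : ℤ) (t : Fin p) (w : Fin p → ℤ) :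
    step t (ofChain c w) = ofChain c fun s => w s + if s = t then 1 else 0 := by
  funext u
  simp only [step, ofChain, nextEntry, Fin.ext_iff]
  split_ifs <;> omega

theorem toChain_step (c : ℤ) (t : Fin p) (i : Fin p → ℤ) :
    toChain c (step t i) = fun s => toChain c i s + if s = t then 1 else 0 := by
  conv_lhs => rw [← ofChain_toChain c i, step_ofChain, toChain_ofChain]

/-- The condition that defines chains. -/
def IsChainVec (m : ℕ) (w : Fin p → ℤ) : Prop := Interlaced w w ∧ ∀ t, 0 ≤ w t ∧ w t < m

theorem antitone_of_nextEntry_le {c : ℤ} {w : Fin p → ℤ} (h : ∀ t, nextEntry c w t ≤ w t)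
    {s t : Fin p} (hst : s ≤ t) : w t ≤ w s := by
  obtain ⟨l, hl⟩ := Nat.exists_eq_add_of_le (Fin.le_def.1 hst)
  induction l generalizing t with
  | zero => exact (congrArg w (Fin.ext hl)).le
  | succ l ih =>
    have h1 := ih (t := ⟨s.val + l, by omega⟩) (Fin.le_def.2 (by simp only; omega)) rfl
    have h2 := h ⟨s.val + l, by omega⟩
    simp only [nextEntry] at h2
    rw [dif_pos (by omega)] at h2
    have h3 : (⟨s.val + l + 1, by omega⟩ : Fin p) = t := Fin.ext (by simp only; omega)
    rw [h3] at h2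
    exact h2.trans h1

theorem neg_le_of_nextEntry_le {c : ℤ} {w : Fin p → ℤ} (h : ∀ t, nextEntry c w t ≤ w t)
    (t : Fin p) : -c ≤ w t := by
  have ht := t.2
  have h1 := h ⟨p - 1, by omega⟩
  simp only [nextEntry] at h1
  rw [dif_neg (by omega)] at h1
  exact h1.trans (antitone_of_nextEntry_le h (Fin.le_def.2 (by simp only; omega)))

/-- Comparison with the next entry suffices; the value 0 placed after the last entry accounts for
nonnegativity. -/
theorem isChain_iff {m : ℕ} (w : Fin p → ℤ) :
    IsChainVec m w ↔ (∀ t, nextEntry 0 w t ≤ w t) ∧ ∀ t, w t < m := by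
  constructor
  · refine fun h => ⟨fun t => ?_, fun t => (h.2 t).2⟩
    simp only [nextEntry]
    split_ifs with ht
    · exact h.1.2 _ _ (Fin.lt_def.2 (Nat.lt_succ_self _))
    · have := (h.2 t).1
      omega
  · refine fun h => ⟨⟨fun _ => le_rfl, fun s t hst => antitone_of_nextEntry_le h.1 hst.le⟩,
      fun t => ⟨?_, h.2 t⟩⟩
    have := neg_le_of_nextEntry_le h.1 t
    omega

theorem toChain_zero_eq_sum (c : ℤ) (i : Fin (p + 1) → ℤ) :
    toChain c i 0 = ∑ u, i u - (p + 1) - c := by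
  have : Finset.Ici (0 : Fin (p + 1)) = Finset.univ := by
    ext u; simp
  rw [toChain, this, Finset.sum_sub_distrib]
  simp

/-- The conditions i_t ≥ 1 say that the sums decrease down to 0. Given them, the bound for s = n,
which is w_1 ≤ m - 1, implies the bounds for smaller s. -/
theorem mem_pyramid_iff {m n : ℕ} (i : Fin n → ℤ) :
    i ∈ pyramid m n ↔ IsChainVec m (toChain 0 i) := by
  have h1 : (∀ t, nextEntry 0 (toChain 0 i) t ≤ toChain 0 i t) ↔ ∀ t, 1 ≤ i t := by
    refine forall_congr' fun t => ?_
    rw [toChain_eq 0 i t]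
    omega
  rw [isChain_iff, h1]
  refine and_congr_right fun hi => ?_
  cases n with
  | zero => exact ⟨fun _ t => t.elim0, fun _ t => t.elim0⟩
  | succ n =>
    have h0 := toChain_zero_eq_sum 0 i
    constructor
    · intro h t
      have h2 := h (Fin.last n)
      have h3 : Finset.Iic (Fin.last n) = Finset.univ := by
        ext u; simp [Fin.le_last]
      rw [h3] at h2
      have h4 := antitone_of_nextEntry_le (h1.2 hi) (Fin.zero_le t)
      simp only [Fin.val_last] at h2
      omega
    · intro h s
      have h2 := h 0
      have h3 : ∑ t ∈ Finset.Iic s, (i t - 1) ≤ ∑ t, (i t - 1) :=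
        Finset.sum_le_sum_of_subset_of_nonneg (Finset.subset_univ _) fun t _ _ => by
          have := hi t
          omega
      rw [Finset.sum_sub_distrib, Finset.sum_sub_distrib] at h3
      simp only [Finset.sum_const, Fin.card_Iic, Finset.card_univ, Fintype.card_fin, nsmul_eq_mul,
        mul_one] at h3
      push_cast at h3
      omega

theorem ofChain_mem_pyramid {m n : ℕ} (w : Chain m n) : ofChain 0 w.1 ∈ pyramid m n := by
  rw [mem_pyramid_iff, toChain_ofChain]
  exact w.2

/-- Without the last coordinate, the last entry of w takes the place of the end value; subtracting
it normalises the end value to 0. -/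
theorem init_ofChain {n : ℕ} (c : ℤ) (w : Fin (n + 1) → ℤ) :
    Fin.init (ofChain c w) = ofChain 0 fun t => w t.castSucc - w (Fin.last n) := by
  funext t
  have ht := t.2
  simp only [Fin.init, ofChain, nextEntry, Fin.val_castSucc]
  rw [dif_pos (by omega)]
  split_ifs with h
  · have : (⟨t.val + 1, by omega⟩ : Fin (n + 1)) = (⟨t.val + 1, h⟩ : Fin n).castSucc := rfl
    rw [this]
    ring
  · have : (⟨t.val + 1, by omega⟩ : Fin (n + 1)) = Fin.last n := Fin.ext (by simp; omega)
    rw [this]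
    ring

theorem mem_barVertices_iff {m n : ℕ} (c : ℤ) (w : Fin (n + 1) → ℤ) :
    ofChain c w ∈ barVertices m n ↔
      IsChainVec m fun t : Fin n => w t.castSucc - w (Fin.last n) := by
  change Fin.init (ofChain c w) ∈ pyramid m n ↔ _
  rw [init_ofChain, mem_pyramid_iff, toChain_ofChain]

theorem ofChain_mem_barVertices {m n : ℕ} (c : ℤ) (w : Chain m (n + 1)) :
    ofChain c w.1 ∈ barVertices m n := by
  rw [mem_barVertices_iff]
  refine ⟨⟨fun _ => le_rfl, fun s t h => ?_⟩, fun t => ?_⟩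
  · have := w.anti (Fin.castSucc_le_castSucc_iff.2 h.le)
    dsimp only
    omega
  · have h1 := w.anti (Fin.le_last t.castSucc)
    have h2 := w.lt t.castSucc
    have h3 := w.nonneg (Fin.last n)
    dsimp only
    omega

/-- The cuboid coordinates a are added to the chain coordinates (x_1, …, x_n, 0). The shift v - 1
makes the last chain entry equal to the last entry of a. -/
theorem barV_eq_ofChain {n : ℕ} (v : ℤ) (x : Fin n → ℤ) (a : Fin (n + 1) → ℤ) :
    barV (Fin.snoc (ofChain 0 x) v) a =
      ofChain (v - 1) (a + (Fin.snoc x 0 : Fin (n + 1) → ℤ)) := by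
  funext u
  cases u using Fin.lastCases with
  | last =>
    simp [barV, ofChain, nextEntry]
    ring
  | cast t =>
    have ht := t.2
    have ht' : t.val + 1 < n + 1 := by omega
    simp only [barV, ofChain, nextEntry, Fin.snoc_castSucc, Fin.val_castSucc, Pi.add_apply,
      dif_pos ht']
    split_ifs with h
    · have : (⟨t.val + 1, by omega⟩ : Fin (n + 1)) = (⟨t.val + 1, h⟩ : Fin n).castSucc := rfl
      rw [this, Fin.snoc_castSucc]
      ring
    · have : (⟨t.val + 1, by omega⟩ : Fin (n + 1)) = Fin.last n := Fin.ext (by simp; omega)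
      rw [this, Fin.snoc_last]
      ring

/-- For w = a + (x, 0) the inequalities on a read w_1 ≤ m - 1, w_{t+1} ≤ x_t ≤ w_t and w_{n+1} ≥ 0.
So w is a chain, and conversely every chain w admits such an x, for instance (w_2, …, w_{n+1}). -/
theorem mem_completionSet_iff {m n : ℕ} (hn : 1 ≤ n) (v : ℤ) (j : barVertices m n) :
    j ∈ completionSet m n v ↔ IsChainVec m (toChain (v - 1) j.1) := by
  obtain ⟨n, rfl⟩ := Nat.exists_eq_add_of_le' hn
  constructor
  · rintro ⟨i, hi, a, ⟨ha1, ha2⟩, h⟩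
    obtain ⟨x, rfl⟩ : ∃ x, i = ofChain 0 x := ⟨_, (ofChain_toChain 0 i).symm⟩
    have hsum := toChain_zero_eq_sum 0 (ofChain 0 x)
    rw [mem_pyramid_iff] at hi
    rw [toChain_ofChain] at hi hsum
    rw [h, barV_eq_ofChain, toChain_ofChain]
    have hx := (isChain_iff x).1 hi
    have h0 := ha2 0
    simp only [cuboidSides, Fin.cons_zero] at h0
    push_cast at h0
    have hle : ∀ t : Fin (n + 1), nextEntry 0 (a + (Fin.snoc x 0 : Fin (n + 2) → ℤ)) t.castSucc ≤
        x t := by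
      intro t
      have h1 := ha2 t.succ
      simp only [cuboidSides, Fin.cons_succ, ofChain, nextEntry] at h1
      simp only [nextEntry, Fin.val_castSucc]
      rw [dif_pos (by omega)]
      have h2 : (⟨t.val + 1, by omega⟩ : Fin (n + 2)) = t.succ := rfl
      rw [h2, Pi.add_apply]
      split_ifs at h1 with h
      · have h3 : t.succ = (⟨t.val + 1, h⟩ : Fin (n + 1)).castSucc := rfl
        rw [h3, Fin.snoc_castSucc]
        rw [h3] at h1
        omega
      · have h3 : t.succ = Fin.last (n + 1) := Fin.ext (by simp; omega)
        rw [h3, Fin.snoc_last]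
        rw [h3] at h1
        omega
    have hanti : ∀ t, nextEntry 0 (a + (Fin.snoc x 0 : Fin (n + 2) → ℤ)) t ≤
        (a + (Fin.snoc x 0 : Fin (n + 2) → ℤ)) t := by
      intro t
      have hat := ha1 t
      simp only [Pi.zero_apply] at hat
      cases t using Fin.lastCases with
      | last => simpa [nextEntry] using hat
      | cast t =>
        have := hle t
        rw [Pi.add_apply, Fin.snoc_castSucc]
        omega
    refine (isChain_iff _).2 ⟨hanti, fun t => ?_⟩
    have h1 := antitone_of_nextEntry_le hanti (Fin.zero_le t)
    have h2 : (a + (Fin.snoc x 0 : Fin (n + 2) → ℤ)) 0 = a 0 + x 0 := by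
      rw [Pi.add_apply]
      rfl
    omega
  · intro hw
    obtain ⟨w, hw'⟩ : ∃ w : Chain m (n + 1 + 1), w.1 = toChain (v - 1) j.1 := ⟨⟨_, hw⟩, rfl⟩
    refine ⟨ofChain 0 w.tailChain.1, ofChain_mem_pyramid _,
      w.1 - (Fin.snoc w.tailChain.1 0 : Fin (n + 2) → ℤ), ⟨fun t => ?_, fun t => ?_⟩, ?_⟩
    · rw [Pi.zero_apply, Pi.sub_apply]
      cases t using Fin.lastCases with
      | last => rw [Fin.snoc_last, sub_zero]; exact w.nonneg _
      | cast t => rw [Fin.snoc_castSucc]; exact sub_nonneg.2 (w.castSucc_ge t)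
    · have hsum := toChain_zero_eq_sum 0 (ofChain 0 w.tailChain.1)
      rw [toChain_ofChain] at hsum
      rw [Pi.sub_apply]
      cases t using Fin.cases with
      | zero =>
        have h1 : (Fin.snoc w.tailChain.1 0 : Fin (n + 2) → ℤ) 0 = w.tailChain.1 0 := rfl
        have h2 := w.lt 0
        simp only [cuboidSides, Fin.cons_zero, h1]
        push_cast
        omega
      | succ t =>
        simp only [cuboidSides, Fin.cons_succ, ofChain, nextEntry]
        have h4 : w.tailChain.1 t = w.1 t.succ := rfl
        split_ifs with h
        · have h3 : t.succ = (⟨t.val + 1, h⟩ : Fin (n + 1)).castSucc := rfl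
          rw [h4]
          conv_lhs => rw [h3, Fin.snoc_castSucc]
          rw [h3]
          omega
        · have h3 : t.succ = Fin.last (n + 1) := Fin.ext (by simp; omega)
          rw [h4, h3, Fin.snoc_last]
          omega
    · rw [barV_eq_ofChain, sub_add_cancel, hw', ofChain_toChain]

end Coordinates

/-! ## The pyramid algebras and the cuboid completions -/

/-- Coordinates in `ℤ^p` on the vertices of `B` that make `B` the bound quiver of a subset of `ℤ^p`
with the arrows `i → i(t)`, zero relations in each direction and anticommutativity of the
squares. -/
structure CubicCoords {k : Type u} [Field k] (B : QuadraticQuiver k) (p : ℕ) where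
  vec : B.V → Fin p → ℤ
  vec_injective : Function.Injective vec
  dir : B.A → Fin p
  vec_tgt : ∀ a, vec (B.tgt a) = step (dir a) (vec (B.src a))
  arrow_ext : ∀ a b, B.src a = B.src b → dir a = dir b → a = b
  exists_arrow : ∀ t x y, vec y = step t (vec x) → ∃ a, B.src a = x ∧ dir a = t
  single_mem : ∀ a b, dir a = dir b → B.tgt a = B.src b → Finsupp.single (a, b) 1 ∈ B.rel
  square_mem : ∀ a b a' b', B.src a = B.src a' → B.tgt a = B.src b → B.tgt a' = B.src b' →
    dir a = dir b' → dir b = dir a' → dir b < dir a →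
    Finsupp.single (a, b) (-1) - Finsupp.single (a', b') 1 ∈ B.rel
  rel_cases : ∀ r ∈ B.rel, (∃ a b, dir a = dir b ∧ r = Finsupp.single (a, b) 1) ∨
    ∃ a b a' b', B.src a = B.src a' ∧ B.tgt a = B.src b ∧ B.tgt a' = B.src b' ∧
      dir a = dir b' ∧ dir b = dir a' ∧ dir b < dir a ∧
      r = Finsupp.single (a, b) (-1) - Finsupp.single (a', b') 1

namespace CubicCoords

variable {k : Type u} [Field k] {B : QuadraticQuiver k} {p : ℕ}

/-- The coordinates of a cubic quiver whose scalars are all `-1`. -/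
def ofCubic {S : Set (Fin p → ℤ)} {d : Fin p → Fin p → (Fin p → ℤ) → kˣ}
    (hd : ∀ s t i, t < s → d s t i = -1) : CubicCoords (cubicQuiver k S d) p where
  vec := fun i => i.1
  vec_injective := Subtype.val_injective
  dir := fun a => a.1.1
  vec_tgt := fun _ => rfl
  arrow_ext := fun _ _ h h' => Subtype.ext (Prod.ext h' (congrArg Subtype.val h))
  exists_arrow := fun t x y h => ⟨⟨(t, x.1), x.2, h ▸ y.2⟩, rfl, rfl⟩
  single_mem := by
    rintro ⟨⟨s, i⟩, h, h1⟩ ⟨⟨t, j⟩, g, g1⟩ hst hj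
    obtain rfl : s = t := hst
    obtain rfl : step s i = j := congrArg Subtype.val hj
    exact Or.inr ⟨s, i, h, h1, g1, rfl⟩
  square_mem := by
    rintro ⟨⟨s, i⟩, h, h1⟩ ⟨⟨t, j⟩, g, g1⟩ ⟨⟨t', i'⟩, e, e1⟩ ⟨⟨s', j'⟩, f, f1⟩ ha hb hc hs ht hlt
    obtain rfl : s = s' := hs
    obtain rfl : t = t' := ht
    obtain rfl : i = i' := congrArg Subtype.val ha
    obtain rfl : step s i = j := congrArg Subtype.val hb
    obtain rfl : step t i = j' := congrArg Subtype.val hc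
    refine Or.inl ⟨s, t, i, hlt, h, e1, h1, f1, g1, ?_⟩
    rw [hd s t i hlt, Units.val_neg, Units.val_one]
    rfl
  rel_cases := by
    rintro r (⟨s, t, i, hlt, h0, ht, hs, hts, hst, rfl⟩ | ⟨t, i, h0, h1, h2, rfl⟩)
    · refine Or.inr ⟨⟨(s, i), h0, hs⟩, ⟨(t, step s i), hs, hst⟩, ⟨(t, i), h0, ht⟩,
        ⟨(s, step t i), ht, hts⟩, rfl, rfl, rfl, rfl, rfl, hlt, ?_⟩
      rw [hd s t i hlt, Units.val_neg, Units.val_one]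
      rfl
    · exact Or.inl ⟨⟨(t, i), h0, h1⟩, ⟨(t, step t i), h1, h2⟩, rfl, rfl⟩

/-- The embedding of the pairs of arrows of a full subquiver. -/
abbrev pairs (B : QuadraticQuiver k) (W : Set B.V) :
    (B.restrict W).A × (B.restrict W).A ↪ B.A × B.A :=
  (Function.Embedding.subtype _).prodMap (Function.Embedding.subtype _)

theorem embDomain_square {W : Set B.V} (a b a' b' : (B.restrict W).A) :
    (Finsupp.single (a, b) (-1) - Finsupp.single (a', b') 1 :
      (B.restrict W).A × (B.restrict W).A →₀ k).embDomain (pairs B W) =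
    Finsupp.single (a.1, b.1) (-1) - Finsupp.single (a'.1, b'.1) 1 := by
  simp only [Finsupp.embDomain_eq_mapDomain, Finsupp.mapDomain_sub, Finsupp.mapDomain_single]
  rfl

theorem exists_of_embDomain_ne_zero {W : Set B.V} {r : (B.restrict W).A × (B.restrict W).A →₀ k}
    {a b : B.A} (h : r.embDomain (pairs B W) (a, b) ≠ 0) :
    ∃ a' b' : (B.restrict W).A, a'.1 = a ∧ b'.1 = b := by
  by_contra hc
  refine h (Finsupp.embDomain_of_notMem_range _ _ _ ?_)
  rintro ⟨⟨a', b'⟩, h'⟩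
  exact hc ⟨a', b', congrArg Prod.fst h', congrArg Prod.snd h'⟩

/-- The coordinates of a full subquiver. -/
def restrict (Q : CubicCoords B p) (W : Set B.V) : CubicCoords (B.restrict W) p where
  vec := fun i => Q.vec i.1
  vec_injective := Q.vec_injective.comp Subtype.val_injective
  dir := fun a => Q.dir a.1
  vec_tgt := fun a => Q.vec_tgt a.1
  arrow_ext := fun a b h h' => Subtype.ext (Q.arrow_ext _ _ (congrArg Subtype.val h) h')
  exists_arrow := by
    intro t x y h
    obtain ⟨a, ha, rfl⟩ := Q.exists_arrow t x.1 y.1 h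
    have hy : B.tgt a = y.1 := Q.vec_injective (by rw [Q.vec_tgt, ha, h])
    exact ⟨⟨a, ha ▸ x.2, hy ▸ y.2⟩, Subtype.ext ha, rfl⟩
  single_mem := by
    intro a b h h'
    change Finsupp.embDomain (pairs B W) _ ∈ B.rel
    rw [Finsupp.embDomain_single]
    exact Q.single_mem _ _ h (congrArg Subtype.val h')
  square_mem := by
    intro a b a' b' h1 h2 h3 h4 h5 h6
    change Finsupp.embDomain (pairs B W) _ ∈ B.rel
    rw [embDomain_square]
    exact Q.square_mem _ _ _ _ (congrArg Subtype.val h1) (congrArg Subtype.val h2)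
      (congrArg Subtype.val h3) h4 h5 h6
  rel_cases := by
    classical
    intro r hr
    change r.embDomain (pairs B W) ∈ B.rel at hr
    -- Extension by zero is injective, and arrows with nonzero coefficient after extension come from
    -- the subquiver. So the shape of a relation of `B` can be pulled back.
    have hinj := Finsupp.embDomain_injective (M := k) (pairs B W)
    rcases Q.rel_cases _ hr with ⟨a, b, h, hr'⟩ | ⟨a, b, a', b', h1, h2, h3, h4, h5, h6, hr'⟩
    · obtain ⟨a, b, rfl, rfl⟩ := exists_of_embDomain_ne_zero (r := r) (a := a) (b := b) (by
        rw [hr', Finsupp.single_eq_same]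
        exact one_ne_zero)
      refine Or.inl ⟨a, b, h, hinj (hr'.trans ?_)⟩
      rw [Finsupp.embDomain_single]
      rfl
    -- The two paths start in different directions, so their coefficients do not cancel.
    · have hne : (a, b) ≠ (a', b') := by
        intro h
        rw [← show a = a' from congrArg Prod.fst h] at h5
        exact h6.ne h5
      obtain ⟨a, b, rfl, rfl⟩ := exists_of_embDomain_ne_zero (r := r) (a := a) (b := b) (by
        rw [hr', Finsupp.sub_apply, Finsupp.single_eq_same, Finsupp.single_eq_of_ne hne, sub_zero]
        exact neg_ne_zero.2 one_ne_zero)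
      obtain ⟨a', b', rfl, rfl⟩ := exists_of_embDomain_ne_zero (r := r) (a := a') (b := b') (by
        rw [hr', Finsupp.sub_apply, Finsupp.single_eq_same, Finsupp.single_eq_of_ne hne.symm,
          zero_sub]
        exact neg_ne_zero.2 one_ne_zero)
      exact Or.inr ⟨a, b, a', b', Subtype.ext h1, Subtype.ext h2, Subtype.ext h3, h4, h5, h6,
        hinj (hr'.trans (embDomain_square a b a' b').symm)⟩

/-- If the coordinates run through the differences of the chains, `B` is a chain quiver. -/
noncomputable def chainQuiver {m : ℕ} (Q : CubicCoords B p) (c : ℤ)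
    (h : ∀ x, IsChainVec m (toChain c (Q.vec x)))
    (h' : ∀ w : Chain m p, ∃ x, Q.vec x = ofChain c w.1) : ChainQuiver B m p where
  pos := Equiv.ofBijective (fun x => (⟨toChain c (Q.vec x), h x⟩ : Chain m p)) (by
    refine ⟨fun x y hxy => Q.vec_injective ?_, fun w => ?_⟩
    · have h1 : toChain c (Q.vec x) = toChain c (Q.vec y) := congrArg Subtype.val hxy
      rw [← ofChain_toChain c (Q.vec x), h1, ofChain_toChain]
    · obtain ⟨x, hx⟩ := h' w
      refine ⟨x, Subtype.ext ?_⟩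
      change toChain c (Q.vec x) = w.1
      rw [hx, toChain_ofChain])
  dir := Q.dir
  isUp := by
    intro a s
    change toChain c (Q.vec (B.tgt a)) s = toChain c (Q.vec (B.src a)) s + _
    rw [Q.vec_tgt, toChain_step]
  arrow_ext := Q.arrow_ext
  exists_arrow := by
    intro t w w' hw
    obtain ⟨x, hx⟩ := h' w
    obtain ⟨y, hy⟩ := h' w'
    obtain ⟨a, rfl, ha⟩ := Q.exists_arrow t x y (by
      rw [hx, hy, step_ofChain]
      exact congrArg _ (funext hw))
    refine ⟨a, Subtype.ext ?_, ha⟩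
    change toChain c (Q.vec (B.src a)) = w.1
    rw [hx, toChain_ofChain]
  single_mem := Q.single_mem
  square_mem := Q.square_mem
  rel_cases := Q.rel_cases

end CubicCoords

/-! ### The choice of g' and the conclusion -/

theorem signTwist_translation (k : Type u) [Field k] (m n : ℕ) :
    IsTranslationTwist m n (signTwist k n) fun _ _ => -1 :=
  fun _ _ _ _ _ => rfl

/-- With g' given by -1 throughout, the new squares anticommute like the old ones, and the
completion is a quiver of the same kind in one dimension more. -/
theorem barTwist_eq (k : Type u) [Field k] {n : ℕ} {s t : Fin (n + 1)} (i : Fin (n + 1) → ℤ)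
    (h : t < s) : barTwist (signTwist k n) (fun _ _ => -1) s t i = -1 := by
  have hs := s.2
  have ht : t.val < n := by
    have := Fin.lt_def.1 h
    omega
  rw [barTwist, dif_pos ht]
  split_ifs <;> rfl

theorem nonempty_pyramid_dualAlg_equiv (k : Type u) [Field k] (m n : ℕ) {L : Type u} [Ring L]
    [Algebra k L] (A : RelAlg k L (ChainRel m n)) :
    Nonempty ((pyramidQuiver k m n (signTwist k n)).DualAlg ≃ₐ[k] L) := by
  let Q : CubicCoords (pyramidQuiver k m n (signTwist k n)) n := .ofCubic fun _ _ _ _ => rfl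
  exact (Q.chainQuiver 0 (fun x => (mem_pyramid_iff x.1).1 x.2)
    fun w => ⟨⟨_, ofChain_mem_pyramid w⟩, rfl⟩).nonempty_dualAlg_equiv A

theorem nonempty_cuboidCompletion_dualAlg_equiv (k : Type u) [Field k] (m : ℕ) {n : ℕ}
    (hn : 1 ≤ n) (v : ℤ) {L : Type u} [Ring L] [Algebra k L]
    (A : RelAlg k L (ChainRel m (n + 1))) :
    Nonempty ((cuboidCompletion k m n (signTwist k n) (fun _ _ => -1) v).DualAlg ≃ₐ[k] L) := by
  let Q : CubicCoords (barQuiver k m n (signTwist k n) fun _ _ => -1) (n + 1) :=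
    .ofCubic fun _ _ i h => barTwist_eq k i h
  refine ((Q.restrict (completionSet m n v)).chainQuiver (v - 1)
    (fun x => (mem_completionSet_iff hn v x.1).1 x.2)
    fun w => ⟨⟨⟨_, ofChain_mem_barVertices _ w⟩, (mem_completionSet_iff hn v _).2 ?_⟩,
      rfl⟩).nonempty_dualAlg_equiv A
  rw [toChain_ofChain]
  exact w.2

/-- In chain coordinates the middle vertex decreases weakly because it lies in Q(n)_0 × ℤ. Its
entries are at least those of the source, hence nonnegative, and at most those of the target, hence
below m. The scalars play no role. -/
theorem isFullBound_completionSet (k : Type u) [Field k] (m : ℕ) {n : ℕ} (hn : 1 ≤ n)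
    (d : Fin n → Fin n → (Fin n → ℤ) → kˣ) (c : Fin n → (Fin n → ℤ) → kˣ) (v : ℤ) :
    (barQuiver k m n d c).IsFullBound (completionSet m n v) := by
  rintro r hr ⟨⟨⟨s, i⟩, hi, hi'⟩, ⟨⟨t, j⟩, hj, hj'⟩⟩ hp h0 h2
  obtain rfl : step s i = j := congrArg Subtype.val ((barQuiver k m n d c).parallel r hr _ hp).1
  have h0 := (mem_completionSet_iff hn v _).1 h0
  have h2 := (mem_completionSet_iff hn v _).1 h2
  refine (mem_completionSet_iff hn v _).2 ?_
  change IsChainVec m (toChain (v - 1) i) at h0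
  change IsChainVec m (toChain (v - 1) (step t (step s i))) at h2
  change IsChainVec m (toChain (v - 1) (step s i))
  have h1 : step s i ∈ barVertices m n := hi'
  rw [← ofChain_toChain (v - 1) (step s i), mem_barVertices_iff] at h1
  rw [toChain_step] at h2
  have h3 := toChain_step (v - 1) s i
  generalize toChain (v - 1) (step s i) = w at *
  refine ⟨⟨fun _ => le_rfl, fun a b hab => ?_⟩, fun a => ⟨?_, ?_⟩⟩
  · cases b using Fin.lastCases with
    | last =>
      cases a using Fin.lastCases with
      | last => exact le_rfl
      | cast a =>
        have := (h1.2 a).1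
        dsimp only at this
        omega
    | cast b =>
      cases a using Fin.lastCases with
      | last => exact absurd hab (not_lt.2 (Fin.le_last _))
      | cast a =>
        have := h1.1.2 a b (Fin.castSucc_lt_castSucc_iff.1 hab)
        dsimp only at this
        omega
  · have := (h0.2 a).1
    rw [h3]
    dsimp only
    split_ifs <;> omega
  · have := (h2.2 a).2
    dsimp only at this
    split_ifs at this <;> omega

theorem mainTheorem5 {k : Type u} [Field k] (m n : ℕ) (hm : 3 ≤ m) (hn : 1 ≤ n) :
    Nonempty ((pyramidQuiver k m n (signTwist k n)).DualAlg ≃ₐ[k] iyamaT k m n) ∧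
    ∃ c : Fin n → (Fin n → ℤ) → kˣ, IsTranslationTwist m n (signTwist k n) c ∧
      ∀ v : ℤ,
        (barQuiver k m n (signTwist k n) c).IsFullBound (completionSet m n v) ∧
        Nonempty ((cuboidCompletion k m n (signTwist k n) c v).DualAlg ≃ₐ[k]
          iyamaT k m (n + 1)) := by
  obtain ⟨A⟩ := nonempty_relAlg_iyamaT k (by omega : 1 ≤ m) hn
  obtain ⟨A'⟩ := nonempty_relAlg_iyamaT k (by omega : 1 ≤ m) (by omega : 1 ≤ n + 1)
  exact ⟨nonempty_pyramid_dualAlg_equiv k m n A, fun _ _ => -1, signTwist_translation k m n,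
    fun v => ⟨isFullBound_completionSet k m hn _ _ v,
      nonempty_cuboidCompletion_dualAlg_equiv k m hn v A'⟩⟩
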